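/- **Theorem 3.1.** Let $\mathfrak g$ be a finite-dimensional simple Lie algebra over $\mathbb C$, $\mathfrak h$ a Cartan subalgebra of dimension $l$, $\Delta$ the root system and $\Delta_+$ a set of positive roots. Let $\langle\cdot,\cdot\rangle$ be the symmetric invariant bilinear form on $\mathfrak g$ with $\langle\alpha,\alpha\rangle=2$ for long roots $\alpha$. For $\alpha\in\Delta_+$ let $t_\alpha\in\mathfrak h$ be given by $\langle t_\alpha,h\rangle=\alpha(h)$, put $h_\alpha=\frac{2}{\langle\alpha,\alpha\rangle}t_\alpha$, and choose root vectors $x_{\pm\alpha}\in\mathfrak g_{\pm\alpha}$ with $[x_\alpha,x_{-\alpha}]=h_\alpha$. Let $k\ge 1$ be an integer. Let $\widehat{\mathfrak g}=\mathfrak g\otimes\mathbb C[t,t^{-1}]\oplus\mathbb CK$ be the affine Lie algebra, with $K$ central and $[x\otimes t^m,y\otimes t^n]=[x,y]\otimes t^{m+n}+m\langle x,y\rangle\delta_{m+n,0}K$. Let $V(k,0)$ be the $\widehat{\mathfrak g}$-module induced from the one-dimensional module $\mathbb C\mathbf 1$ of $\mathfrak g\otimes\mathbb C[t]\oplus\mathbb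 CK$ on which $\mathfrak g\otimes\mathbb C[t]$ acts as $0$ and $K$ as $k$. Write $x(n)$ for the action of $x\otimes t^n$. Then $V(k,0)$ is a vertex operator algebra with vacuum $\mathbf 1$ and $Y(x(-1)\mathbf 1,z)=\sum_{n\in\mathbb Z}x(n)z^{-n-1}$ for $x\in\mathfrak g$; write $Y(u,z)=\sum_{n\in\mathbb Z}u_nz^{-n-1}$. The vertex subalgebra generated by a subset $S$ is the smallest subspace that contains $\mathbf 1$ and $S$ and is closed under all products $u_nv$, $n\in\mathbb Z$. Let $M_{\widehat{\mathfrak h}}(k,0)$ be the Heisenberg vertex subalgebra generated by the vectors $h(-1)\mathbf 1$, $h\in\mathfrak h$, and let $$N(\mathfrak g,k)=\{v\in V(k,0): u_nv=0\text{ for all }u\in M_{\widehat{\mathfrak h}}(k,0),\ n\ge 0\}$$ be its commutant in $V(k,0)$. For $\alpha\in\Delta_+$ put $k_\alpha=\frac{2}{\langle\alpha,\alpha\rangle}k$, $$\omega_\alpha=\frac{1}{2k_\alpha(k_\alpha+2)}\bigl(-k_\alpha h_\alpha(-2)\mathbf 1-h_\alpha(-1)^2\mathbf 1+2k_\alpha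 x_\alpha(-1)x_{-\alpha}(-1)\mathbf 1\bigr),$$ $$W^3_\alpha=k_\alpha^2h_\alpha(-3)\mathbf 1+3k_\alpha h_\alpha(-2)h_\alpha(-1)\mathbf 1+2h_\alpha(-1)^3\mathbf 1-6k_\alpha h_\alpha(-1)x_\alpha(-1)x_{-\alpha}(-1)\mathbf 1+3k_\alpha^2x_\alpha(-2)x_{-\alpha}(-1)\mathbf 1-3k_\alpha^2x_\alpha(-1)x_{-\alpha}(-2)\mathbf 1,$$ and let $\widehat P_\alpha$ be the vertex subalgebra generated by $\omega_\alpha$ and $W^3_\alpha$. Then the vectors $\omega_\alpha$, $W^3_\alpha$ for $\alpha\in\Delta_+$ are $\dim\mathfrak g-l$ in number, and $N(\mathfrak g,k)$ is the vertex subalgebra of $V(k,0)$ generated by them. Equivalently, $N(\mathfrak g,k)$ is the vertex subalgebra generated by the subalgebras $\widehat P_\alpha$, $\alpha\in\Delta_+$. Moreover, for every $\alpha\in\Delta_+$, $\widehat P_\alpha$ with conformal vector $\omega_\alpha$ is isomorphic, as a vertex operator algebra, to $N(\mathfrak{sl}_2,k_\alpha)$ (for the form on $\mathfrak{sl}_2$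 with $\langle h,h\rangle=2$) with its conformal vector $\omega_{\mathrm{aff}}-\omega_{\mathfrak h}$, where $$\omega_{\mathrm{aff}}=\tfrac{1}{2(k_\alpha+2)}\bigl(\tfrac12h(-1)^2\mathbf 1+e(-1)f(-1)\mathbf 1+f(-1)e(-1)\mathbf 1\bigr),\qquad \omega_{\mathfrak h}=\tfrac{1}{4k_\alpha}h(-1)^2\mathbf 1.$$ -/

import Mathlib

namespace Parafermion
noncomputable section

set_option linter.unusedSectionVars false
section Fields
variable {V : Type*} [AddCommGroup V] [Module ℂ V]

variable (V) in
/-- The space of fields `A(z) = ∑ₙ A_n z^{-n-1}` on `V`: sequences of modes `A_n ∈ End V` such that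
for every `v ∈ V`, `A_n v = 0` for all sufficiently large `n`. -/
def FieldSpace : Submodule ℂ (ℤ → Module.End ℂ V) where
  carrier := {A | ∀ v, ∃ N : ℤ, ∀ n, N ≤ n → A n v = 0}
  add_mem' {A B} hA hB v := by
    obtain ⟨N, hN⟩ := hA v
    obtain ⟨M, hM⟩ := hB v
    exact ⟨max N M, fun n hn => by
      simp [hN n (le_trans (le_max_left _ _) hn), hM n (le_trans (le_max_right _ _) hn)]⟩
  zero_mem' v := ⟨0, fun n _ => by simp⟩
  smul_mem' c A hA v := by
    obtain ⟨N, hN⟩ := hA v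
    exact ⟨N, fun n hn => by simp [hN n hn]⟩

variable (V) in
/-- The identity field: `1(z) = id`, i.e. `1_{-1} = id` and `1_n = 0` otherwise. -/
def idField : FieldSpace V :=
  ⟨fun n => if n = -1 then LinearMap.id else 0, fun v => ⟨0, fun n hn => by
    simp [show n ≠ -1 by omega]⟩⟩

/-- The coefficient `(-1)^j * binom(m, j)` of the binomial expansion. -/
def bcoef (m : ℤ) (j : ℕ) : ℤ := (-1) ^ j * Ring.choose m j

lemma field_exists_nat (A : FieldSpace V) (n : ℤ) (v : V) :
    ∃ N : ℕ, ∀ j : ℕ, N ≤ j → A.1 (n + j) v = 0 := by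
  obtain ⟨N, hN⟩ := A.2 v
  exact ⟨(N - n).toNat, fun j hj => hN _ (by omega)⟩

lemma fsupp {f : ℕ → V} (h : ∃ N : ℕ, ∀ j : ℕ, N ≤ j → f j = 0) :
    (Function.support f).Finite := by
  obtain ⟨N, hN⟩ := h
  refine (Finset.range N).finite_toSet.subset fun j hj => ?_
  by_contra hc
  simp only [Finset.coe_range, Set.mem_Iio, not_lt] at hc
  exact hj (hN j hc)

lemma finsum_eq_range {f : ℕ → V} (N : ℕ) (h : ∀ j : ℕ, N ≤ j → f j = 0) :
    ∑ᶠ j, f j = ∑ j ∈ Finset.range N, f j := by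
  refine finsum_eq_sum_of_support_subset f fun j hj => ?_
  by_contra hc
  simp only [Finset.coe_range, Set.mem_Iio, not_lt] at hc
  exact hj (h j hc)

lemma leftSupp (a : ℤ → Module.End ℂ V) (m : ℤ) (A : FieldSpace V) (n : ℤ) (v : V) :
    (Function.support fun j : ℕ => bcoef m j • a (m - j) (A.1 (n + j) v)).Finite := by
  obtain ⟨N, hN⟩ := field_exists_nat A n v
  exact fsupp ⟨N, fun j hj => by simp [hN j hj]⟩

lemma rightSupp (a : FieldSpace V) (m : ℤ) (A : ℤ → Module.End ℂ V) (n : ℤ) (v : V) :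
    (Function.support fun j : ℕ => bcoef m j • A (m + n - j) (a.1 j v)).Finite := by
  obtain ⟨N, hN⟩ := field_exists_nat a 0 v
  exact fsupp ⟨N, fun j hj => by have := hN j hj; simp_all⟩

/-- `∑_{j ≥ 0} (-1)^j binom(m, j) a_{m-j} A_{n+j}`, i.e. `Res_{z₁} (z₁ - z)^m a(z₁) A(z)`. -/
def leftProd (a : ℤ → Module.End ℂ V) (m : ℤ) : Module.End ℂ (FieldSpace V) where
  toFun A := ⟨fun n =>
    { toFun v := ∑ᶠ j : ℕ, bcoef m j • a (m - j) (A.1 (n + j) v)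
      map_add' v w := by
        simp only [map_add, smul_add]
        exact finsum_add_distrib (leftSupp a m A n v) (leftSupp a m A n w)
      map_smul' c v := by
        simp only [map_smul, RingHom.id_apply]
        rw [smul_finsum' c (leftSupp a m A n v)]
        exact finsum_congr fun j => smul_comm _ _ _ }, fun v => by
    obtain ⟨N, hN⟩ := A.2 v
    refine ⟨N, fun n hn => ?_⟩
    refine (finsum_congr fun j => ?_).trans finsum_zero
    rw [hN (n + j) (by omega)]; simp⟩
  map_add' A B := by
    ext n v
    simp only [Submodule.coe_add, Pi.add_apply, LinearMap.add_apply, map_add, smul_add,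
      LinearMap.coe_mk, AddHom.coe_mk]
    exact finsum_add_distrib (leftSupp a m A n v) (leftSupp a m B n v)
  map_smul' c A := by
    ext n v
    simp only [Submodule.coe_smul, Pi.smul_apply, LinearMap.smul_apply, map_smul,
      LinearMap.coe_mk, AddHom.coe_mk, RingHom.id_apply]
    rw [smul_finsum' c (leftSupp a m A n v)]
    exact finsum_congr fun j => smul_comm _ _ _

/-- `∑_{j ≥ 0} (-1)^j binom(m, j) A_{m+n-j} a_j`,
i.e. `(-1)^m Res_{z₁} (-z + z₁)^m A(z) a(z₁)`. -/
def rightProd (a : FieldSpace V) (m : ℤ) : Module.End ℂ (FieldSpace V) where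
  toFun A := ⟨fun n =>
    { toFun v := ∑ᶠ j : ℕ, bcoef m j • A.1 (m + n - j) (a.1 j v)
      map_add' v w := by
        simp only [map_add, smul_add]
        exact finsum_add_distrib (rightSupp a m A.1 n v) (rightSupp a m A.1 n w)
      map_smul' c v := by
        simp only [map_smul, RingHom.id_apply]
        rw [smul_finsum' c (rightSupp a m A.1 n v)]
        exact finsum_congr fun j => smul_comm _ _ _ }, fun v => by
    obtain ⟨N, hN⟩ := field_exists_nat a 0 v
    choose M hM using fun j : ℕ => A.2 (a.1 j v)
    obtain ⟨K, hK⟩ := ((Finset.range N).image fun j => M j + j - m).bddAbove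
    refine ⟨K, fun n hn => ?_⟩
    refine (finsum_congr fun j => ?_).trans finsum_zero
    by_cases hj : N ≤ j
    · have := hN j hj
      simp_all
    · rw [hM j _ _]
      · simp
      · have := hK (Finset.mem_coe.2 (Finset.mem_image_of_mem _ (Finset.mem_range.2 (not_le.1 hj))))
        omega⟩
  map_add' A B := by
    ext n v
    simp only [Submodule.coe_add, Pi.add_apply, LinearMap.add_apply, smul_add,
      LinearMap.coe_mk, AddHom.coe_mk]
    exact finsum_add_distrib (rightSupp a m A.1 n v) (rightSupp a m B.1 n v)
  map_smul' c A := by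
    ext n v
    simp only [Submodule.coe_smul, Pi.smul_apply, LinearMap.smul_apply,
      LinearMap.coe_mk, AddHom.coe_mk, RingHom.id_apply]
    rw [smul_finsum' c (rightSupp a m A.1 n v)]
    exact finsum_congr fun j => smul_comm _ _ _

/-- The residue product
`Res_{z₁} ((z₁ - z)^m a(z₁) A(z) - (-z + z₁)^m A(z) a(z₁))` of fields. Its `n`-th mode is
`∑_{j ≥ 0} (-1)^j binom(m, j) (a_{m-j} A_{n+j} - (-1)^m A_{m+n-j} a_j)`. -/
def residueProd (a : FieldSpace V) (m : ℤ) : Module.End ℂ (FieldSpace V) :=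
  leftProd a.1 m - (m.negOnePow : ℤ) • rightProd a m

lemma leftProd_apply (a : ℤ → Module.End ℂ V) (m : ℤ) (A : FieldSpace V) (n : ℤ) (v : V) :
    (leftProd a m A).1 n v = ∑ᶠ j : ℕ, bcoef m j • a (m - j) (A.1 (n + j) v) := rfl

lemma rightProd_apply (a : FieldSpace V) (m : ℤ) (A : FieldSpace V) (n : ℤ) (v : V) :
    (rightProd a m A).1 n v = ∑ᶠ j : ℕ, bcoef m j • A.1 (m + n - j) (a.1 j v) := rfl

lemma sum_square (N : ℕ) (f : ℕ → ℕ → V) (h : ∀ i j, N ≤ i + j → f i j = 0) :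
    ∑ i ∈ Finset.range N, ∑ j ∈ Finset.range N, f i j =
      ∑ s ∈ Finset.range N, ∑ ij ∈ Finset.HasAntidiagonal.antidiagonal s, f ij.1 ij.2 := by
  simp_rw [Finset.Nat.sum_antidiagonal_eq_sum_range_succ (fun i j => f i j),
    Finset.sum_range_diag_flip]
  refine Finset.sum_congr rfl fun i hi => ?_
  refine (Finset.sum_subset (Finset.range_mono (Nat.sub_le N i)) fun j _ hj => ?_).symm
  refine h i j ?_
  simp only [Finset.mem_range, not_lt] at hj
  omega

lemma bcoef_add (m p : ℤ) (s : ℕ) :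
    ∑ ij ∈ Finset.HasAntidiagonal.antidiagonal s, bcoef m ij.1 * bcoef p ij.2 = bcoef (m + p) s := by
  rw [bcoef, Ring.add_choose_eq s (Commute.all m p), Finset.mul_sum]
  refine Finset.sum_congr rfl fun ij hij => ?_
  rw [← Finset.HasAntidiagonal.mem_antidiagonal.1 hij, pow_add, bcoef, bcoef]
  ring

lemma bcoef_sub_mul (m : ℤ) (i : ℕ) : (m - i) * bcoef m i = m * bcoef (m - 1) i := by
  have h : (m - i) * Ring.choose m i = m * Ring.choose (m - 1) i := by
    have h1 := Ring.descPochhammer_eq_factorial_smul_choose m i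
    have h2 := Ring.descPochhammer_eq_factorial_smul_choose (m - 1) i
    have hf : (i.factorial : ℤ) ≠ 0 := by positivity
    apply mul_left_cancel₀ hf
    have e1 : (descPochhammer ℤ (i + 1)).smeval m = m * (descPochhammer ℤ i).smeval (m - 1) := by
      rw [descPochhammer_succ_left, Polynomial.smeval_X_mul, Polynomial.smeval_comp]
      simp
    have e2 : (descPochhammer ℤ (i + 1)).smeval m = (descPochhammer ℤ i).smeval m * (m - i) := by
      rw [descPochhammer_succ_right, Polynomial.smeval_mul, Polynomial.smeval_sub,
        Polynomial.smeval_X, Polynomial.smeval_natCast]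
      simp
    rw [nsmul_eq_mul] at h1 h2
    linear_combination (-(m - i)) * h1 + m * h2 + e1 - e2
  rw [bcoef, bcoef]
  linear_combination (-1) ^ i * h

lemma bcoef_sub_add (m p : ℤ) (s : ℕ) :
    ∑ ij ∈ Finset.HasAntidiagonal.antidiagonal s, (m - ij.1) * (bcoef m ij.1 * bcoef p ij.2) =
      m * bcoef (m + p - 1) s := by
  rw [show m + p - 1 = (m - 1) + p by ring, ← bcoef_add, Finset.mul_sum]
  refine Finset.sum_congr rfl fun ij _ => ?_
  rw [← mul_assoc, bcoef_sub_mul, mul_assoc]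

lemma bcoef_pred (s : ℕ) : bcoef ((s : ℤ) - 1) s = if s = 0 then 1 else 0 := by
  cases s with
  | zero => simp [bcoef]
  | succ s =>
    have : ((s + 1 : ℕ) : ℤ) - 1 = (s : ℤ) := by push_cast; ring
    rw [this, bcoef, Ring.choose_natCast]
    simp

variable {a b c : FieldSpace V} {κ : ℂ}

lemma leftProd_comm
    (hab : ∀ (m n : ℤ) (v : V), a.1 m (b.1 n v) - b.1 n (a.1 m v) =
      c.1 (m + n) v + (if m + n = 0 then (m : ℂ) * κ else 0) • v)
    (m p : ℤ) (A : FieldSpace V) :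
    leftProd a.1 m (leftProd b.1 p A) - leftProd b.1 p (leftProd a.1 m A) =
      leftProd c.1 (m + p) A + (if m + p = 0 then (m : ℂ) * κ else 0) • A := by
  ext n v
  obtain ⟨N₀, hN₀⟩ := field_exists_nat A n v
  obtain ⟨N, rfl, hN⟩ : ∃ N : ℕ, N = N₀ + 1 ∧ ∀ j : ℕ, N ≤ j → A.1 (n + j) v = 0 :=
    ⟨N₀ + 1, rfl, fun j hj => hN₀ j (by omega)⟩
  have hin (x : ℤ → Module.End ℂ V) (q : ℤ) (i : ℕ) : (leftProd x q A).1 (n + i) v =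
      ∑ j ∈ Finset.range (N₀ + 1), bcoef q j • x (q - j) (A.1 (n + (i + j : ℕ)) v) := by
    rw [leftProd_apply, finsum_eq_range (N₀ + 1)]
    · simp [add_assoc]
    · intro j hj
      have := hN (i + j) (by omega)
      rw [add_assoc, ← Nat.cast_add, this]; simp
  have hout (x y : ℤ → Module.End ℂ V) (q r : ℤ) : (leftProd x q (leftProd y r A)).1 n v =
      ∑ i ∈ Finset.range (N₀ + 1), ∑ j ∈ Finset.range (N₀ + 1), (bcoef q i * bcoef r j) •
        x (q - i) (y (r - j) (A.1 (n + (i + j : ℕ)) v)) := by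
    rw [leftProd_apply, finsum_eq_range (N₀ + 1)]
    · refine Finset.sum_congr rfl fun i _ => ?_
      rw [hin, map_sum, Finset.smul_sum]
      refine Finset.sum_congr rfl fun j _ => ?_
      rw [map_zsmul, smul_smul]
    · intro i hi
      rw [hin, Finset.sum_eq_zero, map_zero, smul_zero]
      intro j _
      rw [hN (i + j) (by omega)]; simp
  change (leftProd a.1 m (leftProd b.1 p A)).1 n v - (leftProd b.1 p (leftProd a.1 m A)).1 n v =
    (leftProd c.1 (m + p) A).1 n v + (if m + p = 0 then (m : ℂ) * κ else 0) • A.1 n v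
  rw [hout, hout, Finset.sum_comm (f := fun i j => (bcoef p i * bcoef m j) •
        b.1 (p - i) (a.1 (m - j) (A.1 (n + (i + j : ℕ)) v))), ← Finset.sum_sub_distrib]
  simp_rw [← Finset.sum_sub_distrib]
  have key (i j : ℕ) : (bcoef m i * bcoef p j) • a.1 (m - i) (b.1 (p - j) (A.1 (n + (i + j : ℕ)) v))
      - (bcoef p j * bcoef m i) • b.1 (p - j) (a.1 (m - i) (A.1 (n + (j + i : ℕ)) v)) =
      (bcoef m i * bcoef p j) • (c.1 (m + p - (i + j : ℕ)) (A.1 (n + (i + j : ℕ)) v)) +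
      ((m - i) * (bcoef m i * bcoef p j)) •
        ((if m + p - (i + j : ℕ) = 0 then κ else 0) • (A.1 (n + (i + j : ℕ)) v)) := by
    rw [mul_comm (bcoef p j), add_comm j i, ← smul_sub, hab,
      show m - (i : ℤ) + (p - j) = m + p - (i + j : ℕ) by push_cast; ring, smul_add, mul_comm (m - i : ℤ),
      mul_smul _ (m - i : ℤ)]
    congr 2
    rw [← Int.cast_smul_eq_zsmul ℂ, smul_smul]
    congr 1
    split_ifs <;> simp
  simp_rw [key]
  rw [sum_square]
  swap
  · intro i j hij
    rw [hN _ hij]; simp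
  have key2 (s : ℕ) : ∑ ij ∈ Finset.HasAntidiagonal.antidiagonal s,
      ((bcoef m ij.1 * bcoef p ij.2) • (c.1 (m + p - (ij.1 + ij.2 : ℕ)) (A.1 (n + (ij.1 + ij.2 : ℕ)) v)) +
      ((m - ij.1) * (bcoef m ij.1 * bcoef p ij.2)) •
        ((if m + p - (ij.1 + ij.2 : ℕ) = 0 then κ else 0) • (A.1 (n + (ij.1 + ij.2 : ℕ)) v))) =
      bcoef (m + p) s • c.1 (m + p - s) (A.1 (n + s) v) +
        if s = 0 then (if m + p = 0 then (m : ℂ) * κ else 0) • A.1 n v else 0 := by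
    rw [Finset.sum_add_distrib]
    congr 1
    · rw [← bcoef_add, Finset.sum_smul]
      refine Finset.sum_congr rfl fun ij hij => ?_
      rw [Finset.HasAntidiagonal.mem_antidiagonal.1 hij]
    · trans (m * bcoef (m + p - 1) s) • ((if m + p - s = 0 then κ else 0) • A.1 (n + s) v)
      · rw [← bcoef_sub_add, Finset.sum_smul]
        refine Finset.sum_congr rfl fun ij hij => ?_
        rw [Finset.HasAntidiagonal.mem_antidiagonal.1 hij]
      · by_cases hs : m + p - s = 0
        · rw [show m + p - 1 = (s : ℤ) - 1 by omega, bcoef_pred]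
          by_cases h0 : s = 0
          · subst h0
            have hmp : m + p = 0 := by simpa using hs
            rw [if_pos rfl, if_pos rfl, if_pos hmp, ← Int.cast_smul_eq_zsmul ℂ, smul_smul]
            simp [hmp]
          · simp [h0]
        · rw [if_neg hs]
          by_cases h0 : s = 0
          · subst h0
            have hmp : m + p ≠ 0 := by simpa using hs
            simp [hmp]
          · simp [h0]
  simp_rw [key2]
  rw [Finset.sum_add_distrib, Finset.sum_ite_eq' , if_pos (by simp), leftProd_apply,
    finsum_eq_range (N₀ + 1)]
  intro j hj
  rw [hN j hj]; simp

lemma rightProd_comm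
    (hab : ∀ (m n : ℤ) (v : V), a.1 m (b.1 n v) - b.1 n (a.1 m v) =
      c.1 (m + n) v + (if m + n = 0 then (m : ℂ) * κ else 0) • v)
    (m p : ℤ) (A : FieldSpace V) :
    rightProd a m (rightProd b p A) - rightProd b p (rightProd a m A) =
      - rightProd c (m + p) A := by
  ext n v
  have hbd (x y : FieldSpace V) : ∃ N : ℕ, ∀ i j : ℕ, N ≤ i ∨ N ≤ j → y.1 j (x.1 i v) = 0 := by
    obtain ⟨N, hN⟩ := field_exists_nat x 0 v
    choose M hM using fun i : ℕ => field_exists_nat y 0 (x.1 i v)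
    refine ⟨N + ∑ i ∈ Finset.range N, M i, fun i j hij => ?_⟩
    by_cases hi : N ≤ i
    · have := hN i hi
      rw [zero_add] at this
      rw [this, map_zero]
    · have h1 : M i ≤ ∑ i ∈ Finset.range N, M i :=
        Finset.single_le_sum (f := M) (fun _ _ => Nat.zero_le _) (Finset.mem_range.2 (not_le.1 hi))
      have := hM i j (by omega)
      rwa [zero_add] at this
  obtain ⟨N₁, h1⟩ := hbd a b
  obtain ⟨N₂, h2⟩ := hbd b a
  obtain ⟨N₃, h3⟩ := field_exists_nat c 0 v
  obtain ⟨N, hN1, hN2, hN3⟩ : ∃ N : ℕ, N₁ ≤ N ∧ N₂ ≤ N ∧ N₃ ≤ N :=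
    ⟨N₁ + N₂ + N₃, by omega, by omega, by omega⟩
  replace h3 (s : ℕ) (hs : N ≤ s) : c.1 s v = 0 := by
    have := h3 s (by omega)
    rwa [zero_add] at this
  have hout (x y : FieldSpace V) (q r : ℤ)
      (h : ∀ i j : ℕ, N ≤ i ∨ N ≤ j → y.1 j (x.1 i v) = 0) :
      (rightProd x q (rightProd y r A)).1 n v =
      ∑ i ∈ Finset.range N, ∑ j ∈ Finset.range N, (bcoef q i * bcoef r j) •
        A.1 (q + r + n - (i + j : ℕ)) (y.1 j (x.1 i v)) := by
    have hin (i : ℕ) : (rightProd y r A).1 (q + n - i) (x.1 i v) =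
        ∑ j ∈ Finset.range N, bcoef r j • A.1 (q + r + n - (i + j : ℕ)) (y.1 j (x.1 i v)) := by
      rw [rightProd_apply, finsum_eq_range N]
      · refine Finset.sum_congr rfl fun j _ => ?_
        rw [show r + (q + n - (i : ℤ)) - j = q + r + n - (i + j : ℕ) by push_cast; ring]
      · intro j hj
        rw [h i j (Or.inr hj)]; simp
    rw [rightProd_apply, finsum_eq_range N]
    · refine Finset.sum_congr rfl fun i _ => ?_
      rw [hin, Finset.smul_sum]
      simp_rw [smul_smul]
    · intro i hi
      rw [hin, Finset.sum_eq_zero, smul_zero]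
      intro j _
      rw [h i j (Or.inl hi)]; simp
  change (rightProd a m (rightProd b p A)).1 n v - (rightProd b p (rightProd a m A)).1 n v =
    - (rightProd c (m + p) A).1 n v
  rw [hout a b m p fun i j hij => h1 i j (by omega), hout b a p m fun i j hij => h2 i j (by omega),
    Finset.sum_comm (f := fun i j => (bcoef p i * bcoef m j) •
        A.1 (p + m + n - (i + j : ℕ)) (a.1 j (b.1 i v))), ← Finset.sum_sub_distrib]
  simp_rw [← Finset.sum_sub_distrib]
  have key (i j : ℕ) : (bcoef m i * bcoef p j) • A.1 (m + p + n - (i + j : ℕ)) (b.1 j (a.1 i v))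
      - (bcoef p j * bcoef m i) • A.1 (p + m + n - (j + i : ℕ)) (a.1 i (b.1 j v)) =
      - (bcoef m i * bcoef p j) • A.1 (m + p + n - (i + j : ℕ)) (c.1 (i + j : ℕ) v) := by
    have := hab i j v
    rw [show (if (i : ℤ) + j = 0 then ((i : ℤ) : ℂ) * κ else 0) = 0 by
      split_ifs with h0
      · rw [show i = 0 by omega]; simp
      · rfl, zero_smul, add_zero, ← Nat.cast_add] at this
    rw [← this, mul_comm (bcoef p j), add_comm j i, add_comm p m, ← smul_sub, ← map_sub, neg_smul,
      ← smul_neg, ← map_neg, neg_sub]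
  simp_rw [key]
  rw [sum_square]
  swap
  · intro i j hij
    rw [h3 _ hij]; simp
  have key2 (s : ℕ) : ∑ ij ∈ Finset.HasAntidiagonal.antidiagonal s,
      - (bcoef m ij.1 * bcoef p ij.2) • A.1 (m + p + n - (ij.1 + ij.2 : ℕ)) (c.1 (ij.1 + ij.2 : ℕ) v)
      = - (bcoef (m + p) s • A.1 (m + p + n - s) (c.1 s v)) := by
    rw [← bcoef_add, Finset.sum_smul, ← Finset.sum_neg_distrib]
    refine Finset.sum_congr rfl fun ij hij => ?_
    rw [Finset.HasAntidiagonal.mem_antidiagonal.1 hij, neg_smul]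
  simp_rw [key2]
  rw [Finset.sum_neg_distrib, rightProd_apply, finsum_eq_range N]
  intro j hj
  rw [h3 j hj]; simp

lemma left_rightProd_comm (x : ℤ → Module.End ℂ V) (y : FieldSpace V) (m p : ℤ)
    (A : FieldSpace V) :
    leftProd x m (rightProd y p A) = rightProd y p (leftProd x m A) := by
  ext n v
  obtain ⟨N, hN⟩ := field_exists_nat y 0 v
  replace hN (j : ℕ) (hj : N ≤ j) : y.1 j v = 0 := by
    have := hN j hj
    rwa [zero_add] at this
  choose M hM using fun j : ℕ => field_exists_nat A (p + n - j) (y.1 j v)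
  have hK (i j : ℕ) (hi : ∑ j ∈ Finset.range N, M j ≤ i) :
      A.1 (p + n - j + i) (y.1 j v) = 0 := by
    by_cases hj : N ≤ j
    · rw [hN j hj, map_zero]
    · have h1 : M j ≤ ∑ j ∈ Finset.range N, M j :=
        Finset.single_le_sum (f := M) (fun _ _ => Nat.zero_le _) (Finset.mem_range.2 (not_le.1 hj))
      exact hM j i (by omega)
  change (leftProd x m (rightProd y p A)).1 n v = (rightProd y p (leftProd x m A)).1 n v
  have h1 (i : ℕ) : (rightProd y p A).1 (n + i) v =
      ∑ j ∈ Finset.range N, bcoef p j • A.1 (p + n - j + i) (y.1 j v) := by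
    rw [rightProd_apply, finsum_eq_range N]
    · refine Finset.sum_congr rfl fun j _ => ?_
      rw [show p + (n + (i : ℤ)) - j = p + n - j + i by ring]
    · intro j hj
      rw [hN j hj]; simp
  have h2 (j : ℕ) : (leftProd x m A).1 (p + n - j) (y.1 j v) =
      ∑ i ∈ Finset.range (∑ j ∈ Finset.range N, M j),
        bcoef m i • x (m - i) (A.1 (p + n - j + i) (y.1 j v)) := by
    rw [leftProd_apply, finsum_eq_range]
    intro i hi
    rw [hK i j hi]; simp
  rw [leftProd_apply, rightProd_apply, finsum_eq_range (∑ j ∈ Finset.range N, M j),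
    finsum_eq_range N]
  · simp_rw [h1, h2, map_sum, Finset.smul_sum, map_zsmul]
    rw [Finset.sum_comm]
    refine Finset.sum_congr rfl fun i _ => Finset.sum_congr rfl fun j _ => ?_
    rw [smul_comm]
  · intro j hj
    rw [hN j hj]; simp
  · intro i hi
    rw [h1, Finset.sum_eq_zero, map_zero, smul_zero]
    intro j _
    rw [hK i j hi]; simp

lemma residueProd_comm
    (hab : ∀ (m n : ℤ) (v : V), a.1 m (b.1 n v) - b.1 n (a.1 m v) =
      c.1 (m + n) v + (if m + n = 0 then (m : ℂ) * κ else 0) • v)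
    (m p : ℤ) (A : FieldSpace V) :
    residueProd a m (residueProd b p A) - residueProd b p (residueProd a m A) =
      residueProd c (m + p) A + (if m + p = 0 then (m : ℂ) * κ else 0) • A := by
  have h1 := leftProd_comm hab m p A
  have h2 := rightProd_comm hab m p A
  have h3 := left_rightProd_comm a.1 b m p A
  have h4 := left_rightProd_comm b.1 a p m A
  simp only [residueProd, LinearMap.sub_apply, LinearMap.smul_apply, map_sub, map_zsmul,
    Int.negOnePow_add, Units.val_mul, mul_smul] at *
  generalize ((m.negOnePow : ℤˣ) : ℤ) = e at *
  generalize ((p.negOnePow : ℤˣ) : ℤ) = f at *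
  rw [h3, h4]
  rw [sub_eq_iff_eq_add] at h1 h2
  rw [h1, h2]
  simp only [smul_sub, smul_add, smul_neg, smul_comm f e]
  abel

lemma residueProd_add (a b : FieldSpace V) (m : ℤ) :
    residueProd (a + b) m = residueProd a m + residueProd b m := by
  have h1 : leftProd (a + b).1 m = leftProd a.1 m + leftProd b.1 m := by
    ext A n v
    change ∑ᶠ j : ℕ, bcoef m j • (a.1 (m - j) (A.1 (n + j) v) + b.1 (m - j) (A.1 (n + j) v)) = _
    simp only [smul_add]
    exact finsum_add_distrib (leftSupp a.1 m A n v) (leftSupp b.1 m A n v)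
  have h2 : rightProd (a + b) m = rightProd a m + rightProd b m := by
    ext A n v
    change ∑ᶠ j : ℕ, bcoef m j • A.1 (m + n - j) (a.1 j v + b.1 j v) = _
    simp only [map_add, smul_add]
    exact finsum_add_distrib (rightSupp a m A.1 n v) (rightSupp b m A.1 n v)
  rw [residueProd, residueProd, residueProd, h1, h2, smul_add]
  abel

lemma residueProd_smul (r : ℂ) (a : FieldSpace V) (m : ℤ) :
    residueProd (r • a) m = r • residueProd a m := by
  have h1 : leftProd (r • a).1 m = r • leftProd a.1 m := by
    ext A n v
    change ∑ᶠ j : ℕ, bcoef m j • (r • a.1 (m - j) (A.1 (n + j) v)) =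
      r • ∑ᶠ j : ℕ, bcoef m j • (a.1 (m - j) (A.1 (n + j) v))
    rw [smul_finsum' r (leftSupp a.1 m A n v)]
    exact finsum_congr fun j => smul_comm _ _ _
  have h2 : rightProd (r • a) m = r • rightProd a m := by
    ext A n v
    change ∑ᶠ j : ℕ, bcoef m j • A.1 (m + n - j) (r • a.1 j v) =
      r • ∑ᶠ j : ℕ, bcoef m j • A.1 (m + n - j) (a.1 j v)
    rw [smul_finsum' r (rightSupp a m A.1 n v)]
    exact finsum_congr fun j => by rw [map_smul, smul_comm]
  rw [residueProd, residueProd, h1, h2]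
  ext1 A
  simp only [LinearMap.sub_apply, LinearMap.smul_apply, smul_sub]
  rw [smul_comm r]

lemma leftProd_idField (a : ℤ → Module.End ℂ V) (m n : ℤ) (v : V) :
    (leftProd a m (idField V)).1 n v =
      if 0 ≤ -1 - n then bcoef m (-1 - n).toNat • a (m + n + 1) v else 0 := by
  rw [leftProd_apply]
  split_ifs with h
  · rw [finsum_eq_single _ (-1 - n).toNat]
    · rw [Int.toNat_of_nonneg h, show n + (-1 - n) = -1 by ring,
        show m - (-1 - n) = m + n + 1 by ring]
      simp [idField]
    · intro j hj
      have : n + (j : ℤ) ≠ -1 := by omega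
      simp [idField, this]
  · refine (finsum_congr fun j => ?_).trans finsum_zero
    have : n + (j : ℤ) ≠ -1 := by omega
    simp [idField, this]

lemma rightProd_idField (a : FieldSpace V) (m n : ℤ) (v : V) :
    (rightProd a m (idField V)).1 n v =
      if 0 ≤ m + n + 1 then bcoef m (m + n + 1).toNat • a.1 (m + n + 1) v else 0 := by
  rw [rightProd_apply]
  split_ifs with h
  · rw [finsum_eq_single _ (m + n + 1).toNat]
    · rw [Int.toNat_of_nonneg h, show m + n - (m + n + 1) = -1 by ring]
      simp [idField]
    · intro j hj
      have : m + n - (j : ℤ) ≠ -1 := by omega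
      simp [idField, this]
  · refine (finsum_congr fun j => ?_).trans finsum_zero
    have : m + n - (j : ℤ) ≠ -1 := by omega
    simp [idField, this]

lemma residueProd_idField (a : FieldSpace V) (m : ℤ) (hm : 0 ≤ m) :
    residueProd a m (idField V) = 0 := by
  obtain ⟨M, rfl⟩ := Int.eq_ofNat_of_zero_le hm
  ext n v
  change (leftProd a.1 M (idField V)).1 n v -
    (((M : ℤ).negOnePow : ℤ) • rightProd a M (idField V)).1 n v = 0
  change _ - ((M : ℤ).negOnePow : ℤ) • (rightProd a M (idField V)).1 n v = 0
  rw [leftProd_idField, rightProd_idField]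
  have hb (j : ℕ) : bcoef M j = (-1) ^ j * (M.choose j : ℤ) := by
    rw [bcoef, Ring.choose_natCast]
  by_cases h1 : 0 ≤ -1 - n
  · obtain ⟨i, hi⟩ := Int.eq_ofNat_of_zero_le h1
    obtain rfl : n = -1 - i := by omega
    by_cases h2 : (0 : ℤ) ≤ M + (-1 - i) + 1
    · obtain ⟨j, rfl⟩ : ∃ j, M = i + j := ⟨M - i, by omega⟩
      have e1 : (-1 - (-1 - (i : ℤ))).toNat = i := by omega
      have e2 : (((i + j : ℕ) : ℤ) + (-1 - i) + 1).toNat = j := by omega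
      rw [if_pos h1, if_pos h2, e1, e2, hb, hb, smul_smul, ← sub_smul, Nat.choose_symm_add]
      have : ((((i + j : ℕ) : ℤ).negOnePow : ℤˣ) : ℤ) = (-1) ^ i * (-1) ^ j := by
        rw [Int.negOnePow_def, zpow_natCast, pow_add]; simp
      rw [this, show (-1 : ℤ) ^ i * ((i + j).choose j : ℤ) -
        (-1) ^ i * (-1) ^ j * ((-1) ^ j * ((i + j).choose j : ℤ)) =
        (-1) ^ i * ((i + j).choose j : ℤ) * (1 - (-1) ^ j * (-1) ^ j) by ring, ← mul_pow]
      simp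
    · rw [if_pos h1, if_neg h2, hb, Nat.choose_eq_zero_of_lt (by omega)]
      simp
  · rw [if_neg h1]
    split_ifs with h2
    · rw [hb, Nat.choose_eq_zero_of_lt (by omega)]
      simp
    · simp

lemma residueProd_neg_one_idField (a : FieldSpace V) : residueProd a (-1) (idField V) = a := by
  ext n v
  change (leftProd a.1 (-1) (idField V)).1 n v -
    ((-1 : ℤ).negOnePow : ℤ) • (rightProd a (-1) (idField V)).1 n v = a.1 n v
  have hb (j : ℕ) : bcoef (-1) j = 1 := by
    rw [bcoef, Ring.choose_neg, show (1 : ℤ) + j - 1 = j by ring, Ring.choose_natCast,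
      Nat.choose_self, Int.negOnePow_def, zpow_natCast, Units.smul_def]
    simp [← mul_pow]
  rw [leftProd_idField, rightProd_idField, hb, hb]
  by_cases h : 0 ≤ n
  · rw [if_neg (by omega), if_pos (by omega)]
    simp
  · rw [if_pos (by omega), if_neg (by omega)]
    simp

end Fields
section Affine

open LieAlgebra TensorProduct

/-- A symmetric invariant bilinear form on a complex Lie algebra. -/
structure InvForm (𝔤 : Type*) [LieRing 𝔤] [LieAlgebra ℂ 𝔤] where
  form : LinearMap.BilinForm ℂ 𝔤
  symm : form.IsSymm
  invariant : form.lieInvariant 𝔤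

variable {𝔤 : Type*} [LieRing 𝔤] [LieAlgebra ℂ 𝔤] (B : InvForm 𝔤) (k : ℂ)

lemma neg_symm : (-B.form).IsSymm := ⟨fun x y => by simp [B.symm.eq]⟩

lemma neg_invariant : (-B.form).lieInvariant 𝔤 := fun x y z => by
  simp [B.invariant x y z]

/-- The affine Lie algebra `𝔤 ⊗ ℂ[t, t⁻¹] ⊕ ℂ K` with bracket
`[x ⊗ t^m, y ⊗ t^n] = [x, y] ⊗ t^{m+n} + m ⟨x, y⟩ δ_{m+n,0} K` and `K` central
(see `lie_loopElt` and `lie_central`). Mathlib's cocycle is the residue of `f dg`, while the usual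
one is that of `(df) g`; this accounts for the minus sign. -/
def Affine : Type _ :=
  ofTwoCocycle (LoopAlgebra.twoCocycleOfBilinear ℂ ℤ 𝔤 (-B.form) (neg_invariant B) (neg_symm B))

instance : LieRing (Affine B) := inferInstanceAs (LieRing (ofTwoCocycle
  (LoopAlgebra.twoCocycleOfBilinear ℂ ℤ 𝔤 (-B.form) (neg_invariant B) (neg_symm B))))

instance : LieAlgebra ℂ (Affine B) := inferInstanceAs (LieAlgebra ℂ (ofTwoCocycle
  (LoopAlgebra.twoCocycleOfBilinear ℂ ℤ 𝔤 (-B.form) (neg_invariant B) (neg_symm B))))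

/-- The underlying vector space of the affine Lie algebra is `𝔤[t, t⁻¹] ⊕ ℂ K`, with loops written
as finitely supported functions `ℤ → 𝔤`. -/
def coords : Affine B ≃ₗ[ℂ] (ℤ →₀ 𝔤) × ℂ :=
  LinearEquiv.trans
    { (ofProd (LoopAlgebra.twoCocycleOfBilinear ℂ ℤ 𝔤 (-B.form) (neg_invariant B)
        (neg_symm B))).symm with
      map_add' := of_symm_add _
      map_smul' := of_symm_smul _ : Affine B ≃ₗ[ℂ] _ }
    (LinearEquiv.prodCongr (LoopAlgebra.toFinsupp ℂ ℤ 𝔤)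
      (TrivialLieModule.equiv ℂ (loopAlgebra ℂ ℤ 𝔤) ℂ))

/-- The element `x ⊗ t^n` of the affine Lie algebra. -/
def loopElt (n : ℤ) : 𝔤 →ₗ[ℂ] Affine B :=
  (coords B).symm.toLinearMap ∘ₗ LinearMap.inl ℂ _ _ ∘ₗ Finsupp.lsingle n

/-- The central element `K` of the affine Lie algebra. -/
def central : Affine B := (coords B).symm (0, 1)

lemma coords_loopElt (n : ℤ) (x : 𝔤) : coords B (loopElt B n x) = (Finsupp.single n x, 0) := by
  simp [loopElt]

lemma coords_central : coords B (central B) = (0, 1) := by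
  simp [central]

lemma lie_loopElt (x y : 𝔤) (m n : ℤ) :
    ⁅loopElt B m x, loopElt B n y⁆ =
      loopElt B (m + n) ⁅x, y⁆ + (if m + n = 0 then (m : ℂ) * B.form x y else 0) • central B := by
  have h : LoopAlgebra.residuePairing ℂ ℤ 𝔤 (-B.form) (AddMonoidAlgebra.single m 1 ⊗ₜ[ℂ] x)
      (AddMonoidAlgebra.single n 1 ⊗ₜ[ℂ] y) = if m + n = 0 then (m : ℂ) * B.form x y else 0 := by
    rw [LoopAlgebra.residuePairing_apply_apply, LoopAlgebra.toFinsupp_single_tmul,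
      LoopAlgebra.toFinsupp_single_tmul, Finsupp.sum_single_index (by simp)]
    by_cases hmn : m + n = 0
    · obtain rfl : n = -m := by omega
      simp
    · rw [Finsupp.single_eq_of_ne (by omega), if_neg hmn]
      simp
  have hl (n : ℤ) (x : 𝔤) : loopElt B n x =
      ofProd _ (AddMonoidAlgebra.single n (1 : ℂ) ⊗ₜ[ℂ] x, 0) := by
    rw [← LoopAlgebra.toFinsupp_symm_single]; rfl
  apply (coords B).injective
  rw [map_add, map_smul, coords_loopElt, coords_central, hl, hl]
  refine Prod.ext ?_ ?_
  · change LoopAlgebra.toFinsupp ℂ ℤ 𝔤 ⁅AddMonoidAlgebra.single m (1 : ℂ) ⊗ₜ[ℂ] x,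
      AddMonoidAlgebra.single n (1 : ℂ) ⊗ₜ[ℂ] y⁆ = Finsupp.single (m + n) ⁅x, y⁆ + _ • 0
    rw [ExtendScalars.bracket_tmul, AddMonoidAlgebra.single_mul_single, mul_one, smul_zero,
      add_zero, LoopAlgebra.toFinsupp_single_tmul]
  · change (TrivialLieModule.equiv ℂ (loopAlgebra ℂ ℤ 𝔤) ℂ)
        ((TrivialLieModule.equiv ℂ (loopAlgebra ℂ ℤ 𝔤) ℂ).symm
        (LoopAlgebra.residuePairing ℂ ℤ 𝔤 (-B.form) (AddMonoidAlgebra.single m 1 ⊗ₜ[ℂ] x)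
          (AddMonoidAlgebra.single n 1 ⊗ₜ[ℂ] y)) + ⁅_, _⁆ - ⁅_, _⁆) = 0 + _ • 1
    rw [h, LieModule.IsTrivial.trivial, LieModule.IsTrivial.trivial, add_zero, sub_zero, zero_add,
      LinearEquiv.apply_symm_apply, smul_eq_mul, mul_one]

lemma lie_central (z : Affine B) : ⁅z, central B⁆ = 0 := by
  have hc : ((ofProd (LoopAlgebra.twoCocycleOfBilinear ℂ ℤ 𝔤 (-B.form) (neg_invariant B)
      (neg_symm B))).symm (central B)).1 = 0 :=
    (LoopAlgebra.toFinsupp ℂ ℤ 𝔤).symm.map_zero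
  apply (coords B).injective
  rw [map_zero]
  refine Prod.ext ?_ ?_
  · change LoopAlgebra.toFinsupp ℂ ℤ 𝔤 ⁅_, _⁆ = 0
    rw [hc, lie_zero, map_zero]
  · change (TrivialLieModule.equiv ℂ (loopAlgebra ℂ ℤ 𝔤) ℂ)
        ((TrivialLieModule.equiv ℂ (loopAlgebra ℂ ℤ 𝔤) ℂ).symm
        (LoopAlgebra.residuePairing ℂ ℤ 𝔤 (-B.form) _ _) + ⁅_, _⁆ - ⁅_, _⁆) = 0
    rw [hc, map_zero, LieModule.IsTrivial.trivial, LieModule.IsTrivial.trivial, sub_zero,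
      add_zero, map_zero, map_zero]

lemma eq_sum_loopElt (z : Affine B) :
    z = ((coords B z).1.sum fun n x => loopElt B n x) + (coords B z).2 • central B := by
  apply (coords B).injective
  rw [map_add, map_smul, coords_central, Finsupp.sum, map_sum]
  simp_rw [coords_loopElt]
  refine Prod.ext ?_ ?_
  · rw [Prod.fst_add, Prod.fst_sum, Prod.smul_fst, smul_zero, add_zero]
    exact (Finsupp.sum_single (coords B z).1).symm
  · simp [Prod.snd_sum]

/-- The universal enveloping algebra of the affine Lie algebra. -/
abbrev UAff : Type _ := UniversalEnvelopingAlgebra ℂ (Affine B)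

/-- The left ideal of the enveloping algebra generated by `𝔤 ⊗ ℂ[t]` and `K - k`. -/
def vacuumIdeal : Ideal (UAff B) :=
  Ideal.span ({u | ∃ (x : 𝔤) (n : ℤ), 0 ≤ n ∧ u = UniversalEnvelopingAlgebra.ι ℂ (loopElt B n x)} ∪
    {UniversalEnvelopingAlgebra.ι ℂ (central B) - algebraMap ℂ (UAff B) k})

/-- The generalized Verma module `V(k,0)`: the module induced from the one-dimensional module of
`𝔤 ⊗ ℂ[t] ⊕ ℂ K` on which `𝔤 ⊗ ℂ[t]` acts by `0` and `K` acts by `k`. -/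
def VacuumModule : Type _ := UAff B ⧸ vacuumIdeal B k

instance : AddCommGroup (VacuumModule B k) :=
  inferInstanceAs (AddCommGroup (UAff B ⧸ vacuumIdeal B k))

instance : Module (UAff B) (VacuumModule B k) :=
  inferInstanceAs (Module (UAff B) (UAff B ⧸ vacuumIdeal B k))

instance : Module ℂ (VacuumModule B k) :=
  inferInstanceAs (Module ℂ (UAff B ⧸ vacuumIdeal B k))

instance : IsScalarTower ℂ (UAff B) (VacuumModule B k) :=
  inferInstanceAs (IsScalarTower ℂ (UAff B) (UAff B ⧸ vacuumIdeal B k))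

/-- The projection of the enveloping algebra onto `V(k,0)`. -/
def toVacuum : UAff B →ₗ[UAff B] VacuumModule B k := Submodule.mkQ (vacuumIdeal B k)

lemma toVacuum_surjective : Function.Surjective (toVacuum B k) :=
  Submodule.mkQ_surjective _

lemma toVacuum_eq_zero (u : UAff B) : toVacuum B k u = 0 ↔ u ∈ vacuumIdeal B k :=
  Submodule.Quotient.mk_eq_zero _

/-- The vacuum vector `𝟙` of `V(k,0)`. -/
def vacuum : VacuumModule B k := toVacuum B k 1

/-- The operator `x(n)` on `V(k,0)`, i.e. the action of `x ⊗ t^n`. -/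
def modeEnd (x : 𝔤) (n : ℤ) : Module.End ℂ (VacuumModule B k) :=
  Algebra.lsmul ℂ ℂ (VacuumModule B k) (UniversalEnvelopingAlgebra.ι ℂ (loopElt B n x))


section UEA
attribute [local instance 100] LieRing.ofAssociativeRing

lemma uea_induction {L : Type*} [LieRing L] [LieAlgebra ℂ L]
    (S : Subalgebra ℂ (UniversalEnvelopingAlgebra ℂ L))
    (h : ∀ x, UniversalEnvelopingAlgebra.ι ℂ x ∈ S) (u : UniversalEnvelopingAlgebra ℂ L) :
    u ∈ S := by
  obtain ⟨t, rfl⟩ : ∃ t, UniversalEnvelopingAlgebra.mkAlgHom ℂ L t = u :=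
    RingCon.mkₐ_surjective _ u
  induction t using TensorAlgebra.induction with
  | algebraMap r => rw [AlgHom.commutes]; exact S.algebraMap_mem r
  | ι x => exact h x
  | mul a b ha hb => rw [map_mul]; exact S.mul_mem ha hb
  | add a b ha hb => rw [map_add]; exact S.add_mem ha hb

lemma central_smul (v : VacuumModule B k) :
    UniversalEnvelopingAlgebra.ι ℂ (central B) • v = k • v := by
  obtain ⟨u, rfl⟩ := toVacuum_surjective B k v
  have hu : u * UniversalEnvelopingAlgebra.ι ℂ (central B) =
      UniversalEnvelopingAlgebra.ι ℂ (central B) * u := by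
    have := uea_induction (Subalgebra.centralizer ℂ {UniversalEnvelopingAlgebra.ι ℂ (central B)})
      (fun x => by
        rw [Subalgebra.mem_centralizer_iff]
        rintro g rfl
        have h := (UniversalEnvelopingAlgebra.ι ℂ).map_lie x (central B)
        rw [lie_central, map_zero, LieRing.of_associative_ring_bracket] at h
        exact (sub_eq_zero.1 h.symm).symm) u
    rw [Subalgebra.mem_centralizer_iff] at this
    exact (this _ rfl).symm
  rw [← algebraMap_smul (UAff B) k, ← map_smul, ← map_smul, smul_eq_mul, smul_eq_mul, ← hu,
    Algebra.commutes, ← sub_eq_zero, ← map_sub, ← mul_sub, toVacuum_eq_zero]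
  exact Ideal.mul_mem_left _ _ (Ideal.subset_span (Or.inr rfl))

lemma modeEnd_comm (x y : 𝔤) (m n : ℤ) (v : VacuumModule B k) :
    modeEnd B k x m (modeEnd B k y n v) - modeEnd B k y n (modeEnd B k x m v) =
      modeEnd B k ⁅x, y⁆ (m + n) v +
        (if m + n = 0 then (m : ℂ) * (B.form x y * k) else 0) • v := by
  have h := (UniversalEnvelopingAlgebra.ι ℂ).map_lie (loopElt B m x) (loopElt B n y)
  rw [LieRing.of_associative_ring_bracket, lie_loopElt, map_add, map_smul] at h
  simp only [modeEnd, Algebra.lsmul_coe]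
  rw [smul_smul, smul_smul, ← sub_smul, ← h, add_smul, smul_assoc, central_smul, smul_smul]
  congr 2
  split_ifs
  · ring
  · ring

lemma modeEnd_vacuum (x : 𝔤) (n : ℤ) (hn : 0 ≤ n) : modeEnd B k x n (vacuum B k) = 0 := by
  simp only [modeEnd, Algebra.lsmul_coe, vacuum]
  rw [← map_smul, smul_eq_mul, mul_one, toVacuum_eq_zero]
  exact Ideal.subset_span (Or.inl ⟨x, n, hn, rfl⟩)

lemma modeEnd_truncation (v : VacuumModule B k) (x : 𝔤) :
    ∃ N : ℤ, ∀ n, N ≤ n → modeEnd B k x n v = 0 := by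
  let T : Submodule ℂ (VacuumModule B k) :=
    { carrier := {v | ∀ x, ∃ N : ℤ, ∀ n, N ≤ n → modeEnd B k x n v = 0}
      add_mem' := fun {v w} hv hw x => by
        obtain ⟨N, hN⟩ := hv x
        obtain ⟨M, hM⟩ := hw x
        exact ⟨max N M, fun n hn => by
          rw [map_add, hN n (le_trans (le_max_left _ _) hn),
            hM n (le_trans (le_max_right _ _) hn), add_zero]⟩
      zero_mem' := fun x => ⟨0, fun n _ => map_zero _⟩
      smul_mem' := fun c v hv x => by
        obtain ⟨N, hN⟩ := hv x
        exact ⟨N, fun n hn => by rw [map_smul, hN n hn, smul_zero]⟩ }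
  let S : Subalgebra ℂ (UAff B) :=
    { carrier := {u | ∀ w ∈ T, u • w ∈ T}
      mul_mem' := fun {a b} ha hb w hw => by rw [mul_smul]; exact ha _ (hb _ hw)
      add_mem' := fun {a b} ha hb w hw => by rw [add_smul]; exact T.add_mem (ha _ hw) (hb _ hw)
      algebraMap_mem' := fun r w hw => by rw [algebraMap_smul]; exact T.smul_mem r hw }
  have hS : ∀ u, u ∈ S := uea_induction S fun z w hw => by
    rw [eq_sum_loopElt B z]
    generalize (coords B z).1 = f
    rw [map_add, add_smul, map_smul, smul_assoc, central_smul, Finsupp.sum, map_sum,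
      Finset.sum_smul]
    refine T.add_mem (T.sum_mem fun m _ => ?_) (T.smul_mem _ (T.smul_mem _ hw))
    intro x
    obtain ⟨N, hN⟩ := hw x
    obtain ⟨M, hM⟩ := hw ⁅x, f m⁆
    refine ⟨max (max N (M - m)) (1 - m), fun n hn => ?_⟩
    have h := modeEnd_comm B k x (f m) n m w
    rw [hN n (by omega), hM (n + m) (by omega), if_neg (by omega), map_zero, sub_zero, zero_smul,
      add_zero] at h
    exact h
  obtain ⟨u, rfl⟩ := toVacuum_surjective B k v
  have := hS u (vacuum B k) (fun x => ⟨0, fun n hn => modeEnd_vacuum B k x n hn⟩) x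
  rwa [vacuum, ← map_smul, smul_eq_mul, mul_one] at this

/-- The field `x(z) = ∑ x(n) z^{-n-1}`. -/
def currentField : 𝔤 →ₗ[ℂ] FieldSpace (VacuumModule B k) where
  toFun x := ⟨modeEnd B k x, fun v => modeEnd_truncation B k v x⟩
  map_add' x y := by
    ext n v
    simp [modeEnd]
  map_smul' c x := by
    ext n v
    simp [modeEnd]

/-- The action of `x ⊗ t^n` on the space of fields on `V(k,0)`: the `n`-th residue product with
the field `x(z)`. -/
def loopAct (n : ℤ) : 𝔤 →ₗ[ℂ] Module.End ℂ (FieldSpace (VacuumModule B k)) where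
  toFun x := residueProd (currentField B k x) n
  map_add' x y := by
    rw [map_add, residueProd_add]
  map_smul' c x := by
    rw [map_smul, residueProd_smul]; rfl

lemma loopAct_comm (x y : 𝔤) (m n : ℤ) :
    loopAct B k m x * loopAct B k n y - loopAct B k n y * loopAct B k m x =
      loopAct B k (m + n) ⁅x, y⁆ + (if m + n = 0 then (m : ℂ) * (B.form x y * k) else 0) • 1 := by
  ext1 A
  exact residueProd_comm (a := currentField B k x) (b := currentField B k y)
    (c := currentField B k ⁅x, y⁆) (modeEnd_comm B k x y) m n A

/-- The linear map underlying `affineAct`: `x ⊗ t^n` acts by `loopAct` and `K` acts by `k`. -/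
def affineLin : Affine B →ₗ[ℂ] Module.End ℂ (FieldSpace (VacuumModule B k)) :=
  LinearMap.coprod (Finsupp.lsum ℂ (fun n => loopAct B k n))
    (LinearMap.toSpanSingleton ℂ _ (k • 1)) ∘ₗ (coords B).toLinearMap

lemma affineLin_loopElt (x : 𝔤) (n : ℤ) : affineLin B k (loopElt B n x) = loopAct B k n x := by
  simp [affineLin, coords_loopElt]

lemma affineLin_central : affineLin B k (central B) = k • 1 := by
  simp [affineLin, coords_central]

/-- The space of fields on `V(k,0)` is a module of level `k` for the affine Lie algebra, where
`x ⊗ t^n` acts by the `n`-th residue product with `x(z)`. -/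
def affineAct : Affine B →ₗ⁅ℂ⁆ Module.End ℂ (FieldSpace (VacuumModule B k)) :=
  { affineLin B k with
    map_lie' := fun {z w} => by
      change affineLin B k ⁅z, w⁆ =
        affineLin B k z * affineLin B k w - affineLin B k w * affineLin B k z
      have hK (u : Affine B) : ⁅central B, u⁆ = 0 := by
        rw [← lie_skew, lie_central, neg_zero]
      rw [eq_sum_loopElt B z, eq_sum_loopElt B w]
      generalize (coords B z).1 = f
      generalize (coords B w).1 = g
      generalize (coords B z).2 = c
      generalize (coords B w).2 = d
      simp only [Finsupp.sum, add_lie, lie_add, smul_lie, lie_smul, lie_central, hK, smul_zero,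
        add_zero, sum_lie, lie_sum, map_add, map_smul, Finset.sum_const_zero, map_sum, affineLin_central,
        affineLin_loopElt, lie_loopElt]
      have hadd (X Y : Module.End ℂ (FieldSpace (VacuumModule B k))) :
          (X + c • k • 1) * (Y + d • k • 1) - (Y + d • k • 1) * (X + c • k • 1) =
            X * Y - Y * X := by
        simp only [mul_add, add_mul, mul_smul_comm, smul_mul_assoc, mul_one, one_mul, smul_add]
        module
      rw [hadd, Finset.sum_mul_sum, Finset.sum_mul_sum, Finset.sum_comm (s := g.support) (t := f.support),
        Finset.sum_comm (s := g.support) (t := f.support)]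
      have hsub {X Y Z : Module.End ℂ (FieldSpace (VacuumModule B k))} (h : X + Z = Y) :
          X = Y - Z := by
        rw [← h]
        ext1 A
        rw [LinearMap.sub_apply, LinearMap.add_apply, add_sub_cancel_right]
      refine hsub ?_
      rw [← Finset.sum_add_distrib]
      refine Finset.sum_congr rfl fun n _ => ?_
      rw [← Finset.sum_add_distrib]
      refine Finset.sum_congr rfl fun m _ => ?_
      have hadd' {X Y Z : Module.End ℂ (FieldSpace (VacuumModule B k))} (h : X - Z = Y) :
          Y + Z = X := by
        rw [← h]
        ext1 A
        rw [LinearMap.add_apply, LinearMap.sub_apply, sub_add_cancel]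
      refine hadd' ((loopAct_comm B k (f n) (g m) n m).trans ?_)
      rw [smul_smul]
      congr 2
      split_ifs <;> ring }

/-- The linear map from the enveloping algebra to the fields on `V(k,0)` that sends `u` to
the result of acting with `u` on the identity field. -/
def fieldOfUAff : UAff B →ₗ[ℂ] FieldSpace (VacuumModule B k) :=
  LinearMap.applyₗ (idField (VacuumModule B k)) ∘ₗ
    (UniversalEnvelopingAlgebra.lift ℂ (affineAct B k)).toLinearMap

lemma fieldOfUAff_eq_zero (u : UAff B) (hu : u ∈ vacuumIdeal B k) : fieldOfUAff B k u = 0 := by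
  have hmul (u w : UAff B) : fieldOfUAff B k (u * w) =
      UniversalEnvelopingAlgebra.lift ℂ (affineAct B k) u (fieldOfUAff B k w) := by
    simp [fieldOfUAff]
  induction hu using Submodule.span_induction with
  | zero => exact map_zero _
  | add x y _ _ hx hy => rw [map_add, hx, hy, add_zero]
  | smul a x _ hx => rw [smul_eq_mul, hmul, hx, map_zero]
  | mem x hx =>
    rcases hx with ⟨y, n, hn, rfl⟩ | rfl
    · change UniversalEnvelopingAlgebra.lift ℂ (affineAct B k)
        (UniversalEnvelopingAlgebra.ι ℂ (loopElt B n y)) (idField _) = 0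
      rw [UniversalEnvelopingAlgebra.lift_ι_apply]
      change affineLin B k (loopElt B n y) (idField _) = 0
      rw [affineLin_loopElt]
      exact residueProd_idField _ n hn
    · change UniversalEnvelopingAlgebra.lift ℂ (affineAct B k)
        (UniversalEnvelopingAlgebra.ι ℂ (central B) - algebraMap ℂ _ k) (idField _) = 0
      rw [map_sub, UniversalEnvelopingAlgebra.lift_ι_apply, AlgHom.commutes]
      change (affineLin B k (central B) - algebraMap ℂ _ k) (idField _) = 0
      rw [affineLin_central, Algebra.algebraMap_eq_smul_one]
      exact sub_self (k • idField (VacuumModule B k))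

/-- The vertex operator map `v ↦ Y(v, z)` of the vertex operator algebra `V(k,0)`. It is determined
by `Y(𝟙, z) = id` (`stateField_vacuum`) and the iterate formula for `Y(x(n) v, z)`
(`stateField_modeEnd`), and it satisfies `Y(x(-1) 𝟙, z) = x(z)` (`stateField_current`). -/
def stateField : VacuumModule B k →ₗ[ℂ] FieldSpace (VacuumModule B k) :=
  (((vacuumIdeal B k).restrictScalars ℂ).liftQ (fieldOfUAff B k) (fieldOfUAff_eq_zero B k)) ∘ₗ
    (Submodule.Quotient.restrictScalarsEquiv ℂ (vacuumIdeal B k)).symm.toLinearMap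

/-- The `n`-th product `u_n v` in `V(k,0)`, where `Y(u, z) = ∑ u_n z^{-n-1}`. -/
def nProd (u : VacuumModule B k) (n : ℤ) (v : VacuumModule B k) : VacuumModule B k :=
  (stateField B k u).1 n v


lemma stateField_toVacuum (u : UAff B) :
    stateField B k (toVacuum B k u) = fieldOfUAff B k u := rfl

/-- `Y(𝟙, z) = id`. -/
lemma stateField_vacuum : stateField B k (vacuum B k) = idField (VacuumModule B k) := by
  rw [vacuum, stateField_toVacuum, fieldOfUAff, LinearMap.comp_apply, AlgHom.toLinearMap_apply,
    map_one]
  rfl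

/-- The iterate formula: `Y(x(n) v, z)` is the `n`-th residue product of `x(z)` and `Y(v, z)`. -/
lemma stateField_modeEnd (x : 𝔤) (n : ℤ) (v : VacuumModule B k) :
    stateField B k (modeEnd B k x n v) =
      residueProd (currentField B k x) n (stateField B k v) := by
  obtain ⟨u, rfl⟩ := toVacuum_surjective B k v
  have h : modeEnd B k x n (toVacuum B k u) =
      toVacuum B k (UniversalEnvelopingAlgebra.ι ℂ (loopElt B n x) * u) :=
    (map_smul (toVacuum B k) _ u).symm
  rw [h, stateField_toVacuum, stateField_toVacuum, fieldOfUAff, LinearMap.comp_apply,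
    LinearMap.comp_apply, AlgHom.toLinearMap_apply, AlgHom.toLinearMap_apply, map_mul,
    UniversalEnvelopingAlgebra.lift_ι_apply]
  change affineLin B k (loopElt B n x) _ = _
  rw [affineLin_loopElt]
  rfl

/-- `Y(x(-1) 𝟙, z) = x(z)`. -/
lemma stateField_current (x : 𝔤) :
    stateField B k (modeEnd B k x (-1) (vacuum B k)) = currentField B k x := by
  rw [stateField_modeEnd, stateField_vacuum, residueProd_neg_one_idField]

end UEA

/-- A vertex subalgebra of `V(k,0)`: a subspace that contains `𝟙` and is closed under all
`n`-th products. -/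
structure IsVertexSubalgebra (W : Submodule ℂ (VacuumModule B k)) : Prop where
  vacuum_mem : vacuum B k ∈ W
  nProd_mem : ∀ u ∈ W, ∀ v ∈ W, ∀ n : ℤ, nProd B k u n v ∈ W

/-- The vertex subalgebra of `V(k,0)` generated by `S`: the smallest one that contains `S`. -/
def vertexClosure (S : Set (VacuumModule B k)) : Submodule ℂ (VacuumModule B k) :=
  sInf {W | IsVertexSubalgebra B k W ∧ S ⊆ W}

/-- The commutant of `W` in `V(k,0)`: all `v` with `u_n v = 0` for all `u ∈ W` and `n ≥ 0`. -/
def commutant (W : Submodule ℂ (VacuumModule B k)) : Submodule ℂ (VacuumModule B k) where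
  carrier := {v | ∀ u ∈ W, ∀ n : ℤ, 0 ≤ n → nProd B k u n v = 0}
  add_mem' {v w} hv hw u hu n hn := by
    have h1 := hv u hu n hn
    have h2 := hw u hu n hn
    simp only [nProd] at h1 h2 ⊢
    rw [map_add, h1, h2, add_zero]
  zero_mem' u _ n _ := map_zero _
  smul_mem' c v hv u hu n hn := by
    have h1 := hv u hu n hn
    simp only [nProd] at h1 ⊢
    rw [map_smul, h1, smul_zero]

/-- The Heisenberg vertex subalgebra of `V(k,0)`, generated by `h(-1) 𝟙` for `h ∈ H`. -/
def heisenberg (H : Submodule ℂ 𝔤) : Submodule ℂ (VacuumModule B k) :=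
  vertexClosure B k {v | ∃ h ∈ H, v = modeEnd B k h (-1) (vacuum B k)}

/-- `N(𝔤, k)`: the commutant in `V(k,0)` of the Heisenberg vertex subalgebra. -/
def parafermion (H : Submodule ℂ 𝔤) : Submodule ℂ (VacuumModule B k) :=
  commutant B k (heisenberg B k H)

/-- The vector
`1/(2κ(κ+2)) (-κ h(-2) 𝟙 - h(-1)² 𝟙 + 2κ e(-1) f(-1) 𝟙)`. -/
def omegaVec (κ : ℂ) (h e f : 𝔤) : VacuumModule B k :=
  (1 / (2 * κ * (κ + 2))) •
    (-(κ • modeEnd B k h (-2) (vacuum B k))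
      - modeEnd B k h (-1) (modeEnd B k h (-1) (vacuum B k))
      + (2 * κ) • modeEnd B k e (-1) (modeEnd B k f (-1) (vacuum B k)))

/-- The vector `κ² h(-3) 𝟙 + 3κ h(-2) h(-1) 𝟙 + 2 h(-1)³ 𝟙 - 6κ h(-1) e(-1) f(-1) 𝟙
+ 3κ² e(-2) f(-1) 𝟙 - 3κ² e(-1) f(-2) 𝟙`. -/
def wVec (κ : ℂ) (h e f : 𝔤) : VacuumModule B k :=
  κ ^ 2 • modeEnd B k h (-3) (vacuum B k)
    + (3 * κ) • modeEnd B k h (-2) (modeEnd B k h (-1) (vacuum B k))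
    + (2 : ℂ) • modeEnd B k h (-1) (modeEnd B k h (-1) (modeEnd B k h (-1) (vacuum B k)))
    - (6 * κ) • modeEnd B k h (-1) (modeEnd B k e (-1) (modeEnd B k f (-1) (vacuum B k)))
    + (3 * κ ^ 2) • modeEnd B k e (-2) (modeEnd B k f (-1) (vacuum B k))
    - (3 * κ ^ 2) • modeEnd B k e (-1) (modeEnd B k f (-2) (vacuum B k))

/-- A linear isomorphism between vertex operator algebras `W₁` and `W₂` (realized inside affine
vertex operator algebras) with conformal vectors `ω₁` and `ω₂` is an isomorphism of vertex operator
algebras: it preserves the vacuum vector, all `n`-th products and the conformal vector. -/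
structure IsVOAIso {𝔤₁ 𝔤₂ : Type*} [LieRing 𝔤₁] [LieAlgebra ℂ 𝔤₁] [LieRing 𝔤₂] [LieAlgebra ℂ 𝔤₂]
    {B₁ : InvForm 𝔤₁} {B₂ : InvForm 𝔤₂} {k₁ k₂ : ℂ}
    {W₁ : Submodule ℂ (VacuumModule B₁ k₁)} {W₂ : Submodule ℂ (VacuumModule B₂ k₂)}
    (φ : W₁ ≃ₗ[ℂ] W₂) (ω₁ : VacuumModule B₁ k₁) (ω₂ : VacuumModule B₂ k₂) : Prop where
  map_vacuum : ∃ h : vacuum B₁ k₁ ∈ W₁, (φ ⟨_, h⟩ : VacuumModule B₂ k₂) = vacuum B₂ k₂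
  map_nProd : ∀ (u v : W₁) (n : ℤ), ∃ h : nProd B₁ k₁ u n v ∈ W₁,
    (φ ⟨_, h⟩ : VacuumModule B₂ k₂) = nProd B₂ k₂ (φ u) n (φ v)
  map_conformal : ∃ h : ω₁ ∈ W₁, (φ ⟨_, h⟩ : VacuumModule B₂ k₂) = ω₂

end Affine

section SL2

/-- The Lie algebra `sl₂` of traceless complex `2 × 2` matrices. -/
abbrev sl2 : Type := LieAlgebra.SpecialLinear.sl (Fin 2) ℂ

/-- The standard basis vector `e` of `sl₂`. -/
def sl2E : sl2 := ⟨!![0, 1; 0, 0], by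
  change Matrix.trace (_ : Matrix (Fin 2) (Fin 2) ℂ) = 0
  simp [Matrix.trace_fin_two]⟩

/-- The standard basis vector `f` of `sl₂`. -/
def sl2F : sl2 := ⟨!![0, 0; 1, 0], by
  change Matrix.trace (_ : Matrix (Fin 2) (Fin 2) ℂ) = 0
  simp [Matrix.trace_fin_two]⟩

/-- The standard basis vector `h` of `sl₂`. -/
def sl2H : sl2 := ⟨!![1, 0; 0, -1], by
  change Matrix.trace (_ : Matrix (Fin 2) (Fin 2) ℂ) = 0
  simp [Matrix.trace_fin_two]⟩

/-- The trace form `⟨x, y⟩ = tr(x y)` on `sl₂`, which satisfies `⟨h, h⟩ = 2`. -/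
def sl2Form : InvForm sl2 where
  form := LinearMap.mk₂ ℂ (fun x y : sl2 => (x.1 * y.1).trace)
    (fun x y z => by simp [add_mul]) (fun c x y => by simp)
    (fun x y z => by simp [mul_add]) (fun c x y => by simp)
  symm := ⟨fun x y => by simp [Matrix.trace_mul_comm x.1 y.1]⟩
  invariant x y z := by
    simp only [LinearMap.mk₂_apply, LieAlgebra.SpecialLinear.sl_bracket, sub_mul, mul_sub,
      Matrix.trace_sub]
    rw [Matrix.mul_assoc y.1 x.1 z.1, ← Matrix.mul_assoc y.1 z.1 x.1,
      Matrix.trace_mul_cycle y.1 z.1 x.1]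
    ring

/-- `N(sl₂, κ)`, for the Cartan subalgebra `ℂ h` and the form with `⟨h, h⟩ = 2`. -/
def parafermionSl2 (κ : ℂ) : Submodule ℂ (VacuumModule sl2Form κ) :=
  parafermion sl2Form κ (ℂ ∙ sl2H)

/-- The conformal vector `ω_aff - ω_𝔥` of `N(sl₂, κ)`, where
`ω_aff = 1/(2(κ+2)) (h(-1)² 𝟙 / 2 + e(-1) f(-1) 𝟙 + f(-1) e(-1) 𝟙)` and
`ω_𝔥 = 1/(2κ) (h(-1)² 𝟙 / 2)`. -/
def conformalSl2 (κ : ℂ) : VacuumModule sl2Form κ :=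
  (1 / (2 * (κ + 2))) •
      ((1 / 2 : ℂ) • modeEnd sl2Form κ sl2H (-1) (modeEnd sl2Form κ sl2H (-1) (vacuum sl2Form κ))
        + modeEnd sl2Form κ sl2E (-1) (modeEnd sl2Form κ sl2F (-1) (vacuum sl2Form κ))
        + modeEnd sl2Form κ sl2F (-1) (modeEnd sl2Form κ sl2E (-1) (vacuum sl2Form κ)))
    - (1 / (2 * κ)) •
      ((1 / 2 : ℂ) • modeEnd sl2Form κ sl2H (-1) (modeEnd sl2Form κ sl2H (-1) (vacuum sl2Form κ)))

end SL2

section Roots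

open LieAlgebra

variable {𝔤 : Type*} [LieRing 𝔤] [LieAlgebra ℂ 𝔤] [FiniteDimensional ℂ 𝔤] [IsSimple ℂ 𝔤]
  (B : InvForm 𝔤) (H : LieSubalgebra ℂ 𝔤) [H.IsCartanSubalgebra]

/-- The element `t_α ∈ H` with `⟨t_α, h⟩ = α(h)` for all `h ∈ H`, which exists and is unique when
the form is nondegenerate. -/
def rootVec (α : H.root) : H := Function.invFun (fun t h : H => B.form t h) (α.1 : H → ℂ)

/-- `⟨α, α⟩ = ⟨t_α, t_α⟩`. -/
def rootNormSq (α : H.root) : ℂ := B.form (rootVec B H α) (rootVec B H α)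

/-- The form is nondegenerate and `⟨α, α⟩ = 2` for every long root `α`. All nonzero invariant forms
on a simple Lie algebra are proportional, with `⟨α, α⟩ / ⟨β, β⟩` a positive rational number, so
the long roots are those for which the absolute value of `⟨α, α⟩` is maximal. -/
structure IsNormalized : Prop where
  nondegenerate : B.form.Nondegenerate
  long_root : ∀ α : H.root, (∀ β : H.root, ‖rootNormSq B H β‖ ≤ ‖rootNormSq B H α‖) →
    rootNormSq B H α = 2

/-- `k_α = (⟨θ, θ⟩ / ⟨α, α⟩) k = (2 / ⟨α, α⟩) k`, where `θ` is the highest root (which is long). -/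
def rootLevel (k : ℂ) (α : H.root) : ℂ := 2 / rootNormSq B H α * k

/-- For every positive root `α`, `e α = x_α` and `f α = x_{-α}` are root vectors for `α` and `-α`
such that `[x_α, x_{-α}]` is the coroot `h_α = (2 / ⟨α, α⟩) t_α`. -/
def IsRootVectors (b : (IsKilling.rootSystem H).Base) (e f : H.root → 𝔤) : Prop :=
  ∀ α : H.root, b.IsPos α → e α ∈ rootSpace H α.1 ∧ f α ∈ rootSpace H (-α.1) ∧
    ⁅e α, f α⁆ = (IsKilling.coroot α.1 : 𝔤)

variable (e f : H.root → 𝔤) (k : ℂ)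

/-- The vector `ω_α`, for a choice of root vectors `e α` and `f α`. -/
def omegaRoot (α : H.root) : VacuumModule B k :=
  omegaVec B k (rootLevel B H k α) (IsKilling.coroot α.1 : 𝔤) (e α) (f α)

/-- The vector `W³_α`, for a choice of root vectors `e α` and `f α`. -/
def wRoot (α : H.root) : VacuumModule B k :=
  wVec B k (rootLevel B H k α) (IsKilling.coroot α.1 : 𝔤) (e α) (f α)

/-- The set of all vectors `ω_α` and `W³_α`, for `α` a positive root. -/
def parafermionGenerators (b : (IsKilling.rootSystem H).Base) : Set (VacuumModule B k) :=
  {v | ∃ α : H.root, b.IsPos α ∧ (v = omegaRoot B H e f k α ∨ v = wRoot B H e f k α)}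

/-- The vertex subalgebra `P̂_α` of `V(k,0)` generated by `ω_α` and `W³_α`. -/
def rootSubalgebra (α : H.root) : Submodule ℂ (VacuumModule B k) :=
  vertexClosure B k {omegaRoot B H e f k α, wRoot B H e f k α}

end Roots
end
end Parafermion

/-! Generation. A vector lies in `N(𝔤,k)` exactly when all `h(n)` with `h ∈ 𝔥`, `n ≥ 0` kill it
(`parafermion_eq_heisenbergVacua`). The vectors `ω_α`, `W³_α` are of this kind
(`IsToral.modeEnd_eq_zero`), hence so is the vertex subalgebra `U` that they generate. For the
converse, let `C` be the span of all Heisenberg descendants of `U`. By locality, vertex operators of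
Heisenberg vacua commute with all modes `h(n)`, so `C` is again a vertex subalgebra
(`isVertexSubalgebra_heisenbergSpan`), now containing the currents `h(-1)𝟙`. It suffices to show
that `C` contains the whole `𝔥`-weight-zero part of `V(k,0)`: this part contains `N(𝔤,k)`
(`heisenbergVacua_le_wordSpan`), and the Heisenberg vacua inside `C` are just `U`, because every
proper descendant has a positive eigenvalue under a number operator
(`heisenbergVacua_inf_heisenbergSpan_le`).

That `C` contains the weight-zero part is shown in three stages. Modulo Heisenberg descendants,
`ω_α` and `W³_α` give `e(-1)f(-1)𝟙` and `e(-2)f(-1)𝟙`, and a recursion produces all `e(-m-1)f(-1)𝟙`;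
its leading coefficient is `(m+3)((k_α+1)(m+1)+1)`, nonzero since `k_α > 0` (`e_f_vacuum_mem`). The
modes of these quadratic vectors are binomial combinations of normally ordered products `e(p)f(q)`,
and varying `m` isolates each product, so `C` is stable under every `e(p)f(q)`
(`normallyOrdered_mem`, `e_f_mem`). Finally, a word of weight zero in root vectors is reduced by
induction on its length to such pairs of opposite roots (`word_mem`).

Isomorphism. The triple `(h_α, x_α, x_{-α})` is an embedding of `sl₂` that multiplies the form by
`k_α / k`, so it induces a map of vacuum modules from level `k_α` to level `k`
(`exists_vacuum_embedding`). It is injective because each vacuum module embeds into the enveloping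
algebra of the negative part, and the map between these enveloping algebras is injective
(`ueaMap_injective`, by a convolution argument that avoids the PBW theorem). Applied to `sl₂`
itself, the generation theorem says that `N(sl₂,k_α)` is generated by its `ω` and `W³`, whose images
generate `P̂_α`.

Count. There are `dim 𝔤 - l` roots, so the number of pairs (positive root, choice of `ω` or `W³`) is
right; the vectors are pairwise distinct by evaluation at suitable characters of the negative part
(`exists_evaluation`). -/

namespace Parafermion
-- Residue products and locality of fields
section FieldCalculus
variable {V : Type*} [AddCommGroup V] [Module ℂ V]

/-- Multiplication of a field by `z^p`, i.e. a shift of its modes. -/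
def shift (p : ℤ) : FieldSpace V →ₗ[ℂ] FieldSpace V where
  toFun A := ⟨fun n => A.1 (n + p), fun v => by
    obtain ⟨N, hN⟩ := A.2 v
    exact ⟨N - p, fun n hn => hN _ (by omega)⟩⟩
  map_add' _ _ := rfl
  map_smul' _ _ := rfl

lemma shift_apply (p : ℤ) (A : FieldSpace V) (n : ℤ) : (shift p A).1 n = A.1 (n + p) := rfl

lemma shift_shift (p q : ℤ) (A : FieldSpace V) : shift p (shift q A) = shift (p + q) A := by
  ext n v
  simp [shift_apply, add_assoc]

lemma shift_zero (A : FieldSpace V) : shift 0 A = A := by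
  ext n v
  simp [shift_apply]

lemma residueProd_apply (a : FieldSpace V) (m : ℤ) (A : FieldSpace V) (n : ℤ) (v : V) :
    (residueProd a m A).1 n v = (∑ᶠ j : ℕ, bcoef m j • a.1 (m - j) (A.1 (n + j) v)) -
      (m.negOnePow : ℤ) • ∑ᶠ j : ℕ, bcoef m j • A.1 (m + n - j) (a.1 j v) := rfl

lemma bcoef_zero_right (m : ℤ) : bcoef m 0 = 1 := by simp [bcoef]

lemma bcoef_add_one (m : ℤ) (j : ℕ) : bcoef (m + 1) (j + 1) = bcoef m (j + 1) - bcoef m j := by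
  rw [bcoef, bcoef, bcoef, Ring.choose_succ_succ]
  ring

lemma bcoef_zero_succ (j : ℕ) : bcoef 0 (j + 1) = 0 := by
  have := Ring.choose_natCast (R := ℤ) 0 (j + 1)
  simp only [Nat.cast_zero] at this
  rw [bcoef, this]; simp

lemma finsum_bcoef_add_one (q : ℤ) {G : ℕ → V} (hG : ∃ N : ℕ, ∀ j, N ≤ j → G j = 0) :
    ∑ᶠ j, bcoef (q + 1) j • G j = ∑ᶠ j, bcoef q j • G j - ∑ᶠ j, bcoef q j • G (j + 1) := by
  obtain ⟨N, hN⟩ := hG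
  rw [finsum_eq_range (N + 1), finsum_eq_range (N + 1), finsum_eq_range N]
  · rw [Finset.sum_range_succ' _ N, Finset.sum_range_succ' _ N]
    simp only [bcoef_add_one, sub_smul, Finset.sum_sub_distrib, bcoef_zero_right]
    abel
  · intro j hj; rw [hN _ (by omega), smul_zero]
  · intro j hj; rw [hN _ (by omega), smul_zero]
  · intro j hj; rw [hN _ (by omega), smul_zero]

/-- Write `z₁ = z + (z₁ - z)` under the residue in `z₁`; on coefficients this is Pascal's rule. All
later inductions on the exponent of `z₁ - z` use this identity. -/
lemma residueProd_shift_one (y : FieldSpace V) (q : ℤ) (A : FieldSpace V) :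
    residueProd (shift 1 y) q A = shift 1 (residueProd y q A) + residueProd y (q + 1) A := by
  ext n v
  change (residueProd (shift 1 y) q A).1 n v =
    (residueProd y q A).1 (n + 1) v + (residueProd y (q + 1) A).1 n v
  simp only [residueProd_apply, shift_apply, Int.negOnePow_add, Int.negOnePow_one, mul_neg, mul_one,
    Units.val_neg]
  rw [finsum_bcoef_add_one q, finsum_bcoef_add_one q]
  · have e1 : (∑ᶠ j : ℕ, bcoef q j • y.1 (q - j + 1) (A.1 (n + j) v)) =
        ∑ᶠ j : ℕ, bcoef q j • y.1 (q + 1 - j) (A.1 (n + j) v) :=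
      finsum_congr fun j => by rw [show q - (j : ℤ) + 1 = q + 1 - j by ring]
    have e2 : (∑ᶠ j : ℕ, bcoef q j • y.1 (q - j) (A.1 (n + 1 + j) v)) =
        ∑ᶠ j : ℕ, bcoef q j • y.1 (q + 1 - (j + 1 : ℕ)) (A.1 (n + (j + 1 : ℕ)) v) :=
      finsum_congr fun j => by
        rw [show q + 1 - ((j + 1 : ℕ) : ℤ) = q - j by push_cast; ring,
          show n + ((j + 1 : ℕ) : ℤ) = n + 1 + j by push_cast; ring]
    have e3 : (∑ᶠ j : ℕ, bcoef q j • A.1 (q + n - j) (y.1 (j + 1) v)) =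
        ∑ᶠ j : ℕ, bcoef q j • A.1 (q + 1 + n - (j + 1 : ℕ)) (y.1 (j + 1 : ℕ) v) :=
      finsum_congr fun j => by
        rw [show q + 1 + n - ((j + 1 : ℕ) : ℤ) = q + n - j by push_cast; ring]; simp
    have e4 : (∑ᶠ j : ℕ, bcoef q j • A.1 (q + (n + 1) - j) (y.1 j v)) =
        ∑ᶠ j : ℕ, bcoef q j • A.1 (q + 1 + n - j) (y.1 j v) :=
      finsum_congr fun j => by rw [show q + (n + 1) - (j : ℤ) = q + 1 + n - j by ring]
    rw [e1, e2, e3, e4, neg_smul, smul_sub]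
    abel
  · obtain ⟨N, hN⟩ := field_exists_nat y 0 v
    exact ⟨N, fun j hj => by have := hN j hj; simp_all⟩
  · obtain ⟨N, hN⟩ := field_exists_nat A n v
    exact ⟨N, fun j hj => by simp [hN j hj]⟩

lemma residueProd_shift_right (x : FieldSpace V) (q p : ℤ) (A : FieldSpace V) :
    residueProd x q (shift p A) = shift p (residueProd x q A) := by
  ext n v
  change (residueProd x q (shift p A)).1 n v = (residueProd x q A).1 (n + p) v
  simp only [residueProd_apply, shift_apply]
  simp_rw [show ∀ j : ℕ, n + (j : ℤ) + p = n + p + j from fun j => by ring,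
    show ∀ j : ℕ, q + n - (j : ℤ) + p = q + (n + p) - j from fun j => by ring]

lemma residueProd_zero_apply (h A : FieldSpace V) (n : ℤ) (v : V) :
    (residueProd h 0 A).1 n v = h.1 0 (A.1 n v) - A.1 n (h.1 0 v) := by
  rw [residueProd_apply, finsum_eq_range 1, finsum_eq_range 1]
  · simp [bcoef_zero_right]
  all_goals
    intro j hj
    obtain ⟨i, rfl⟩ : ∃ i, j = i + 1 := ⟨j - 1, by omega⟩
    rw [bcoef_zero_succ, zero_smul]

/-- The `0`-th product with a field is a derivation of all residue products. -/
lemma residueProd_zero_residueProd (h x : FieldSpace V) (q : ℤ) (A : FieldSpace V) :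
    residueProd h 0 (residueProd x q A) =
      residueProd (residueProd h 0 x) q A + residueProd x q (residueProd h 0 A) := by
  ext n v
  change (residueProd h 0 (residueProd x q A)).1 n v =
    (residueProd (residueProd h 0 x) q A).1 n v + (residueProd x q (residueProd h 0 A)).1 n v
  rw [residueProd_zero_apply, residueProd_apply, residueProd_apply, residueProd_apply,
    residueProd_apply, map_sub, map_zsmul]
  have l1 := leftSupp x.1 q A n v
  have l2 := leftSupp x.1 q A n (h.1 0 v)
  have l3 := leftSupp (residueProd h 0 x).1 q A n v
  have l4 := leftSupp x.1 q (residueProd h 0 A) n v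
  have r1 := rightSupp x q A.1 n v
  have r2 := rightSupp x q A.1 n (h.1 0 v)
  have r3 := rightSupp (residueProd h 0 x) q A.1 n v
  have r4 := rightSupp x q (residueProd h 0 A).1 n v
  have hl : h.1 0 (∑ᶠ j : ℕ, bcoef q j • x.1 (q - j) (A.1 (n + j) v)) -
      (∑ᶠ j : ℕ, bcoef q j • x.1 (q - j) (A.1 (n + j) (h.1 0 v))) =
      (∑ᶠ j : ℕ, bcoef q j • (residueProd h 0 x).1 (q - j) (A.1 (n + j) v)) +
      (∑ᶠ j : ℕ, bcoef q j • x.1 (q - j) ((residueProd h 0 A).1 (n + j) v)) := by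
    rw [map_finsum _ l1, ← finsum_sub_distrib, ← finsum_add_distrib l3 l4]
    · refine finsum_congr fun j => ?_
      simp only [residueProd_zero_apply, map_zsmul, map_sub, smul_sub]
      abel
    · refine l1.subset fun j hj h0 => hj ?_
      simp only at h0
      simp only [h0, map_zero]
    · exact l2
  have hr : h.1 0 (∑ᶠ j : ℕ, bcoef q j • A.1 (q + n - j) (x.1 j v)) -
      (∑ᶠ j : ℕ, bcoef q j • A.1 (q + n - j) (x.1 j (h.1 0 v))) =
      (∑ᶠ j : ℕ, bcoef q j • A.1 (q + n - j) ((residueProd h 0 x).1 j v)) +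
      (∑ᶠ j : ℕ, bcoef q j • (residueProd h 0 A).1 (q + n - j) (x.1 j v)) := by
    rw [map_finsum _ r1, ← finsum_sub_distrib, ← finsum_add_distrib r3 r4]
    · refine finsum_congr fun j => ?_
      simp only [residueProd_zero_apply, map_zsmul, map_sub, smul_sub]
      abel
    · refine r1.subset fun j hj h0 => hj ?_
      simp only at h0
      simp only [h0, map_zero]
    · exact r2
  rw [sub_eq_iff_eq_add] at hl hr
  rw [hl, hr]
  simp only [smul_add]
  abel

/-- Mutual locality of two fields: a high enough power of `z - w` kills their commutator. -/
def IsLocal (y A : FieldSpace V) : Prop :=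
  ∃ R : ℕ, ∀ q : ℤ, R ≤ q → ∀ p : ℤ, residueProd (shift p y) q A = 0

lemma residueProd_shift_add_one (y : FieldSpace V) (q p : ℤ) (A : FieldSpace V) :
    residueProd (shift (p + 1) y) q A =
      shift 1 (residueProd (shift p y) q A) + residueProd (shift p y) (q + 1) A := by
  rw [← residueProd_shift_one, shift_shift, add_comm]

lemma residueProd_shift_idField (A : FieldSpace V) (q : ℕ) (p : ℤ) :
    residueProd (shift p (idField V)) q A = 0 := by
  induction q generalizing p with
  | zero =>
    ext n v
    change (residueProd (shift p (idField V)) 0 A).1 n v = 0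
    rw [residueProd_zero_apply]
    simp only [shift_apply, idField]
    split_ifs <;> simp
  | succ q ih =>
    have := residueProd_shift_add_one (idField V) q p A
    rw [ih, ih, map_zero, zero_add] at this
    exact_mod_cast this.symm

lemma isLocal_idField (y : FieldSpace V) : IsLocal y (idField V) :=
  ⟨0, fun q hq _ => residueProd_idField _ q hq⟩

/-- Commute `h(z₁)`, weighted by `z₁^p (z₁ - z)^r`, past `x(z₂)`. The current part of the commutator
adds the exponents `q` and `r`. The central part differentiates the weight, and the last two terms
are the product rule for `z₁^p (z₁ - z)^r`. The induction on `r` uses `(z₁ - z)^(r+1) = z₁ (z₁ -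
z)^r - z (z₁ - z)^r`, so `p` must vary. -/
lemma residueProd_shift_residueProd {h x y : FieldSpace V} {κ : ℂ}
    (hxy : ∀ (m n : ℤ) (v : V), h.1 m (x.1 n v) - x.1 n (h.1 m v) =
      y.1 (m + n) v + (if m + n = 0 then (m : ℂ) * κ else 0) • v)
    (q : ℤ) (A : FieldSpace V) (r : ℕ) (p : ℤ) :
    residueProd (shift p h) r (residueProd x q A) =
      residueProd x q (residueProd (shift p h) r A) + residueProd (shift p y) (q + r) A
      + (p * κ) • residueProd (shift (p - 1) (idField V)) (q + r) A
      + (r * κ) • residueProd (shift p (idField V)) (q + r - 1) A := by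
  induction r generalizing p with
  | zero =>
    have : residueProd (shift p h) 0 x = shift p y + (p * κ) • shift (p - 1) (idField V) := by
      ext n v
      change (residueProd (shift p h) 0 x).1 n v =
        y.1 (n + p) v + (p * κ) • (idField V).1 (n + (p - 1)) v
      rw [residueProd_zero_apply, shift_apply, hxy, zero_add, add_comm p n]
      congr 1
      simp only [idField]
      by_cases hn : n + p = 0
      · rw [if_pos hn, if_pos (by omega), LinearMap.id_apply]
      · rw [if_neg hn, if_neg (by omega)]; simp
    simp only [Nat.cast_zero, zero_mul, zero_smul, add_zero]
    rw [residueProd_zero_residueProd, this, residueProd_add, residueProd_smul]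
    simp only [LinearMap.add_apply, LinearMap.smul_apply]
    abel
  | succ r ih =>
    have key (q r p : ℤ) (y A : FieldSpace V) : residueProd (shift p y) (r + 1) A =
        residueProd (shift (p + 1) y) r A - shift 1 (residueProd (shift p y) r A) := by
      rw [residueProd_shift_add_one]; abel
    push_cast
    rw [key q r p h (residueProd x q A), ih, ih, ← add_assoc, key q (q + r) p y,
      show q + r + 1 - 1 = (q + r - 1) + 1 by ring,
      key q (q + r) (p - 1), key q (q + r - 1) p, key q r p h A]
    simp only [map_add, map_sub, map_smul, residueProd_shift_right, sub_add_cancel,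
      add_sub_cancel_right]
    have e : residueProd (shift p (idField V)) (q + r) A =
        residueProd (shift (p + 1) (idField V)) (q + r - 1) A
        - shift 1 (residueProd (shift p (idField V)) (q + r - 1) A) := by
      rw [← key q, sub_add_cancel]
    rw [e]
    push_cast
    module

/-- Dong's lemma for currents: for `r` large, the four terms of `residueProd_shift_residueProd`
vanish separately. The bound makes `q + r ≥ S` and `q + r - 1 ≥ 0`, the latter because the identity
field has zero products only for nonnegative exponents. -/
lemma IsLocal.residueProd {h x y : FieldSpace V} {κ : ℂ}
    (hxy : ∀ (m n : ℤ) (v : V), h.1 m (x.1 n v) - x.1 n (h.1 m v) =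
      y.1 (m + n) v + (if m + n = 0 then (m : ℂ) * κ else 0) • v)
    (q : ℤ) {A : FieldSpace V} (hA : IsLocal h A) (yA : IsLocal y A) :
    IsLocal h (residueProd x q A) := by
  obtain ⟨R, hR⟩ := hA
  obtain ⟨S, hS⟩ := yA
  refine ⟨R + S + 1 + q.natAbs, fun r hr p => ?_⟩
  obtain ⟨r, rfl⟩ := Int.eq_ofNat_of_zero_le (show 0 ≤ r by omega)
  obtain ⟨s, hs⟩ := Int.eq_ofNat_of_zero_le (show 0 ≤ q + r - 1 by omega)
  rw [residueProd_shift_residueProd hxy, hR _ (by omega), hS _ (by omega), hs,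
    show q + r = (s + 1 : ℕ) by push_cast; omega, residueProd_shift_idField,
    residueProd_shift_idField]
  simp

/-- Descend on the exponent `q`. If all shifted products vanish at `q + 1`, then at `q` replacing
`p` by `p + 1` only multiplies the product by `z`, so vanishing at `p = 0`, which is the hypothesis,
spreads to all `p`. At `q = 0` the `p`-shifted product is the commutator with `h(p)`. -/
lemma IsLocal.commute {h A : FieldSpace V} (hA : IsLocal h A)
    (h0 : ∀ q : ℤ, 0 ≤ q → Parafermion.residueProd h q A = 0) (p n : ℤ) (v : V) :
    h.1 p (A.1 n v) = A.1 n (h.1 p v) := by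
  obtain ⟨R, hR⟩ := hA
  have key : ∀ d q : ℕ, R ≤ q + d → ∀ p, Parafermion.residueProd (shift p h) q A = 0 := by
    intro d
    induction d with
    | zero => intro q hq p; exact hR q (by omega) p
    | succ d ih =>
      intro q hq p
      have h1 (p : ℤ) : Parafermion.residueProd (shift (p + 1) h) q A =
          shift 1 (Parafermion.residueProd (shift p h) q A) := by
        rw [residueProd_shift_add_one]
        have := ih (q + 1) (by omega) p
        push_cast at this
        rw [this, add_zero]
      induction p using Int.induction_on with
      | zero => rw [shift_zero]; exact h0 q (by omega)
      | succ i hi => rw [h1, hi, map_zero]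
      | pred i hi =>
        have h2 := h1 (-i - 1)
        rw [sub_add_cancel, hi] at h2
        have h3 := congrArg (shift (-1)) h2
        rw [shift_shift, map_zero] at h3
        simpa [shift_zero] using h3.symm
  have := key R 0 (by omega) p
  have h2 := congrArg (fun F : FieldSpace V => F.1 n v) this
  simp only [Nat.cast_zero, residueProd_zero_apply, shift_apply, zero_add] at h2
  exact sub_eq_zero.1 h2

end FieldCalculus
end Parafermion

/-! ### Vertex subalgebras of `V(k,0)` and Heisenberg vacua -/

namespace Parafermion
section VacuumModuleCalculus
variable {𝔤 : Type*} [LieRing 𝔤] [LieAlgebra ℂ 𝔤] (B : InvForm 𝔤) (k : ℂ)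

section UEA
attribute [local instance 100] LieRing.ofAssociativeRing

/-- `V(k,0)` is generated from the vacuum by the operators `x(n)`. -/
lemma mem_of_modeEnd_stable (W : Submodule ℂ (VacuumModule B k)) (h1 : vacuum B k ∈ W)
    (hW : ∀ x n, ∀ v ∈ W, modeEnd B k x n v ∈ W) (v : VacuumModule B k) : v ∈ W := by
  let S : Subalgebra ℂ (UAff B) :=
    { carrier := {u | ∀ w ∈ W, u • w ∈ W}
      mul_mem' := fun {a b} ha hb w hw => by rw [mul_smul]; exact ha _ (hb _ hw)
      add_mem' := fun {a b} ha hb w hw => by rw [add_smul]; exact W.add_mem (ha _ hw) (hb _ hw)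
      algebraMap_mem' := fun r w hw => by rw [algebraMap_smul]; exact W.smul_mem r hw }
  have hS : ∀ u, u ∈ S := uea_induction S fun z w hw => by
    rw [eq_sum_loopElt B z, map_add, add_smul, map_smul, smul_assoc, central_smul, Finsupp.sum,
      map_sum, Finset.sum_smul]
    exact W.add_mem (W.sum_mem fun m _ => hW _ _ _ hw) (W.smul_mem _ (W.smul_mem _ hw))
  obtain ⟨u, rfl⟩ := toVacuum_surjective B k v
  have := hS u (vacuum B k) h1
  rwa [vacuum, ← map_smul, smul_eq_mul, mul_one] at this

end UEA

lemma modeEnd_add (x y : 𝔤) (n : ℤ) :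
    modeEnd B k (x + y) n = modeEnd B k x n + modeEnd B k y n := by
  ext v; simp [modeEnd]

lemma modeEnd_smul (c : ℂ) (x : 𝔤) (n : ℤ) : modeEnd B k (c • x) n = c • modeEnd B k x n := by
  ext v; simp [modeEnd]

lemma modeEnd_zero (n : ℤ) : modeEnd B k 0 n = 0 := by
  simpa using modeEnd_smul B k 0 0 n

lemma modeEnd_neg (x : 𝔤) (n : ℤ) : modeEnd B k (-x) n = -modeEnd B k x n := by
  simpa using modeEnd_smul B k (-1) x n

lemma modeEnd_sum {ι : Type*} (s : Finset ι) (x : ι → 𝔤) (n : ℤ) :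
    modeEnd B k (∑ i ∈ s, x i) n = ∑ i ∈ s, modeEnd B k (x i) n := by
  classical
  induction s using Finset.induction_on with
  | empty => simp [modeEnd_zero]
  | insert i s hi ih => rw [Finset.sum_insert hi, Finset.sum_insert hi, modeEnd_add, ih]

lemma modeEnd_swap (x y : 𝔤) (m n : ℤ) (v : VacuumModule B k) :
    modeEnd B k x m (modeEnd B k y n v) = modeEnd B k y n (modeEnd B k x m v) +
      modeEnd B k ⁅x, y⁆ (m + n) v +
        (if m + n = 0 then (m : ℂ) * (B.form x y * k) else 0) • v := by
  rw [add_assoc, ← modeEnd_comm]; abel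

lemma exists_modeEnd_eq_zero (x : 𝔤) (v : VacuumModule B k) :
    ∃ N : ℕ, ∀ j : ℕ, N ≤ j → modeEnd B k x j v = 0 := by
  obtain ⟨N, hN⟩ := modeEnd_truncation B k v x
  exact ⟨N.toNat, fun j hj => hN _ (by omega)⟩

/-- Induction over the generation of `V(k,0)` by currents. The statement is proved for all `y` at
once because adding `x(n)` requires locality with `⁅y, x⁆` as well. -/
lemma isLocal_stateField (y : 𝔤) (a : VacuumModule B k) :
    IsLocal (currentField B k y) (stateField B k a) := by
  let W : Submodule ℂ (VacuumModule B k) :=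
    { carrier := {a | ∀ y, IsLocal (currentField B k y) (stateField B k a)}
      add_mem' := fun {a b} ha hb y => by
        obtain ⟨R, hR⟩ := ha y
        obtain ⟨S, hS⟩ := hb y
        exact ⟨max R S, fun q hq p => by
          rw [map_add, map_add, hR _ (by push_cast at hq; omega), hS _ (by push_cast at hq; omega),
            add_zero]⟩
      zero_mem' := fun y => ⟨0, fun q _ p => by rw [map_zero, map_zero]⟩
      smul_mem' := fun c a ha y => by
        obtain ⟨R, hR⟩ := ha y
        exact ⟨R, fun q hq p => by rw [map_smul, map_smul, hR q hq, smul_zero]⟩ }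
  refine mem_of_modeEnd_stable B k W ?_ ?_ a y
  · intro y
    rw [stateField_vacuum]
    exact isLocal_idField _
  · intro x n v hv y
    rw [stateField_modeEnd]
    exact IsLocal.residueProd (modeEnd_comm B k y x) n (hv y) (hv ⁅y, x⁆)

/-- A state that is annihilated by all `h(j)`, `j ≥ 0`, has a vertex operator that commutes with
all modes of `h`. -/
lemma modeEnd_nProd_comm {h : 𝔤} {a : VacuumModule B k}
    (ha : ∀ j : ℤ, 0 ≤ j → modeEnd B k h j a = 0) (p n : ℤ) (v : VacuumModule B k) :
    modeEnd B k h p (nProd B k a n v) = nProd B k a n (modeEnd B k h p v) :=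
  (isLocal_stateField B k h a).commute (fun q hq => by
    rw [← stateField_modeEnd, ha q hq, map_zero]) p n v

lemma nProd_vacuum (n : ℤ) (v : VacuumModule B k) :
    nProd B k (vacuum B k) n v = if n = -1 then v else 0 := by
  rw [nProd, stateField_vacuum]
  change (if n = -1 then LinearMap.id else 0 : Module.End ℂ (VacuumModule B k)) v = _
  split_ifs <;> rfl

lemma nProd_current (x : 𝔤) (n : ℤ) (v : VacuumModule B k) :
    nProd B k (modeEnd B k x (-1) (vacuum B k)) n v = modeEnd B k x n v := by
  rw [nProd, stateField_current]; rfl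

lemma nProd_modeEnd (x : 𝔤) (m : ℤ) (a : VacuumModule B k) (n : ℤ) (v : VacuumModule B k) :
    nProd B k (modeEnd B k x m a) n v =
      (∑ᶠ j : ℕ, bcoef m j • modeEnd B k x (m - j) (nProd B k a (n + j) v)) -
      (m.negOnePow : ℤ) • ∑ᶠ j : ℕ, bcoef m j • nProd B k a (m + n - j) (modeEnd B k x j v) := by
  rw [nProd, stateField_modeEnd, residueProd_apply]; rfl

lemma nProd_add_left (a b : VacuumModule B k) (n : ℤ) (v : VacuumModule B k) :
    nProd B k (a + b) n v = nProd B k a n v + nProd B k b n v := by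
  simp [nProd]

lemma nProd_smul_left (c : ℂ) (a : VacuumModule B k) (n : ℤ) (v : VacuumModule B k) :
    nProd B k (c • a) n v = c • nProd B k a n v := by
  simp [nProd]

lemma nProd_zero_left (n : ℤ) (v : VacuumModule B k) : nProd B k 0 n v = 0 := by
  simp [nProd]

lemma nProd_zero_right (a : VacuumModule B k) (n : ℤ) : nProd B k a n 0 = 0 := by
  simp [nProd]

lemma finsum_mem_submodule {W : Submodule ℂ (VacuumModule B k)} {f : ℕ → VacuumModule B k}
    (hf : ∀ j, f j ∈ W) : ∑ᶠ j, f j ∈ W :=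
  finsum_induction (· ∈ W) W.zero_mem (fun _ _ => W.add_mem) hf

lemma nProd_modeEnd_mem {W : Submodule ℂ (VacuumModule B k)} {x : 𝔤} {m : ℤ}
    {a : VacuumModule B k} {n : ℤ} {v : VacuumModule B k}
    (h1 : ∀ j : ℕ, modeEnd B k x (m - j) (nProd B k a (n + j) v) ∈ W)
    (h2 : ∀ j : ℕ, nProd B k a (m + n - j) (modeEnd B k x j v) ∈ W) :
    nProd B k (modeEnd B k x m a) n v ∈ W := by
  rw [nProd_modeEnd]
  exact W.sub_mem (finsum_mem_submodule B k fun j => zsmul_mem (h1 j) _)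
    (zsmul_mem (finsum_mem_submodule B k fun j => zsmul_mem (h2 j) _) _)

variable {B k}

lemma isVertexSubalgebra_vertexClosure (S : Set (VacuumModule B k)) :
    IsVertexSubalgebra B k (vertexClosure B k S) where
  vacuum_mem := Submodule.mem_sInf.2 fun _ hW => hW.1.vacuum_mem
  nProd_mem u hu v hv n := Submodule.mem_sInf.2 fun W hW =>
    hW.1.nProd_mem u (Submodule.mem_sInf.1 hu W hW) v (Submodule.mem_sInf.1 hv W hW) n

lemma subset_vertexClosure (S : Set (VacuumModule B k)) : S ⊆ vertexClosure B k S :=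
  fun _ hv => Submodule.mem_sInf.2 fun _ hW => hW.2 hv

lemma vertexClosure_le {S : Set (VacuumModule B k)} {W : Submodule ℂ (VacuumModule B k)}
    (hW : IsVertexSubalgebra B k W) (hS : S ⊆ W) : vertexClosure B k S ≤ W :=
  sInf_le ⟨hW, hS⟩

lemma IsVertexSubalgebra.modeEnd_mem {W : Submodule ℂ (VacuumModule B k)}
    (hW : IsVertexSubalgebra B k W) {x : 𝔤} (hx : modeEnd B k x (-1) (vacuum B k) ∈ W)
    (n : ℤ) {v : VacuumModule B k} (hv : v ∈ W) : modeEnd B k x n v ∈ W := by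
  rw [← nProd_current]
  exact hW.nProd_mem _ hx _ hv n

variable (B k)

/-- The vectors that are annihilated by `h(n)` for all `h ∈ H` and `n ≥ 0`. -/
noncomputable def heisenbergVacua (H : Submodule ℂ 𝔤) : Submodule ℂ (VacuumModule B k) where
  carrier := {v | ∀ h ∈ H, ∀ n : ℤ, 0 ≤ n → modeEnd B k h n v = 0}
  add_mem' {v w} hv hw h hh n hn := by rw [map_add, hv h hh n hn, hw h hh n hn, add_zero]
  zero_mem' _ _ _ _ := map_zero _
  smul_mem' c v hv h hh n hn := by rw [map_smul, hv h hh n hn, smul_zero]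

variable {B k} {H : Submodule ℂ 𝔤}

lemma nProd_modeEnd_comm {a : VacuumModule B k} (ha : a ∈ heisenbergVacua B k H) {h : 𝔤}
    (hh : h ∈ H) (p n : ℤ) (v : VacuumModule B k) :
    nProd B k a n (modeEnd B k h p v) = modeEnd B k h p (nProd B k a n v) :=
  (modeEnd_nProd_comm B k (ha h hh) p n v).symm

lemma isVertexSubalgebra_heisenbergVacua :
    IsVertexSubalgebra B k (heisenbergVacua B k H) where
  vacuum_mem h _ n hn := modeEnd_vacuum B k h n hn
  nProd_mem u hu v hv n h hh m hm := by
    rw [← nProd_modeEnd_comm hu hh, hv h hh m hm, nProd_zero_right]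

variable (B k H) in
/-- The smallest subspace that contains `U` and is stable under `h(n)` for `h ∈ H` and `n < 0`. -/
noncomputable def heisenbergSpan (U : Submodule ℂ (VacuumModule B k)) : Submodule ℂ (VacuumModule B k) :=
  sInf {P | U ≤ P ∧ ∀ h ∈ H, ∀ n : ℤ, n < 0 → ∀ v ∈ P, modeEnd B k h n v ∈ P}

lemma le_heisenbergSpan (U : Submodule ℂ (VacuumModule B k)) : U ≤ heisenbergSpan B k H U :=
  le_sInf fun _ hP => hP.1

lemma modeEnd_mem_heisenbergSpan_of_neg {U : Submodule ℂ (VacuumModule B k)} {h : 𝔤} (hh : h ∈ H)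
    {n : ℤ} (hn : n < 0) {v : VacuumModule B k} (hv : v ∈ heisenbergSpan B k H U) :
    modeEnd B k h n v ∈ heisenbergSpan B k H U :=
  Submodule.mem_sInf.2 fun P hP => hP.2 h hh n hn v (Submodule.mem_sInf.1 hv P hP)

/-- Intersecting `P` with the span itself makes membership of `v` in the span available in the
inductive step. -/
lemma heisenbergSpan_le {U P : Submodule ℂ (VacuumModule B k)} (hU : U ≤ P)
    (hP : ∀ h ∈ H, ∀ n : ℤ, n < 0 → ∀ v ∈ heisenbergSpan B k H U, v ∈ P → modeEnd B k h n v ∈ P) :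
    heisenbergSpan B k H U ≤ P := by
  have : heisenbergSpan B k H U ≤ P ⊓ heisenbergSpan B k H U :=
    sInf_le ⟨le_inf hU (le_heisenbergSpan U), fun h hh n hn v hv =>
      ⟨hP h hh n hn v hv.2 hv.1, modeEnd_mem_heisenbergSpan_of_neg hh hn hv.2⟩⟩
  exact this.trans inf_le_left

/-- As `H` is abelian, moving a nonnegative mode to the right past a negative one costs only a
scalar, and on reaching `U` it acts by zero. -/
lemma modeEnd_mem_heisenbergSpan (hH : ∀ x ∈ H, ∀ y ∈ H, ⁅x, y⁆ = 0)
    {U : Submodule ℂ (VacuumModule B k)} (hU : U ≤ heisenbergVacua B k H) {h : 𝔤} (hh : h ∈ H)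
    (n : ℤ) {v : VacuumModule B k} (hv : v ∈ heisenbergSpan B k H U) :
    modeEnd B k h n v ∈ heisenbergSpan B k H U := by
  rcases lt_or_ge n 0 with hn | hn
  · exact modeEnd_mem_heisenbergSpan_of_neg hh hn hv
  · let P : Submodule ℂ (VacuumModule B k) :=
      (heisenbergSpan B k H U).comap (modeEnd B k h n)
    refine heisenbergSpan_le (P := P) (fun u hu => ?_) (fun x hx m hm w hw hwP => ?_) hv
    · change modeEnd B k h n u ∈ heisenbergSpan B k H U
      rw [hU hu h hh n hn]
      exact zero_mem _
    · change modeEnd B k h n (modeEnd B k x m w) ∈ heisenbergSpan B k H U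
      rw [modeEnd_swap, hH h hh x hx, modeEnd_zero, LinearMap.zero_apply, add_zero]
      exact add_mem (modeEnd_mem_heisenbergSpan_of_neg hx hm hwP) (Submodule.smul_mem _ _ hw)

/-- Induction on both factors. A left factor from `U` has modes that commute with the Heisenberg
modes, so the right factor can be stripped down to `U`, where closure is known. A left factor
`h(m)a` is handled by the iterate formula, since the span is stable under every `h(n)`. -/
lemma isVertexSubalgebra_heisenbergSpan (hH : ∀ x ∈ H, ∀ y ∈ H, ⁅x, y⁆ = 0)
    {U : Submodule ℂ (VacuumModule B k)} (hU : U ≤ heisenbergVacua B k H)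
    (hU' : IsVertexSubalgebra B k U) :
    IsVertexSubalgebra B k (heisenbergSpan B k H U) where
  vacuum_mem := le_heisenbergSpan U hU'.vacuum_mem
  nProd_mem a ha w hw := by
    let P : Submodule ℂ (VacuumModule B k) :=
      { carrier := {a | ∀ (n : ℤ), ∀ w ∈ heisenbergSpan B k H U,
          nProd B k a n w ∈ heisenbergSpan B k H U}
        add_mem' := fun ha hb n w hw => by
          rw [nProd_add_left]; exact add_mem (ha n w hw) (hb n w hw)
        zero_mem' := fun n w _ => by rw [nProd_zero_left]; exact zero_mem _
        smul_mem' := fun c a ha n w hw => by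
          rw [nProd_smul_left]; exact Submodule.smul_mem _ _ (ha n w hw) }
    intro n
    refine heisenbergSpan_le (P := P) (fun u hu n w hw => ?_) (fun x hx m _ a _ haP n w hw => ?_)
      ha n w hw
    · let Q : Submodule ℂ (VacuumModule B k) :=
        (heisenbergSpan B k H U).comap ((stateField B k u).1 n)
      refine heisenbergSpan_le (P := Q) (fun u' hu' => ?_) (fun x hx m hm w hw hwQ => ?_) hw
      · exact le_heisenbergSpan U (hU'.nProd_mem u hu u' hu' n)
      · change nProd B k u n (modeEnd B k x m w) ∈ heisenbergSpan B k H U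
        rw [nProd_modeEnd_comm (hU hu) hx]
        exact modeEnd_mem_heisenbergSpan_of_neg hx hm hwQ
    · exact nProd_modeEnd_mem B k
        (fun j => modeEnd_mem_heisenbergSpan hH hU hx _ (haP _ w hw))
        (fun j => haP _ _ (modeEnd_mem_heisenbergSpan hH hU hx _ hw))

lemma span_vacuum_le : (ℂ ∙ vacuum B k) ≤ heisenbergVacua B k H :=
  (Submodule.span_singleton_le_iff_mem _ _).2 isVertexSubalgebra_heisenbergVacua.vacuum_mem

lemma isVertexSubalgebra_span_vacuum : IsVertexSubalgebra B k (ℂ ∙ vacuum B k) where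
  vacuum_mem := Submodule.mem_span_singleton_self _
  nProd_mem u hu v hv n := by
    obtain ⟨c, rfl⟩ := Submodule.mem_span_singleton.1 hu
    rw [nProd_smul_left, nProd_vacuum]
    split_ifs
    · exact Submodule.smul_mem _ _ hv
    · simp

/-- The commutant of the Heisenberg vertex subalgebra consists of the vacuum vectors for the
Heisenberg algebra. -/
lemma parafermion_eq_heisenbergVacua (hH : ∀ x ∈ H, ∀ y ∈ H, ⁅x, y⁆ = 0) :
    parafermion B k H = heisenbergVacua B k H := by
  apply le_antisymm
  · intro v hv h hh n hn
    have := hv _ (subset_vertexClosure _ ⟨h, hh, rfl⟩) n hn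
    rwa [nProd_current] at this
  · intro v hv u hu n hn
    have hu' : u ∈ heisenbergSpan B k H (ℂ ∙ vacuum B k) := by
      refine vertexClosure_le (isVertexSubalgebra_heisenbergSpan hH span_vacuum_le
        isVertexSubalgebra_span_vacuum) ?_ hu
      rintro _ ⟨h, hh, rfl⟩
      exact modeEnd_mem_heisenbergSpan_of_neg hh (by omega)
        (le_heisenbergSpan _ (Submodule.mem_span_singleton_self _))
    let P : Submodule ℂ (VacuumModule B k) :=
      { carrier := {a | ∀ n : ℤ, 0 ≤ n → nProd B k a n v = 0}
        add_mem' := fun ha hb n hn => by rw [nProd_add_left, ha n hn, hb n hn, add_zero]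
        zero_mem' := fun n _ => nProd_zero_left B k n v
        smul_mem' := fun c a ha n hn => by rw [nProd_smul_left, ha n hn, smul_zero] }
    refine heisenbergSpan_le (P := P) ?_ (fun h hh m hm a _ haP n hn => ?_) hu' n hn
    · rw [Submodule.span_singleton_le_iff_mem]
      intro n hn
      rw [nProd_vacuum, if_neg (by omega)]
    -- Taking `⊥` as the subspace: every summand of the iterate formula vanishes, since it contains
    -- either a nonnegative product of `a` with `v` or some `h(j)v` with `j ≥ 0`.
    · refine (Submodule.mem_bot ℂ).1 (nProd_modeEnd_mem B k (fun j => ?_) (fun j => ?_))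
      · rw [haP _ (by omega), map_zero]; exact zero_mem _
      · rw [hv h hh j (by omega), nProd_zero_right]; exact zero_mem _

/-- In the span of Heisenberg descendants of a space `U` of vacuum vectors, the vacuum vectors are
those of `U`. -/
lemma heisenbergVacua_inf_heisenbergSpan_le (hH : ∀ x ∈ H, ∀ y ∈ H, ⁅x, y⁆ = 0) (hk : k ≠ 0)
    {ι : Type*} [Fintype ι] (b d : ι → 𝔤) (hb : ∀ i, b i ∈ H) (hd : ∀ i, d i ∈ H)
    (hbd : ∀ h ∈ H, ∑ i, B.form (d i) h • b i = h)
    {U : Submodule ℂ (VacuumModule B k)} (hU : U ≤ heisenbergVacua B k H) :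
    heisenbergVacua B k H ⊓ heisenbergSpan B k H U ≤ U := by
  rintro v ⟨hv, hvU⟩
  -- A number operator counting the Heisenberg factors `h(-n)` with `1 ≤ n ≤ N`. The factor `1 / (k
  -- n)` cancels the central term, so that `[E N, h(-n)] = h(-n)`. The truncation at `N` makes it a
  -- finite sum; `N` is chosen later, depending on the vector.
  let E (N : ℕ) : Module.End ℂ (VacuumModule B k) := ∑ n ∈ Finset.Icc 1 N, ∑ i,
    (1 / (k * n)) • (modeEnd B k (b i) (-n) * modeEnd B k (d i) n)
  have hE0 (N : ℕ) (u : VacuumModule B k) (hu : u ∈ heisenbergVacua B k H) : E N u = 0 := by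
    simp only [E, LinearMap.sum_apply, LinearMap.smul_apply, Module.End.mul_apply]
    refine Finset.sum_eq_zero fun n _ => Finset.sum_eq_zero fun i _ => ?_
    rw [hu _ (hd i) n (by omega), map_zero, smul_zero]
  have hE (N n : ℕ) (h1 : 1 ≤ n) (hn : n ≤ N) (h : 𝔤) (hh : h ∈ H) (w : VacuumModule B k) :
      E N (modeEnd B k h (-n) w) = modeEnd B k h (-n) (E N w) + modeEnd B k h (-n) w := by
    have e1 (m : ℕ) (i : ι) : modeEnd B k (b i) (-m) (modeEnd B k (d i) m (modeEnd B k h (-n) w)) =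
        modeEnd B k h (-n) (modeEnd B k (b i) (-m) (modeEnd B k (d i) m w)) +
        (if m = n then (n : ℂ) * (B.form (d i) h * k) else 0) • modeEnd B k (b i) (-m) w := by
      rw [modeEnd_swap B k (d i) h, hH _ (hd i) h hh, modeEnd_zero, LinearMap.zero_apply, add_zero,
        map_add, map_smul, modeEnd_swap B k (b i) h, hH _ (hb i) h hh, modeEnd_zero,
        LinearMap.zero_apply, add_zero]
      by_cases hmn : m = n
      · subst hmn
        rw [if_neg (by omega), if_pos (by omega), if_pos rfl, zero_smul, add_zero]
        simp
      · have hm' : ¬ ((m : ℤ) + -n = 0) := by omega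
        rw [if_neg hmn, if_neg hm']
        by_cases hz : m = 0 ∧ n = 0
        · omega
        · rw [if_neg (by omega)]
          simp
    simp only [E, LinearMap.sum_apply, LinearMap.smul_apply, Module.End.mul_apply, map_sum, e1,
      map_smul, smul_add, Finset.sum_add_distrib]
    congr 1
    rw [Finset.sum_eq_single n]
    · have hn0 : (n : ℂ) ≠ 0 := by exact_mod_cast (by omega : n ≠ 0)
      conv_rhs => rw [← hbd h hh, modeEnd_sum, LinearMap.sum_apply]
      refine Finset.sum_congr rfl fun i _ => ?_
      rw [if_pos rfl, smul_smul, modeEnd_smul, LinearMap.smul_apply]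
      congr 1
      field_simp
    · intro m _ hmn
      refine Finset.sum_eq_zero fun i _ => ?_
      rw [if_neg hmn, zero_smul, smul_zero]
    · intro hn'
      exact absurd (Finset.mem_Icc.2 ⟨h1, hn⟩) hn'
  -- `Z` has the form in which independence of eigenspaces is stated. `Z'` keeps only positive
  -- integral eigenvalues, because this set, unlike the nonzero numbers, is stable under the shift
  -- by `1` that `h(-n)` causes.
  let Z (N : ℕ) : Submodule ℂ (VacuumModule B k) :=
    ⨆ (μ : ℂ) (_ : μ ≠ 0), (E N).eigenspace μ
  let Z' (N : ℕ) : Submodule ℂ (VacuumModule B k) := ⨆ (r : ℕ), (E N).eigenspace (r + 1 : ℂ)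
  have hZ' (N : ℕ) : Z' N ≤ Z N := iSup_le fun r =>
    le_iSup₂_of_le (r + 1 : ℂ) (by exact_mod_cast Nat.succ_ne_zero r) le_rfl
  have key : ∀ w ∈ heisenbergSpan B k H U, ∃ N₀ : ℕ, ∀ N, N₀ ≤ N → w ∈ U ⊔ Z' N := by
    let P : Submodule ℂ (VacuumModule B k) :=
      { carrier := {w | ∃ N₀ : ℕ, ∀ N, N₀ ≤ N → w ∈ U ⊔ Z' N}
        add_mem' := fun {v w} ⟨N, hN⟩ ⟨M, hM⟩ => ⟨max N M, fun K hK =>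
          add_mem (hN K (le_trans (le_max_left _ _) hK)) (hM K (le_trans (le_max_right _ _) hK))⟩
        zero_mem' := ⟨0, fun _ _ => zero_mem _⟩
        smul_mem' := fun c w ⟨N, hN⟩ => ⟨N, fun K hK => Submodule.smul_mem _ _ (hN K hK)⟩ }
    intro w hw
    refine heisenbergSpan_le (P := P) (fun u hu => ⟨0, fun N _ => Submodule.mem_sup_left hu⟩)
      (fun h hh m hm w _ ⟨N₀, hN₀⟩ => ?_) hw
    obtain ⟨n, rfl⟩ : ∃ n : ℕ, m = -n := ⟨(-m).toNat, by omega⟩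
    refine ⟨max N₀ n, fun N hN => Submodule.mem_sup_right ?_⟩
    have hle : U ⊔ Z' N ≤ (Z' N).comap (modeEnd B k h (-n)) := by
      refine sup_le (fun u hu => ?_) (iSup_le fun r u hu => ?_)
      · refine Submodule.mem_iSup_of_mem 0 (Module.End.mem_eigenspace_iff.2 ?_)
        rw [hE N n (by omega) (le_trans (le_max_right _ _) hN) h hh, hE0 N u (hU hu)]
        simp
      · refine Submodule.mem_iSup_of_mem (r + 1) (Module.End.mem_eigenspace_iff.2 ?_)
        rw [hE N n (by omega) (le_trans (le_max_right _ _) hN) h hh,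
          Module.End.mem_eigenspace_iff.1 hu, map_smul]
        push_cast
        module
    exact hle (hN₀ N (le_trans (le_max_left _ _) hN))
  obtain ⟨N, hN⟩ := key v hvU
  obtain ⟨u, hu, z, hz, rfl⟩ := Submodule.mem_sup.1 (hN N le_rfl)
  -- `E N` kills both `u + z` and `u`, hence `z`, which is also a sum of eigenvectors with positive
  -- eigenvalues.
  have h0 : z ∈ (E N).eigenspace 0 := by
    rw [Module.End.mem_eigenspace_iff, zero_smul]
    have := hE0 N _ hv
    rwa [map_add, hE0 N u (hU hu), zero_add] at this
  have hd := (Module.End.eigenspaces_iSupIndep (E N)) 0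
  have : z = 0 := (Submodule.disjoint_def.1 hd) z h0 (hZ' N hz)
  rwa [this, add_zero]

end VacuumModuleCalculus
end Parafermion

/-! ### Triples of level `κ`: the vectors `ω` and `W³` are Heisenberg vacua -/

namespace Parafermion
section Triples
variable {𝔤 : Type*} [LieRing 𝔤] [LieAlgebra ℂ 𝔤]

/-- `(h, e, f)` is an `sl₂`-triple for which `e ⊗ t^m`, `f ⊗ t^n`, `h ⊗ t^p` generate a copy of the
affine Lie algebra of `sl₂` that acts at level `κ` on modules of level `k`. -/
structure IsLevelTriple (B : InvForm 𝔤) (k κ : ℂ) (h e f : 𝔤) : Prop where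
  lie_h_e : ⁅h, e⁆ = (2 : ℂ) • e
  lie_h_f : ⁅h, f⁆ = (-2 : ℂ) • f
  lie_e_f : ⁅e, f⁆ = h
  form_h_h : B.form h h * k = 2 * κ
  form_e_f : B.form e f * k = κ
  form_e_e : B.form e e = 0
  form_f_f : B.form f f = 0
  form_h_e : B.form h e = 0
  form_h_f : B.form h f = 0

variable {B : InvForm 𝔤} {k κ : ℂ} {h e f : 𝔤}

lemma modeEnd_comm_eigen {x y : 𝔤} {a c : ℂ} (hxy : ⁅x, y⁆ = a • y) (hB : B.form x y * k = c)
    (m n : ℤ) (v : VacuumModule B k) :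
    modeEnd B k x m (modeEnd B k y n v) = modeEnd B k y n (modeEnd B k x m v) +
      a • modeEnd B k y (m + n) v + (if m + n = 0 then (m : ℂ) * c else 0) • v := by
  rw [modeEnd_swap, hxy, modeEnd_smul, LinearMap.smul_apply, hB]

namespace IsLevelTriple

lemma e_f_vacuum (T : IsLevelTriple B k κ h e f) {i : ℤ} (hi : 0 ≤ i) (p : ℤ) :
    modeEnd B k e i (modeEnd B k f p (vacuum B k)) = modeEnd B k h (i + p) (vacuum B k) +
      (if i + p = 0 then (i : ℂ) * κ else 0) • vacuum B k := by
  rw [modeEnd_swap, modeEnd_vacuum B k e i hi, map_zero, zero_add, T.lie_e_f, T.form_e_f]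

/-- `x` acts on the triple like an element of a Cartan subalgebra that contains `h`. -/
structure IsToral (B : InvForm 𝔤) (k κ : ℂ) (h e f x : 𝔤) (a : ℂ) : Prop where
  lie_h : ⁅x, h⁆ = 0
  lie_e : ⁅x, e⁆ = a • e
  lie_f : ⁅x, f⁆ = (-a) • f
  form_h : B.form x h * k = κ * a
  form_e : B.form x e = 0
  form_f : B.form x f = 0

/-- A direct check, which explains the coefficients of the two vectors. The case `n = 0` holds
because their weight is zero. For `n ≥ 4` all contributions vanish by degree, as the conformal
weights are `2` and `3`. For `n = 1, 2, 3` the terms cancel thanks to the chosen coefficients. -/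
lemma IsToral.modeEnd_eq_zero (T : IsLevelTriple B k κ h e f) {x : 𝔤} {a : ℂ}
    (X : IsToral B k κ h e f x a) {n : ℤ} (hn : 0 ≤ n) :
    modeEnd B k x n (omegaVec B k κ h e f) = 0 ∧ modeEnd B k x n (wVec B k κ h e f) = 0 := by
  have sh (n p : ℤ) (v : VacuumModule B k) : modeEnd B k x n (modeEnd B k h p v) =
      modeEnd B k h p (modeEnd B k x n v) + (if n + p = 0 then (n : ℂ) * (κ * a) else 0) • v := by
    rw [modeEnd_swap, X.lie_h, modeEnd_zero, X.form_h]; simp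
  have se (n p : ℤ) (v : VacuumModule B k) : modeEnd B k x n (modeEnd B k e p v) =
      modeEnd B k e p (modeEnd B k x n v) + a • modeEnd B k e (n + p) v := by
    rw [modeEnd_comm_eigen X.lie_e rfl, X.form_e]; simp
  have sf (n p : ℤ) (v : VacuumModule B k) : modeEnd B k x n (modeEnd B k f p v) =
      modeEnd B k f p (modeEnd B k x n v) + (-a) • modeEnd B k f (n + p) v := by
    rw [modeEnd_comm_eigen X.lie_f rfl, X.form_f]; simp
  have vx := modeEnd_vacuum B k x n hn
  have ef (i p : ℤ) (hi : 0 ≤ i) := T.e_f_vacuum hi p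
  have vf (i : ℤ) (hi : 0 ≤ i) := modeEnd_vacuum B k f i hi
  have vh (i : ℤ) (hi : 0 ≤ i) := modeEnd_vacuum B k h i hi
  have vf0 := vf 0 le_rfl
  have vf1 := vf 1 (by norm_num)
  have vf2 := vf 2 (by norm_num)
  have e0f1 : modeEnd B k e 0 (modeEnd B k f (-1) (vacuum B k)) =
      modeEnd B k h (-1) (vacuum B k) := by simpa using ef 0 (-1) le_rfl
  have e0f2 : modeEnd B k e 0 (modeEnd B k f (-2) (vacuum B k)) =
      modeEnd B k h (-2) (vacuum B k) := by simpa using ef 0 (-2) le_rfl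
  have e1f1 : modeEnd B k e 1 (modeEnd B k f (-1) (vacuum B k)) = κ • vacuum B k := by
    simpa [vh 0 le_rfl] using ef 1 (-1) (by norm_num)
  have e1f2 : modeEnd B k e 1 (modeEnd B k f (-2) (vacuum B k)) =
      modeEnd B k h (-1) (vacuum B k) := by simpa using ef 1 (-2) (by norm_num)
  have e2f1 : modeEnd B k e 2 (modeEnd B k f (-1) (vacuum B k)) = 0 := by
    simpa [vh 1 (by norm_num)] using ef 2 (-1) (by norm_num)
  have e2f2 : modeEnd B k e 2 (modeEnd B k f (-2) (vacuum B k)) = (2 * κ) • vacuum B k := by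
    simpa [vh 0 le_rfl] using ef 2 (-2) (by norm_num)
  have cases : n = 0 ∨ n = 1 ∨ n = 2 ∨ n = 3 ∨ 4 ≤ n := by omega
  rw [omegaVec, wVec]
  simp only [map_add, map_sub, map_neg, map_smul, sh, se, sf, vx, map_zero, zero_add]
  rcases cases with rfl | rfl | rfl | rfl | hn4
  · norm_num
  · norm_num
    simp only [vf0, e0f1, e0f2, map_zero]
    constructor <;> module
  · norm_num
    simp only [vf0, vf1, e0f1, e1f1, e1f2, map_zero, map_smul]
    constructor <;> module
  · norm_num
    simp only [vf1, vf2, e1f1, e2f1, e2f2, map_zero]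
    constructor <;> module
  · rw [vf (n + -1) (by omega), vf (n + -2) (by omega), ef (n + -1) _ (by omega),
      ef (n + -2) _ (by omega), ef (n + -1) _ (by omega), vh (n + -1 + -1) (by omega),
      vh (n + -2 + -1) (by omega), vh (n + -1 + -2) (by omega)]
    rw [if_neg (by omega), if_neg (by omega), if_neg (by omega), if_neg (by omega),
      if_neg (by omega)]
    try rw [if_neg (by omega)]
    simp

end IsLevelTriple

end Triples
end Parafermion

/-! ### The recursion for the quadratic vectors `e(-m-1)f(-1)𝟙` -/

namespace Parafermion
section Triples
variable {𝔤 : Type*} [LieRing 𝔤] [LieAlgebra ℂ 𝔤]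
variable {B : InvForm 𝔤} {k κ : ℂ} {h e f : 𝔤}

lemma bcoef_neg_succ (m j : ℕ) : bcoef (-(m + 1 : ℕ)) j = ((m + j).choose j : ℤ) := by
  rw [bcoef, Ring.choose_neg, show ((m + 1 : ℕ) : ℤ) + j - 1 = ((m + j : ℕ) : ℤ) by push_cast; ring,
    Ring.choose_natCast, Int.negOnePow_def, zpow_natCast, Units.smul_def]
  push_cast
  rw [smul_eq_mul, ← mul_assoc, ← mul_pow]
  simp

/-- The modes of the vertex operator of `e(-m-1) f(-1) 𝟙`. -/
lemma nProd_e_f (e f : 𝔤) (m : ℕ) (n : ℤ) (v : VacuumModule B k) :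
    nProd B k (modeEnd B k e (-(m + 1 : ℕ)) (modeEnd B k f (-1) (vacuum B k))) n v =
      (∑ᶠ j : ℕ, ((m + j).choose j : ℤ) •
        modeEnd B k e (-(m + 1 : ℕ) - j) (modeEnd B k f (n + j) v)) -
      (-1 : ℤ) ^ (m + 1) • ∑ᶠ j : ℕ, ((m + j).choose j : ℤ) •
        modeEnd B k f (-(m + 1 : ℕ) + n - j) (modeEnd B k e j v) := by
  rw [nProd_modeEnd]
  simp_rw [nProd_current, bcoef_neg_succ]
  rw [Int.negOnePow_neg, Int.negOnePow_def, zpow_natCast]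
  simp

namespace IsLevelTriple

lemma f_e_f_vacuum (T : IsLevelTriple B k κ h e f) {i : ℤ} (hi : 0 < i) (m : ℤ) :
    modeEnd B k f i (modeEnd B k e m (modeEnd B k f (-1) (vacuum B k))) =
      -modeEnd B k h (i + m) (modeEnd B k f (-1) (vacuum B k)) +
        (if i + m = 0 then (i : ℂ) * κ else 0) • modeEnd B k f (-1) (vacuum B k) := by
  have h1 : ⁅f, e⁆ = -h := by rw [← lie_skew, T.lie_e_f]
  have h2 : B.form f e * k = κ := by rw [B.symm.eq]; exact T.form_e_f
  rw [modeEnd_swap B k f e, modeEnd_swap B k f f, modeEnd_vacuum B k f i hi.le, lie_self, h1, h2,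
    T.form_f_f]
  simp [modeEnd_zero, modeEnd_neg]

lemma h_f_vacuum (T : IsLevelTriple B k κ h e f) {i : ℤ} (hi : 0 ≤ i) :
    modeEnd B k h i (modeEnd B k f (-1) (vacuum B k)) =
      (if i = 0 then -2 else 0 : ℂ) • modeEnd B k f (-1) (vacuum B k) := by
  rw [modeEnd_comm_eigen T.lie_h_f rfl, T.form_h_f, modeEnd_vacuum B k h i hi]
  by_cases h0 : i = 0
  · subst h0; simp
  · rw [if_neg h0, modeEnd_vacuum B k f (i + -1) (by omega)]
    simp

lemma h_e_comm (T : IsLevelTriple B k κ h e f) (m n : ℤ) (v : VacuumModule B k) :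
    modeEnd B k e m (modeEnd B k h n v) =
      modeEnd B k h n (modeEnd B k e m v) - (2 : ℂ) • modeEnd B k e (m + n) v := by
  rw [modeEnd_comm_eigen T.lie_h_e rfl, T.form_h_e, add_comm m n]
  simp

lemma h_f_comm (T : IsLevelTriple B k κ h e f) (m n : ℤ) (v : VacuumModule B k) :
    modeEnd B k f m (modeEnd B k h n v) =
      modeEnd B k h n (modeEnd B k f m v) + (2 : ℂ) • modeEnd B k f (m + n) v := by
  rw [modeEnd_comm_eigen T.lie_h_f rfl, T.form_h_f, add_comm m n]
  simp

lemma f_e_vacuum (T : IsLevelTriple B k κ h e f) (m n : ℤ) (hmn : m + n < 0) :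
    modeEnd B k f m (modeEnd B k e n (vacuum B k)) =
      modeEnd B k e n (modeEnd B k f m (vacuum B k)) - modeEnd B k h (m + n) (vacuum B k) := by
  have h1 : ⁅f, e⁆ = -h := by rw [← lie_skew, T.lie_e_f]
  rw [modeEnd_swap B k f e, h1, modeEnd_neg, if_neg (by omega)]
  simp [sub_eq_add_neg]

variable {C : Submodule ℂ (VacuumModule B k)}

/-- The `(-2)`-product with the vacuum is translation, and this is its Leibniz rule. It trades
`f(-2)` for a lower mode of `e` without leaving a vertex subalgebra. -/
lemma translate_e_f (e f : 𝔤) (m : ℕ) :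
    nProd B k (modeEnd B k e (-(m + 1 : ℕ)) (modeEnd B k f (-1) (vacuum B k))) (-2) (vacuum B k) =
      modeEnd B k e (-(m + 1 : ℕ)) (modeEnd B k f (-2) (vacuum B k)) +
      (m + 1 : ℂ) • modeEnd B k e (-(m + 2 : ℕ)) (modeEnd B k f (-1) (vacuum B k)) := by
  rw [nProd_e_f, finsum_eq_range 2, finsum_eq_range 0]
  · simp only [Finset.sum_range_succ, Finset.range_zero, Finset.sum_empty]
    have e1 : ((-(m + 1 : ℕ) : ℤ) - (1 : ℕ)) = -(m + 2 : ℕ) := by push_cast; ring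
    rw [e1]
    simp only [Nat.choose_zero_right, Nat.choose_one_right, Nat.cast_zero, Nat.cast_one, one_smul,
      add_zero, sub_zero, zero_add, smul_zero, Nat.cast_add]
    rw [← Int.cast_smul_eq_zsmul ℂ]
    norm_num
  · intro j _
    rw [modeEnd_vacuum B k e j (by omega), map_zero, smul_zero]
  · intro j hj
    rw [modeEnd_vacuum B k f (-2 + j) (by omega), map_zero, smul_zero]

/-- Two elements of `C` are linear combinations of `X = e(-m-2)f(-1)𝟙` and `Y = e(-m-1)f(-2)𝟙`
modulo `C`. One is the translate `Y + (m+1)X` of the previous vector. The other is the `1`-product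
of `e(-2)f(-1)𝟙` with the previous vector. Their determinant is nonzero by `hκ`, so `X` itself lies
in `C`. -/
lemma e_f_vacuum_mem (T : IsLevelTriple B k κ h e f) (hκ : ∀ m : ℕ, (κ + 1) * (m + 1) + 1 ≠ 0)
    (hC : IsVertexSubalgebra B k C) (hh : modeEnd B k h (-1) (vacuum B k) ∈ C)
    (h11 : modeEnd B k e (-1) (modeEnd B k f (-1) (vacuum B k)) ∈ C)
    (h21 : modeEnd B k e (-2) (modeEnd B k f (-1) (vacuum B k)) ∈ C) (m : ℕ) :
    modeEnd B k e (-(m + 1 : ℕ)) (modeEnd B k f (-1) (vacuum B k)) ∈ C := by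
  have sh (n : ℤ) {v : VacuumModule B k} (hv : v ∈ C) : modeEnd B k h n v ∈ C :=
    hC.modeEnd_mem hh n hv
  induction m using Nat.strong_induction_on with
  | _ m ih =>
  rcases m with _ | m
  · simpa using h11
  have hm := ih m (by omega)
  set X : VacuumModule B k := modeEnd B k e (-(m + 2 : ℕ)) (modeEnd B k f (-1) (vacuum B k)) with hX
  change X ∈ C
  set Y : VacuumModule B k := modeEnd B k e (-(m + 1 : ℕ)) (modeEnd B k f (-2) (vacuum B k)) with hY
  have hT : Y + (m + 1 : ℂ) • X ∈ C := by
    rw [hX, hY, ← translate_e_f]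
    exact hC.nProd_mem _ hm _ hC.vacuum_mem _
  -- Modulo `C` this product equals `(m(m+1) + (m+1)(2+(m+1)κ) + 2) X - (2κ+2) Y`. The three
  -- summands of the first coefficient come from the modes `f(1+j)` with `j < m`, from `j = m`, and
  -- from the `e(0)` term.
  have hP := hC.nProd_mem _ h21 _ hm 1
  have hP' := nProd_e_f (B := B) (k := k) e f 1 1
    (modeEnd B k e (-(m + 1 : ℕ)) (modeEnd B k f (-1) (vacuum B k)))
  rw [show (-(1 + 1 : ℕ) : ℤ) = -2 by norm_num] at hP'
  rw [hP', finsum_eq_range (m + 1), finsum_eq_range 2, Finset.sum_range_succ] at hP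
  rotate_left
  · intro j hj
    rw [modeEnd_swap B k e e, lie_self, modeEnd_zero, T.form_e_e, T.e_f_vacuum (by omega),
      if_neg (by omega), modeEnd_vacuum B k h _ (by omega)]
    simp
  · intro j hj
    rw [T.f_e_f_vacuum (by omega), T.h_f_vacuum (by push_cast; omega), if_neg (by push_cast; omega),
      if_neg (by push_cast; omega)]
    simp
  -- the terms with `h(i)`, `i < 0`
  have hS : ∀ M : ℕ, M ≤ m → (∑ j ∈ Finset.range M, ((1 + j).choose j : ℤ) •
      modeEnd B k e (-2 - j) (modeEnd B k f (1 + j)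
        (modeEnd B k e (-(m + 1 : ℕ)) (modeEnd B k f (-1) (vacuum B k))))) -
      ((M : ℂ) * (M + 1)) • X ∈ C := by
    intro M
    induction M with
    | zero => intro _; simp
    | succ M ihM =>
      intro hM
      have h1 := ihM (by omega)
      have h2 : modeEnd B k h (1 + M + -(m + 1 : ℕ)) (modeEnd B k e (-(M + 1 + 1 : ℕ))
        (modeEnd B k f (-1) (vacuum B k))) ∈ C := sh _ (ih (M + 1) (by omega))
      rw [Finset.sum_range_succ, T.f_e_f_vacuum (by omega), if_neg (by push_cast; omega), zero_smul,
        add_zero, map_neg, T.h_e_comm,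
        show (-2 : ℤ) - M + (1 + M + -(m + 1 : ℕ)) = -(m + 2 : ℕ) by push_cast; ring, ← hX,
        show (-2 : ℤ) - M = -(M + 1 + 1 : ℕ) by push_cast; ring]
      have h3 := sub_mem h1 (Submodule.smul_mem C (M + 1 : ℂ) h2)
      convert h3 using 1
      rw [add_comm 1 M, Nat.choose_succ_self_right, ← Int.cast_smul_eq_zsmul ℂ]
      push_cast
      module
  have hS := hS m le_rfl
  have hl : modeEnd B k e (-2 - m) (modeEnd B k f (1 + m)
      (modeEnd B k e (-(m + 1 : ℕ)) (modeEnd B k f (-1) (vacuum B k)))) =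
      (2 + (m + 1) * κ) • X := by
    rw [T.f_e_f_vacuum (by omega), show (1 : ℤ) + m + -(m + 1 : ℕ) = 0 by push_cast; ring,
      T.h_f_vacuum le_rfl, if_pos rfl, if_pos rfl, map_add, map_neg, map_smul, map_smul,
      show (-2 : ℤ) - m = -(m + 2 : ℕ) by push_cast; ring, ← hX]
    push_cast
    module
  have hr0 : modeEnd B k e 0 (modeEnd B k e (-(m + 1 : ℕ)) (modeEnd B k f (-1) (vacuum B k))) =
      modeEnd B k h (-1) (modeEnd B k e (-(m + 1 : ℕ)) (vacuum B k)) -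
        (2 : ℂ) • modeEnd B k e (-(m + 2 : ℕ)) (vacuum B k) := by
    rw [modeEnd_swap B k e e, lie_self, modeEnd_zero, T.form_e_e, T.e_f_vacuum le_rfl]
    simp only [zero_add, Int.reduceNeg, LinearMap.zero_apply, add_zero]
    rw [if_neg (by norm_num), zero_smul, add_zero, T.h_e_comm]
    rw [show (-(m + 1 : ℕ) : ℤ) + -1 = -(m + 2 : ℕ) by push_cast; ring]
    simp
  have hr1 : modeEnd B k e 1 (modeEnd B k e (-(m + 1 : ℕ)) (modeEnd B k f (-1) (vacuum B k))) =
      κ • modeEnd B k e (-(m + 1 : ℕ)) (vacuum B k) := by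
    rw [modeEnd_swap B k e e, lie_self, modeEnd_zero, T.form_e_e, T.e_f_vacuum (by norm_num),
      show (1 : ℤ) + -1 = 0 by norm_num, modeEnd_vacuum B k h 0 le_rfl]
    simp
  have hR0 : modeEnd B k f (-1) (modeEnd B k e 0
      (modeEnd B k e (-(m + 1 : ℕ)) (modeEnd B k f (-1) (vacuum B k)))) -
      ((2 : ℂ) • Y - (2 : ℂ) • X) ∈ C := by
    rw [hr0, map_sub, map_smul, T.h_f_comm, T.f_e_vacuum _ _ (by omega),
      T.f_e_vacuum _ _ (by omega), T.f_e_vacuum _ _ (by omega), ← hX,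
      show (-1 : ℤ) + -1 = -2 by norm_num, ← hY, map_sub]
    have h1 := sh (-1) hm
    have h2 := sh (-1) (sh (-1 + -(m + 1 : ℕ)) hC.vacuum_mem)
    have h3 := sh (-2 + -(m + 1 : ℕ)) hC.vacuum_mem
    have h4 := sh (-1 + -(m + 2 : ℕ)) hC.vacuum_mem
    have h5 := add_mem (sub_mem (sub_mem h1 h2) (Submodule.smul_mem C (2 : ℂ) h3))
      (Submodule.smul_mem C (2 : ℂ) h4)
    convert h5 using 1
    module
  have hR1 : modeEnd B k f (-2) (modeEnd B k e 1
      (modeEnd B k e (-(m + 1 : ℕ)) (modeEnd B k f (-1) (vacuum B k)))) - κ • Y ∈ C := by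
    rw [hr1, map_smul, T.f_e_vacuum _ _ (by omega), ← hY]
    have h3 := Submodule.smul_mem C (-κ) (sh (-2 + -(m + 1 : ℕ)) hC.vacuum_mem)
    convert h3 using 1
    module
  rw [Finset.sum_range_succ, Finset.sum_range_succ, Finset.sum_range_zero] at hP
  simp only [Int.reduceNeg, Nat.cast_zero, sub_zero, Nat.cast_one, zero_add, add_zero] at hP
  rw [hl, show (-2 : ℤ) + 1 = -1 by norm_num, show (-1 : ℤ) - 1 = -2 by norm_num] at hP
  have hfin := add_mem (add_mem (sub_mem hP hS) hR0) (Submodule.smul_mem C (2 : ℂ) hR1)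
  -- The multiple `2κ + 2` of the translate eliminates `Y`; the remaining coefficient of `X` factors
  -- as `(m+3)((κ+1)(m+1)+1)`.
  have hfin := add_mem hfin (Submodule.smul_mem C (2 * κ + 2) hT)
  have hc : ((m + 3 : ℂ) * ((κ + 1) * (m + 1) + 1)) • X ∈ C := by
    convert hfin using 1
    rw [add_comm 1 m, Nat.choose_succ_self_right]
    simp only [← Int.cast_smul_eq_zsmul ℂ]
    push_cast
    norm_num
    module
  have h0 : (m + 3 : ℂ) * ((κ + 1) * (m + 1) + 1) ≠ 0 :=
    mul_ne_zero (by exact_mod_cast (by omega : m + 3 ≠ 0)) (hκ m)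
  exact (Submodule.smul_mem_iff _ h0).1 hc

end IsLevelTriple
end Triples
end Parafermion

/-! ### Isolating normally ordered products by their binomial weights -/

namespace Parafermion
section Separation
open Polynomial

lemma choose_succ_mul (z : ℤ) (m : ℕ) :
    (m + 1 : ℤ) * Ring.choose z (m + 1) = (z - m) * Ring.choose z m := by
  have h1 := Ring.descPochhammer_eq_factorial_smul_choose z (m + 1)
  have h2 := Ring.descPochhammer_eq_factorial_smul_choose z m
  have hf : (m.factorial : ℤ) ≠ 0 := by positivity
  apply mul_left_cancel₀ hf
  rw [descPochhammer_succ_right, smeval_mul, smeval_sub, smeval_X, smeval_natCast, h2,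
    Nat.factorial_succ] at h1
  simp only [nsmul_eq_mul, pow_one, pow_zero, mul_one] at h1
  push_cast at h1
  linear_combination -h1

/-- Linear combinations with all binomial coefficients as weights can be separated. -/
lemma mem_of_sum_choose_mem {M ι : Type*} [AddCommGroup M] [Module ℂ M] (W : Submodule ℂ M)
    (S : Finset ι) (z : ι → ℤ) (hz : Function.Injective z) (F : ι → M)
    (h : ∀ m : ℕ, ∑ i ∈ S, Ring.choose (z i) m • F i ∈ W) (i : ι) (hi : i ∈ S) : F i ∈ W := by
  classical
  have key (P : ℂ[X]) : ∀ m : ℕ, ∑ i ∈ S, (P.eval (z i : ℂ) * (Ring.choose (z i) m : ℤ)) • F i ∈ W := by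
    induction P using Polynomial.induction_on with
    | C a =>
      intro m
      have := W.smul_mem a (h m)
      rw [Finset.smul_sum] at this
      convert this using 2 with i
      rw [eval_C, mul_smul, Int.cast_smul_eq_zsmul]
    | add p q hp hq =>
      intro m
      simp only [eval_add, add_mul, add_smul, Finset.sum_add_distrib]
      exact W.add_mem (hp m) (hq m)
    | monomial n a ih =>
      intro m
      -- Multiplication of the weights by `z` is realized by `z * binom(z,m) = (m+1) * binom(z,m+1)
      -- + m * binom(z,m)`.
      have := W.add_mem (W.smul_mem (m + 1 : ℂ) (ih (m + 1))) (W.smul_mem (m : ℂ) (ih m))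
      rw [Finset.smul_sum, Finset.smul_sum, ← Finset.sum_add_distrib] at this
      convert this using 2 with i
      rw [smul_smul, smul_smul, ← add_smul]
      congr 1
      have h1 := congrArg (Int.cast : ℤ → ℂ) (choose_succ_mul (z i) m)
      push_cast at h1
      simp only [eval_mul, eval_C, eval_pow, eval_X]
      linear_combination (-(a * (z i : ℂ) ^ n)) * h1
  -- A polynomial that vanishes at all other nodes leaves a nonzero multiple of `F i`.
  have h1 := key (∏ j ∈ S.erase i, (X - C (z j : ℂ))) 0
  rw [Finset.sum_eq_single i] at h1
  · refine (W.smul_mem_iff ?_).1 h1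
    rw [Ring.choose_zero_right, Int.cast_one, mul_one, eval_prod, Finset.prod_ne_zero_iff]
    intro j hj
    rw [eval_sub, eval_X, eval_C, sub_ne_zero]
    exact fun h => (Finset.ne_of_mem_erase hj) (hz (by exact_mod_cast h.symm))
  · intro j hj hji
    rw [eval_prod, Finset.prod_eq_zero (Finset.mem_erase.2 ⟨hji, hj⟩), zero_mul, zero_smul]
    simp
  · exact fun h => absurd hi h

end Separation

section Triples
variable {𝔤 : Type*} [LieRing 𝔤] [LieAlgebra ℂ 𝔤]
variable {B : InvForm 𝔤} {k κ : ℂ} {h e f : 𝔤} {C : Submodule ℂ (VacuumModule B k)}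

/-- The `(s+m+1)`-product of `e(-m-1)f(-1)𝟙` with `v` is `∑ binom(-1-p, m) :e(p)f(s-p): v` over all
`p`, where `e(p)` stands on the left for `p < 0` and on the right for `p ≥ 0`. Only finitely many
terms are nonzero and the numbers `-1-p` are distinct, so `mem_of_sum_choose_mem` isolates each
term. -/
lemma normallyOrdered_mem (hC : IsVertexSubalgebra B k C)
    (hef : ∀ m : ℕ, modeEnd B k e (-(m + 1 : ℕ)) (modeEnd B k f (-1) (vacuum B k)) ∈ C)
    (s : ℤ) {v : VacuumModule B k} (hv : v ∈ C) (t : ℕ) :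
    modeEnd B k e (-1 - t) (modeEnd B k f (s + 1 + t) v) ∈ C ∧
      modeEnd B k f (s - t) (modeEnd B k e t v) ∈ C := by
  obtain ⟨N₁, hN₁⟩ := field_exists_nat (currentField B k f) (s + 1) v
  obtain ⟨N₂, hN₂⟩ := exists_modeEnd_eq_zero B k e v
  replace hN₁ : ∀ j : ℕ, N₁ ≤ j → modeEnd B k f (s + 1 + j) v = 0 := hN₁
  obtain ⟨N, h1, h2, h3⟩ : ∃ N, N₁ ≤ N ∧ N₂ ≤ N ∧ t < N :=
    ⟨N₁ + N₂ + t + 1, by omega, by omega, by omega⟩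
  let F : ℕ ⊕ ℕ → VacuumModule B k := Sum.elim
    (fun t => modeEnd B k e (-1 - t) (modeEnd B k f (s + 1 + t) v))
    (fun j => modeEnd B k f (s - j) (modeEnd B k e j v))
  let z : ℕ ⊕ ℕ → ℤ := Sum.elim (fun t => (t : ℤ)) (fun j => -(j + 1 : ℕ))
  have hz : Function.Injective z := by
    rintro (i | i) (j | j) hij <;> simp only [z, Sum.elim_inl, Sum.elim_inr] at hij
    · rw [Nat.cast_injective hij]
    · omega
    · omega
    · rw [show i = j by omega]
  have key := mem_of_sum_choose_mem C ((Finset.range N).disjSum (Finset.range N)) z hz F ?_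
  · exact ⟨key (Sum.inl t) (Finset.inl_mem_disjSum.2 (Finset.mem_range.2 h3)),
      key (Sum.inr t) (Finset.inr_mem_disjSum.2 (Finset.mem_range.2 h3))⟩
  intro m
  have hm := hC.nProd_mem _ (hef m) _ hv (s + (m + 1 : ℕ))
  rw [nProd_e_f, finsum_eq_range N, finsum_eq_range N] at hm
  · rw [Finset.sum_disjSum]
    convert hm using 1
    rw [sub_eq_add_neg]
    congr 1
    -- The iterate formula is indexed by `j = t - m`. The terms with `t < m` are absent there, in
    -- agreement with `binom(t, m) = 0`, and enlarging the range to `m + N` adds only zeros.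
    · have h4 : ∑ i ∈ Finset.range N, Ring.choose (z (Sum.inl i)) m • F (Sum.inl i) =
          ∑ i ∈ Finset.range (m + N), Ring.choose (z (Sum.inl i)) m • F (Sum.inl i) := by
        refine Finset.sum_subset (Finset.range_mono (by omega)) fun i _ hi => ?_
        simp only [Finset.mem_range, not_lt] at hi
        simp only [F, Sum.elim_inl]
        rw [hN₁ i (by omega), map_zero, smul_zero]
      rw [h4, Finset.sum_range_add, Finset.sum_eq_zero (s := Finset.range m), zero_add]
      · refine Finset.sum_congr rfl fun j _ => ?_
        simp only [z, F, Sum.elim_inl]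
        rw [Ring.choose_natCast, Nat.choose_symm_add, 
          show (-1 : ℤ) - (m + j : ℕ) = -(m + 1 : ℕ) - j by push_cast; ring,
          show s + 1 + (m + j : ℕ) = s + (m + 1 : ℕ) + j by push_cast; ring]
      · intro j hj
        simp only [z, F, Sum.elim_inl]
        rw [Ring.choose_natCast, Nat.choose_eq_zero_of_lt (Finset.mem_range.1 hj)]
        simp
    · rw [← neg_smul, Finset.smul_sum]
      refine Finset.sum_congr rfl fun j _ => ?_
      simp only [z, F, Sum.elim_inr]
      have h5 := bcoef_neg_succ j m
      rw [bcoef] at h5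
      have h6 : Ring.choose (-(j + 1 : ℕ) : ℤ) m = (-1) ^ m * ((j + m).choose m : ℤ) := by
        rw [← h5, ← mul_assoc, ← mul_pow]; simp
      rw [h6, smul_smul, add_comm j m, Nat.choose_symm_add, pow_succ,
        show -((m + 1 : ℕ) : ℤ) + (s + (m + 1 : ℕ)) - j = s - j by ring]
      congr 1
      ring
  · intro j hj
    rw [hN₂ j (by omega), map_zero, smul_zero]
  · intro j hj
    have := hN₁ (m + j) (by omega)
    rw [show s + (m + 1 : ℕ) + j = s + 1 + (m + j : ℕ) by push_cast; ring, this, map_zero, smul_zero]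

namespace IsLevelTriple

/-- Modulo Heisenberg descendants, `ω` is a multiple of `e(-1)f(-1)𝟙`. Once this vector is in `C`,
`W³` reduces to `3κ²` times the difference of `e(-2)f(-1)𝟙` and `e(-1)f(-2)𝟙`. Their sum is a
translate, so adding `3κ²` times it leaves `6κ² e(-2)f(-1)𝟙`. -/
lemma vacuum_mem_of_omega_w (hκ0 : κ ≠ 0) (hκ2 : κ + 2 ≠ 0)
    (hC : IsVertexSubalgebra B k C) (hh : modeEnd B k h (-1) (vacuum B k) ∈ C)
    (hω : omegaVec B k κ h e f ∈ C) (hw : wVec B k κ h e f ∈ C) :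
    modeEnd B k e (-1) (modeEnd B k f (-1) (vacuum B k)) ∈ C ∧
      modeEnd B k e (-2) (modeEnd B k f (-1) (vacuum B k)) ∈ C := by
  have sh (n : ℤ) {v : VacuumModule B k} (hv : v ∈ C) : modeEnd B k h n v ∈ C :=
    hC.modeEnd_mem hh n hv
  have v0 := hC.vacuum_mem
  have h11 : modeEnd B k e (-1) (modeEnd B k f (-1) (vacuum B k)) ∈ C := by
    have h1 := add_mem (add_mem (C.smul_mem (2 * κ * (κ + 2)) hω) (C.smul_mem κ (sh (-2) v0)))
      (sh (-1) (sh (-1) v0))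
    rw [omegaVec, smul_smul, mul_one_div_cancel (mul_ne_zero (mul_ne_zero two_ne_zero hκ0) hκ2)] at h1
    refine (C.smul_mem_iff (mul_ne_zero two_ne_zero hκ0)).1 ?_
    convert h1 using 1
    module
  refine ⟨h11, ?_⟩
  have ht := hC.nProd_mem _ (show modeEnd B k e (-(0 + 1 : ℕ)) (modeEnd B k f (-1) (vacuum B k)) ∈ C
    by simpa using h11) _ v0 (-2)
  rw [translate_e_f] at ht
  have h1 := sub_mem (sub_mem (sub_mem hw (C.smul_mem (κ ^ 2) (sh (-3) v0)))
    (C.smul_mem (3 * κ) (sh (-2) (sh (-1) v0))))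
    (C.smul_mem (2 : ℂ) (sh (-1) (sh (-1) (sh (-1) v0))))
  have h2 := add_mem (add_mem h1 (C.smul_mem (6 * κ) (sh (-1) h11))) (C.smul_mem (3 * κ ^ 2) ht)
  refine (C.smul_mem_iff (show 6 * κ ^ 2 ≠ 0 from mul_ne_zero (by norm_num) (pow_ne_zero _ hκ0))).1 ?_
  convert h2 using 1
  rw [wVec]
  norm_num
  module

/-- A vertex subalgebra that contains `h(-1) 𝟙`, `ω` and `W³` is stable under all `e(p) f(q)` and
`f(p) e(q)`. -/
lemma e_f_mem (T : IsLevelTriple B k κ h e f) (hκ0 : κ ≠ 0) (hκ2 : κ + 2 ≠ 0)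
    (hκ : ∀ m : ℕ, (κ + 1) * (m + 1) + 1 ≠ 0)
    (hC : IsVertexSubalgebra B k C) (hh : modeEnd B k h (-1) (vacuum B k) ∈ C)
    (hω : omegaVec B k κ h e f ∈ C) (hw : wVec B k κ h e f ∈ C) (p q : ℤ)
    {v : VacuumModule B k} (hv : v ∈ C) :
    modeEnd B k e p (modeEnd B k f q v) ∈ C ∧ modeEnd B k f q (modeEnd B k e p v) ∈ C := by
  obtain ⟨h11, h21⟩ := vacuum_mem_of_omega_w hκ0 hκ2 hC hh hω hw
  have hef := T.e_f_vacuum_mem hκ hC hh h11 h21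
  have hswap := modeEnd_swap B k e f p q v
  have hmem : modeEnd B k ⁅e, f⁆ (p + q) v +
      (if p + q = 0 then (p : ℂ) * (B.form e f * k) else 0) • v ∈ C := by
    rw [T.lie_e_f]
    exact add_mem (hC.modeEnd_mem hh _ hv) (C.smul_mem _ hv)
  rw [add_assoc] at hswap
  -- The sign of `p` decides which of the two orders is the normal one. The other order differs from
  -- it by `h(p+q)v` and a multiple of `v`, both in `C`.
  rcases lt_or_ge p 0 with hp | hp
  · obtain ⟨t, rfl⟩ : ∃ t : ℕ, p = -1 - t := ⟨(-1 - p).toNat, by omega⟩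
    have h1 := (normallyOrdered_mem hC hef (q - 1 - t) hv t).1
    rw [show q - 1 - (t : ℤ) + 1 + t = q by ring] at h1
    exact ⟨h1, (Submodule.add_mem_iff_left C hmem).1 (hswap ▸ h1)⟩
  · obtain ⟨t, rfl⟩ := Int.eq_ofNat_of_zero_le hp
    have h1 := (normallyOrdered_mem hC hef (q + t) hv t).2
    rw [add_sub_cancel_right] at h1
    exact ⟨hswap ▸ add_mem h1 hmem, h1⟩

end IsLevelTriple
end Triples
end Parafermion

/-! ### Words of weight zero and the generation theorem for a root vector system -/

namespace Parafermion
section Generation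
variable {𝔤 : Type*} [LieRing 𝔤] [LieAlgebra ℂ 𝔤]

/-- A toral subspace `H` and a family of weight vectors that together span a Lie algebra with a
symmetric invariant form, with the properties of a root space decomposition which are used to
generate the weight zero part of `V(k,0)`. -/
structure RootVectorSystem (B : InvForm 𝔤) (H : Submodule ℂ 𝔤) (ι : Type*) where
  /-- The root vectors. -/
  x : ι → 𝔤
  /-- The index of the opposite root. -/
  neg : ι → ι
  /-- The roots. -/
  wt : ι → Module.Dual ℂ H
  neg_neg : ∀ i, neg (neg i) = i
  wt_neg : ∀ i, wt (neg i) = -wt i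
  lie_toral : ∀ x ∈ H, ∀ y ∈ H, ⁅x, y⁆ = 0
  lie_x : ∀ (h : H) (i : ι), ⁅(h : 𝔤), x i⁆ = wt i h • x i
  span_eq_top : H ⊔ Submodule.span ℂ (Set.range x) = ⊤
  lie_x_x : ∀ i j, ⁅x i, x j⁆ = 0 ∨ (wt i + wt j = 0 ∧ ⁅x i, x j⁆ ∈ H) ∨
    ∃ (m : ι) (c : ℂ), wt m = wt i + wt j ∧ ⁅x i, x j⁆ = c • x m
  -- The combinatorial input for shortening words. In the second alternative `x_j` is, up to a
  -- nonzero scalar, the bracket of `x_{-i}` with a root vector of weight `wt i + wt j`. The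
  -- vanishing of the form removes the central term from the bracket of the corresponding loops.
  exists_pair : ∀ (i : ι) (l : List ι), wt i + (l.map wt).sum = 0 → ∃ j ∈ l, j = neg i ∨
    ∃ (m : ι) (c : ℂ), c ≠ 0 ∧ wt m = wt i + wt j ∧ ⁅x (neg i), x m⁆ = c • x j ∧
      B.form (x (neg i)) (x m) = 0

namespace RootVectorSystem
variable {B : InvForm 𝔤} {H : Submodule ℂ 𝔤} {ι : Type*} (D : RootVectorSystem B H ι) (k : ℂ)

/-- The element of `𝔤` given by a letter. -/
def vec : H ⊕ ι → 𝔤 := Sum.elim Subtype.val D.x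

/-- The weight of a letter. -/
def letterWt : H ⊕ ι → Module.Dual ℂ H := Sum.elim (fun _ => 0) D.wt

/-- The total weight of a word. -/
def wordWt (l : List ((H ⊕ ι) × ℤ)) : Module.Dual ℂ H := (l.map fun a => D.letterWt a.1).sum

/-- The operator `a₁(n₁) ⋯ a_r(n_r)` on `V(k,0)`. -/
noncomputable def word (l : List ((H ⊕ ι) × ℤ)) : Module.End ℂ (VacuumModule B k) :=
  (l.map fun a => modeEnd B k (D.vec a.1) a.2).prod

lemma lie_vec (h : H) (a : H ⊕ ι) : ⁅(h : 𝔤), D.vec a⁆ = D.letterWt a h • D.vec a := by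
  rcases a with y | i
  · simp [vec, letterWt, D.lie_toral h h.2 y y.2]
  · exact D.lie_x h i

lemma form_vec (a b : H ⊕ ι) (hab : B.form (D.vec a) (D.vec b) ≠ 0) :
    D.letterWt a + D.letterWt b = 0 := by
  ext h
  have := B.invariant (h : 𝔤) (D.vec a) (D.vec b)
  rw [D.lie_vec, D.lie_vec, map_smul, map_smul, LinearMap.smul_apply, smul_eq_mul,
    smul_eq_mul] at this
  rw [LinearMap.add_apply, LinearMap.zero_apply]
  refine (mul_eq_zero.1 (?_ : (D.letterWt a h + D.letterWt b h) * _ = 0)).resolve_right hab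
  rw [add_mul, this, neg_add_cancel]

lemma lie_vec_vec (a b : H ⊕ ι) : ⁅D.vec a, D.vec b⁆ = 0 ∨
    ∃ (m : H ⊕ ι) (c : ℂ), D.letterWt m = D.letterWt a + D.letterWt b ∧
      ⁅D.vec a, D.vec b⁆ = c • D.vec m := by
  rcases a with y | i
  · refine Or.inr ⟨b, D.letterWt b y, ?_, D.lie_vec y b⟩
    simp [letterWt]
  · rcases b with y | j
    · refine Or.inr ⟨Sum.inr i, -D.wt i y, ?_, ?_⟩
      · simp [letterWt]
      · rw [← lie_skew, show D.vec (Sum.inl y) = (y : 𝔤) from rfl, D.lie_vec, neg_smul]; rfl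
    · rcases D.lie_x_x i j with h | ⟨h1, h2⟩ | ⟨m, c, h1, h2⟩
      · exact Or.inl h
      · exact Or.inr ⟨Sum.inl ⟨_, h2⟩, 1, by simpa [letterWt] using h1.symm, by simp [vec]⟩
      · exact Or.inr ⟨Sum.inr m, c, by simpa [letterWt] using h1, h2⟩

lemma word_cons (a : (H ⊕ ι) × ℤ) (l : List ((H ⊕ ι) × ℤ)) (v : VacuumModule B k) :
    D.word k (a :: l) v = modeEnd B k (D.vec a.1) a.2 (D.word k l v) := by
  simp [word]

lemma word_append (l l' : List ((H ⊕ ι) × ℤ)) (v : VacuumModule B k) :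
    D.word k (l ++ l') v = D.word k l (D.word k l' v) := by
  simp [word]

lemma wordWt_cons (a : (H ⊕ ι) × ℤ) (l : List ((H ⊕ ι) × ℤ)) :
    D.wordWt (a :: l) = D.letterWt a.1 + D.wordWt l := by
  simp [wordWt]

lemma wordWt_append (l l' : List ((H ⊕ ι) × ℤ)) :
    D.wordWt (l ++ l') = D.wordWt l + D.wordWt l' := by
  simp [wordWt]

lemma wordWt_perm {l l' : List ((H ⊕ ι) × ℤ)} (h : l.Perm l') : D.wordWt l = D.wordWt l' :=
  (h.map _).sum_eq

lemma wordWt_eq_sum_filterMap (l : List ((H ⊕ ι) × ℤ)) :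
    D.wordWt l = ((l.filterMap fun a => a.1.getRight?).map D.wt).sum := by
  induction l with
  | nil => rfl
  | cons a l ih =>
    obtain ⟨a | i, n⟩ := a
    · rw [wordWt_cons, ih, List.filterMap_cons_none rfl]; simp [letterWt]
    · rw [wordWt_cons, ih, List.filterMap_cons_some (f := fun a : (H ⊕ ι) × ℤ => a.1.getRight?)
        (b := i) rfl]
      simp [letterWt]

variable {k}

/-- A subspace that is stable under all `h(n)` and all `x_i(p) x_{-i}(q)` is stable under all
words of weight zero. -/
lemma word_mem {C : Submodule ℂ (VacuumModule B k)}
    (hH : ∀ h ∈ H, ∀ n, ∀ v ∈ C, modeEnd B k h n v ∈ C)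
    (hx : ∀ i p q, ∀ v ∈ C, modeEnd B k (D.x i) p (modeEnd B k (D.x (D.neg i)) q v) ∈ C)
    (l : List ((H ⊕ ι) × ℤ)) (hl : D.wordWt l = 0) {v : VacuumModule B k} (hv : v ∈ C) :
    D.word k l v ∈ C := by
  induction hN : l.length using Nat.strong_induction_on generalizing l with
  | _ N ih =>
  -- Transposing neighbours changes a word by shorter words of weight zero, which the induction
  -- covers: the bracket merges the two letters into one of the combined weight, and the central
  -- term deletes a pair of letters of opposite weights.
  have hswap (l₁ l₂ : List ((H ⊕ ι) × ℤ)) (a b : (H ⊕ ι) × ℤ)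
      (hlen : (l₁ ++ a :: b :: l₂).length = N) (hwt : D.wordWt (l₁ ++ a :: b :: l₂) = 0) :
      D.word k (l₁ ++ a :: b :: l₂) v ∈ C ↔ D.word k (l₁ ++ b :: a :: l₂) v ∈ C := by
    rw [wordWt_append, wordWt_cons, wordWt_cons] at hwt
    have e : D.word k (l₁ ++ a :: b :: l₂) v = D.word k (l₁ ++ b :: a :: l₂) v +
        (D.word k l₁ (modeEnd B k ⁅D.vec a.1, D.vec b.1⁆ (a.2 + b.2) (D.word k l₂ v)) +
        (if a.2 + b.2 = 0 then (a.2 : ℂ) * (B.form (D.vec a.1) (D.vec b.1) * k) else 0) •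
          D.word k (l₁ ++ l₂) v) := by
      rw [word_append, word_append, word_append, word_cons, word_cons, word_cons, word_cons,
        modeEnd_swap, map_add, map_add, map_smul, add_assoc]
    rw [e]
    refine Submodule.add_mem_iff_left C (add_mem ?_ ?_)
    · rcases D.lie_vec_vec a.1 b.1 with h | ⟨m, c, h1, h2⟩
      · rw [h, modeEnd_zero, LinearMap.zero_apply, map_zero]
        exact zero_mem _
      · rw [h2, modeEnd_smul, LinearMap.smul_apply, map_smul]
        refine C.smul_mem c ?_
        have := ih _ ?_ (l₁ ++ (m, a.2 + b.2) :: l₂) ?_ rfl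
        · rwa [word_append, word_cons] at this
        · rw [← hlen]; simp
        · rw [wordWt_append, wordWt_cons, h1, ← hwt]; abel
    · by_cases hab : B.form (D.vec a.1) (D.vec b.1) = 0
      · rw [hab]; simp
      · refine C.smul_mem _ (ih _ ?_ _ ?_ rfl)
        · rw [← hlen]; simp
        · have := D.form_vec _ _ hab
          rw [← add_assoc (D.letterWt a.1), this, zero_add] at hwt
          rw [wordWt_append, hwt]
  have hperm {l l' : List ((H ⊕ ι) × ℤ)} (h : l.Perm l') : ∀ l₁ : List ((H ⊕ ι) × ℤ),
      (l₁ ++ l).length = N → D.wordWt (l₁ ++ l) = 0 →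
      (D.word k (l₁ ++ l) v ∈ C ↔ D.word k (l₁ ++ l') v ∈ C) := by
    induction h with
    | nil => intros; rfl
    | cons a h ih' =>
      intro l₁ h1 h2
      have := ih' (l₁ ++ [a]) (by simpa using h1) (by simpa using h2)
      simpa using this
    | swap a b l =>
      intro l₁ h1 h2
      exact hswap l₁ l b a h1 h2
    | trans h h' ih1 ih2 =>
      intro l₁ h1 h2
      rw [ih1 l₁ h1 h2]
      refine ih2 l₁ ?_ ?_
      · rw [← h1, List.length_append, List.length_append, h.length_eq]
      · rw [← h2, wordWt_append, wordWt_append, D.wordWt_perm h]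
  rcases l with _ | ⟨⟨y | i, p⟩, l⟩
  · simpa [word] using hv
  · rw [word_cons]
    refine hH _ y.2 _ _ (ih l.length ?_ l ?_ rfl)
    · rw [← hN]; simp
    · rw [wordWt_cons] at hl
      simpa [letterWt] using hl
  · have hl' := hl
    rw [wordWt_cons, wordWt_eq_sum_filterMap] at hl'
    obtain ⟨j, hj, hij⟩ := D.exists_pair i _ hl'
    obtain ⟨⟨b, q⟩, hb, hbj⟩ := List.mem_filterMap.1 hj
    obtain rfl : b = Sum.inr j := by
      rcases b with b | b
      · simp at hbj
      · simpa using hbj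
    obtain ⟨s, t, rfl⟩ := List.append_of_mem hb
    have hp : ((Sum.inr i, p) :: (s ++ (Sum.inr j, q) :: t) : List ((H ⊕ ι) × ℤ)).Perm
        ((Sum.inr i, p) :: (Sum.inr j, q) :: (s ++ t)) := List.Perm.cons _ List.perm_middle
    have := hperm hp [] (by simpa using hN) (by simpa using hl)
    rw [List.nil_append, List.nil_append] at this
    rw [this]
    rw [D.wordWt_perm hp] at hl
    have hlen := hp.length_eq
    rw [hN] at hlen
    generalize s ++ t = r at hl hlen
    rw [wordWt_cons, wordWt_cons] at hl
    rw [word_cons, word_cons]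
    change modeEnd B k (D.x i) p (modeEnd B k (D.x j) q (D.word k r v)) ∈ C
    have hl2 : D.wt i + (D.wt j + D.wordWt r) = 0 := hl
    rcases hij with rfl | ⟨m, c, hc, hm, hlie, hform⟩
    · refine hx i p q _ (ih r.length ?_ r ?_ rfl)
      · rw [hlen]; simp
      · rwa [D.wt_neg, ← add_assoc, add_neg_cancel, zero_add] at hl2
    -- For `M` so large that `x_{-i}(M)` kills the remaining vector `w`, one has `c x_j(q) w =
    -- x_{-i}(M) x_m(q-M) w`. So `x_i(p) x_j(q) w` is, up to a nonzero scalar, the pair `x_i(p)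
    -- x_{-i}(M)` applied to a shorter word of weight zero.
    · obtain ⟨M, hM⟩ := exists_modeEnd_eq_zero B k (D.x (D.neg i)) (D.word k r v)
      have h1 := hx i p M _ (ih (r.length + 1) (by rw [hlen]; simp)
        ((Sum.inr m, q - M) :: r) (by
          rw [wordWt_cons, ← hl, show D.letterWt (Sum.inr m) = D.wt m from rfl, hm, add_assoc]; rfl)
        (by simp))
      rw [word_cons] at h1
      change modeEnd B k (D.x i) p (modeEnd B k (D.x (D.neg i)) M
        (modeEnd B k (D.x m) (q - M) (D.word k r v))) ∈ C at h1
      rw [modeEnd_swap B k (D.x (D.neg i)), hM M le_rfl, map_zero, zero_add, hform, hlie,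
        show (M : ℤ) + (q - M) = q by ring, modeEnd_smul] at h1
      simp only [zero_mul, mul_zero, ite_self, zero_smul, add_zero, LinearMap.smul_apply,
        map_smul] at h1
      exact (C.smul_mem_iff hc).1 h1

variable (k) in
/-- The span of the vectors `a₁(n₁) ⋯ a_r(n_r) 𝟙` of a given weight. -/
noncomputable def wordSpan (μ : Module.Dual ℂ H) : Submodule ℂ (VacuumModule B k) :=
  Submodule.span ℂ {v | ∃ l, D.wordWt l = μ ∧ v = D.word k l (vacuum B k)}

lemma iSup_wordSpan : ⨆ μ, D.wordSpan k μ = ⊤ := by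
  refine eq_top_iff.2 fun v _ => mem_of_modeEnd_stable B k _ ?_ ?_ v
  · exact Submodule.mem_iSup_of_mem 0 (Submodule.subset_span ⟨[], rfl, by simp [word]⟩)
  · intro x n v hv
    have hletter (a : H ⊕ ι) : ∀ v ∈ ⨆ μ, D.wordSpan k μ,
        modeEnd B k (D.vec a) n v ∈ ⨆ μ, D.wordSpan k μ := by
      suffices ⨆ μ, D.wordSpan k μ ≤ (⨆ μ, D.wordSpan k μ).comap (modeEnd B k (D.vec a) n) from
        fun v hv => this hv
      refine iSup_le fun μ => Submodule.span_le.2 ?_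
      rintro _ ⟨l, hl, rfl⟩
      change modeEnd B k (D.vec a) n (D.word k l (vacuum B k)) ∈ ⨆ μ, D.wordSpan k μ
      rw [← D.word_cons k (a, n) l]
      refine Submodule.mem_iSup_of_mem (D.letterWt a + μ) (Submodule.subset_span
        ⟨(a, n) :: l, ?_, rfl⟩)
      rw [wordWt_cons, hl]
    have hx : x ∈ H ⊔ Submodule.span ℂ (Set.range D.x) := by rw [D.span_eq_top]; trivial
    obtain ⟨h, hh, y, hy, rfl⟩ := Submodule.mem_sup.1 hx
    rw [modeEnd_add]
    refine add_mem (hletter (Sum.inl ⟨h, hh⟩) v hv) ?_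
    induction hy using Submodule.span_induction with
    | zero => rw [modeEnd_zero]; exact zero_mem _
    | add y z _ _ hy hz =>
      rw [modeEnd_add]
      exact add_mem (hy (by rw [D.span_eq_top]; trivial)) (hz (by rw [D.span_eq_top]; trivial))
    | smul c y _ hy =>
      rw [modeEnd_smul]
      exact Submodule.smul_mem _ _ (hy (by rw [D.span_eq_top]; trivial))
    | mem y hy =>
      obtain ⟨i, rfl⟩ := hy
      exact hletter (Sum.inr i) v hv

lemma word_eigen (h : H) (l : List ((H ⊕ ι) × ℤ)) :
    modeEnd B k h 0 (D.word k l (vacuum B k)) = D.wordWt l h • D.word k l (vacuum B k) := by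
  induction l with
  | nil => simp [word, wordWt, modeEnd_vacuum]
  | cons a l ih =>
    rw [word_cons, wordWt_cons, modeEnd_comm_eigen (D.lie_vec h a.1) rfl, ih]
    simp only [map_smul, Int.cast_zero, zero_mul, ite_self, zero_smul, add_zero, zero_add,
      LinearMap.add_apply, add_smul]
    abel

/-- Word vectors are joint eigenvectors of the commuting operators `h(0)` and together they span
`V(k,0)`. A Heisenberg vacuum has joint eigenvalue zero, so by independence of the joint generalized
eigenspaces its components of nonzero weight cancel. -/
lemma heisenbergVacua_le_wordSpan : heisenbergVacua B k H ≤ D.wordSpan k 0 := by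
  intro v hv
  let E (χ : H → ℂ) : Submodule ℂ (VacuumModule B k) :=
    ⨅ h : H, (modeEnd B k h 0).maxGenEigenspace (χ h)
  have hcomm (h h' : H) : Commute (modeEnd B k (h : 𝔤) 0) (modeEnd B k (h' : 𝔤) 0) := by
    ext v
    simp [Module.End.mul_apply, modeEnd_swap B k (h : 𝔤) h', D.lie_toral h h.2 h' h'.2,
      modeEnd_zero]
  have hind : iSupIndep E := Module.End.independent_iInf_maxGenEigenspace_of_forall_mapsTo
    (fun h : H => modeEnd B k (h : 𝔤) 0) fun h h' φ =>
      Module.End.mapsTo_maxGenEigenspace_of_comm (hcomm h' h) φ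
  have hle (μ : Module.Dual ℂ H) : D.wordSpan k μ ≤ E μ := by
    refine le_iInf fun h => Submodule.span_le.2 ?_
    rintro _ ⟨l, rfl, rfl⟩
    exact Module.End.eigenspace_le_maxGenEigenspace
      (Module.End.mem_eigenspace_iff.2 (D.word_eigen h l))
  have hv0 : v ∈ E 0 := by
    rw [Submodule.mem_iInf]
    intro h
    refine Module.End.eigenspace_le_maxGenEigenspace
      (Module.End.mem_eigenspace_iff.2 ?_)
    rw [hv h h.2 0 le_rfl, Pi.zero_apply, zero_smul]
  have hsup : v ∈ D.wordSpan k 0 ⊔ ⨆ (χ : H → ℂ) (_ : χ ≠ 0), E χ := by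
    have : (⨆ μ, D.wordSpan k μ) ≤ D.wordSpan k 0 ⊔ ⨆ (χ : H → ℂ) (_ : χ ≠ 0), E χ := by
      refine iSup_le fun μ => ?_
      by_cases hμ : μ = 0
      · subst hμ; exact le_sup_left
      · refine le_sup_of_le_right (le_iSup₂_of_le (μ : H → ℂ) (fun h0 => hμ ?_) (hle μ))
        ext h; exact congrFun h0 h
    exact this (by rw [D.iSup_wordSpan]; trivial)
  obtain ⟨u, hu, z, hz, rfl⟩ := Submodule.mem_sup.1 hsup
  have hz0 : z ∈ E 0 := by
    have := sub_mem hv0 (hle 0 hu)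
    rwa [add_sub_cancel_left] at this
  rw [(Submodule.disjoint_def.1 (hind 0)) z hz0 hz, add_zero]
  exact hu

/-- The commutant of the Heisenberg vertex algebra is generated by the vectors `ω` and `W³` that
belong to the positive roots. -/
theorem vertexClosure_eq_parafermion (pos : Set ι) (hpos : ∀ i, i ∈ pos ∨ D.neg i ∈ pos)
    (c : ι → 𝔤) (κ : ι → ℂ) (hc : ∀ i ∈ pos, c i ∈ H)
    (T : ∀ i ∈ pos, IsLevelTriple B k (κ i) (c i) (D.x i) (D.x (D.neg i)))
    (hκ0 : ∀ i ∈ pos, κ i ≠ 0) (hκ2 : ∀ i ∈ pos, κ i + 2 ≠ 0)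
    (hκ : ∀ i ∈ pos, ∀ m : ℕ, (κ i + 1) * (m + 1) + 1 ≠ 0) (hk : k ≠ 0)
    {ι' : Type*} [Fintype ι'] (b d : ι' → 𝔤) (hb : ∀ i, b i ∈ H) (hd : ∀ i, d i ∈ H)
    (hbd : ∀ h ∈ H, ∑ i, B.form (d i) h • b i = h) :
    vertexClosure B k {v | ∃ i ∈ pos, v = omegaVec B k (κ i) (c i) (D.x i) (D.x (D.neg i)) ∨
      v = wVec B k (κ i) (c i) (D.x i) (D.x (D.neg i))} = parafermion B k H := by
  rw [parafermion_eq_heisenbergVacua D.lie_toral]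
  set S := {v | ∃ i ∈ pos, v = omegaVec B k (κ i) (c i) (D.x i) (D.x (D.neg i)) ∨
      v = wVec B k (κ i) (c i) (D.x i) (D.x (D.neg i))} with hS
  have toral (i : ι) (hi : i ∈ pos) (h : H) :
      IsLevelTriple.IsToral B k (κ i) (c i) (D.x i) (D.x (D.neg i)) h (D.wt i h) := by
    have hch : ⁅c i, (h : 𝔤)⁆ = 0 := D.lie_toral _ (hc i hi) _ h.2
    -- Invariance under `c i`, which commutes with `h` and scales `y` by a nonzero number.
    have horth (y : 𝔤) (r : ℂ) (hr : r ≠ 0) (hy : ⁅c i, y⁆ = r • y) : B.form h y = 0 := by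
      have := B.invariant (c i) (h : 𝔤) y
      rw [hch, hy, map_smul, map_zero, LinearMap.zero_apply, smul_eq_mul, eq_comm, neg_eq_zero,
        mul_eq_zero] at this
      exact this.resolve_left hr
    refine ⟨D.lie_toral _ h.2 _ (hc i hi), D.lie_x h i, ?_, ?_,
      horth _ _ two_ne_zero (T i hi).lie_h_e, horth _ _ (by norm_num) (T i hi).lie_h_f⟩
    · rw [D.lie_x, D.wt_neg]; rfl
    · have := B.invariant (D.x i) (h : 𝔤) (D.x (D.neg i))
      rw [(T i hi).lie_e_f, ← lie_skew, D.lie_x, map_neg, LinearMap.neg_apply, map_smul,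
        LinearMap.smul_apply, neg_inj] at this
      rw [← this, smul_eq_mul, mul_assoc, (T i hi).form_e_f, mul_comm]
  have hU : vertexClosure B k S ≤ heisenbergVacua B k H := by
    refine vertexClosure_le isVertexSubalgebra_heisenbergVacua ?_
    rintro _ ⟨i, hi, rfl | rfl⟩ h hh n hn
    · exact (IsLevelTriple.IsToral.modeEnd_eq_zero (T i hi) (toral i hi ⟨h, hh⟩) hn).1
    · exact (IsLevelTriple.IsToral.modeEnd_eq_zero (T i hi) (toral i hi ⟨h, hh⟩) hn).2
  refine le_antisymm hU fun v hv => ?_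
  have hC := isVertexSubalgebra_heisenbergSpan D.lie_toral hU (isVertexSubalgebra_vertexClosure S)
  set C := heisenbergSpan B k H (vertexClosure B k S)
  have hSC : S ⊆ C := (subset_vertexClosure S).trans (le_heisenbergSpan _)
  have hstab : ∀ h ∈ H, ∀ n, ∀ v ∈ C, modeEnd B k h n v ∈ C :=
    fun h hh n v hv => modeEnd_mem_heisenbergSpan D.lie_toral hU hh n hv
  have hx : ∀ i p q, ∀ v ∈ C, modeEnd B k (D.x i) p (modeEnd B k (D.x (D.neg i)) q v) ∈ C := by
    have hx' (i : ι) (hi : i ∈ pos) (p q : ℤ) (v : VacuumModule B k) (hv : v ∈ C) :=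
      (T i hi).e_f_mem (hκ0 i hi) (hκ2 i hi) (hκ i hi) hC
        (hstab _ (hc i hi) _ _ hC.vacuum_mem) (hSC ⟨i, hi, Or.inl rfl⟩) (hSC ⟨i, hi, Or.inr rfl⟩)
        p q hv
    intro i p q v hv
    rcases hpos i with hi | hi
    · exact (hx' i hi p q v hv).1
    · have := (hx' _ hi q p v hv).2
      rwa [D.neg_neg] at this
  refine heisenbergVacua_inf_heisenbergSpan_le D.lie_toral hk b d hb hd hbd hU ⟨hv, ?_⟩
  have hspan : D.wordSpan k 0 ≤ C := by
    refine Submodule.span_le.2 ?_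
    rintro _ ⟨l, hl, rfl⟩
    exact D.word_mem hstab hx l hl hC.vacuum_mem
  exact hspan (D.heisenbergVacua_le_wordSpan hv)

end RootVectorSystem
end Generation
end Parafermion

/-! ### Injectivity of homomorphisms between enveloping algebras -/

namespace Parafermion
section EnvelopingAlgebra
attribute [local instance 100] LieRing.ofAssociativeRing
open UniversalEnvelopingAlgebra TensorProduct

variable {L L' : Type*} [LieRing L] [LieAlgebra ℂ L] [LieRing L'] [LieAlgebra ℂ L']

lemma uea_mem_of_stable (W : Submodule ℂ (UniversalEnvelopingAlgebra ℂ L)) (h1 : 1 ∈ W)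
    (hW : ∀ x, ∀ u ∈ W, ι ℂ x * u ∈ W) (u : UniversalEnvelopingAlgebra ℂ L) : u ∈ W := by
  let S : Subalgebra ℂ (UniversalEnvelopingAlgebra ℂ L) :=
    { carrier := {a | ∀ w ∈ W, a * w ∈ W}
      mul_mem' := fun {a b} ha hb w hw => by rw [mul_assoc]; exact ha _ (hb _ hw)
      add_mem' := fun {a b} ha hb w hw => by rw [add_mul]; exact W.add_mem (ha _ hw) (hb _ hw)
      algebraMap_mem' := fun r w hw => by
        rw [← Algebra.smul_def]; exact W.smul_mem r hw }
  have := uea_induction S (fun x w hw => hW x w hw) u 1 h1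
  rwa [mul_one] at this

/-- If all values of a polynomial lie in a subspace, then so do its coefficients. -/
lemma coeff_mem_of_forall_eval_mem {M : Type*} [AddCommGroup M] [Module ℂ M] (W : Submodule ℂ M)
    (n : ℕ) (c : ℕ → M) (h : ∀ t : ℂ, ∑ d ∈ Finset.range n, t ^ d • c d ∈ W) (d : ℕ) (hd : d < n) :
    c d ∈ W := by
  rw [← Submodule.Quotient.mk_eq_zero, ← Module.forall_dual_apply_eq_zero_iff ℂ]
  -- After passing to the quotient by `W` and applying a linear form, the claim is that a complex
  -- polynomial with only zero values has zero coefficients.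
  intro ξ
  let P : Polynomial ℂ :=
    ∑ d ∈ Finset.range n, Polynomial.monomial d (ξ (Submodule.Quotient.mk (p := W) (c d)))
  have hP : P = 0 := by
    refine Polynomial.funext fun t => ?_
    have h1 := congrArg ξ ((Submodule.Quotient.mk_eq_zero W).2 (h t))
    change ξ (W.mkQ _) = ξ 0 at h1
    rw [map_sum, map_sum, map_zero] at h1
    rw [Polynomial.eval_finsetSum, Polynomial.eval_zero, ← h1]
    refine Finset.sum_congr rfl fun d _ => ?_
    rw [map_smul, map_smul, Polynomial.eval_monomial, smul_eq_mul, mul_comm]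
    rfl
  have h2 := congrArg (fun Q => Polynomial.coeff Q d) hP
  simpa [P, Polynomial.finsetSum_coeff, Polynomial.coeff_monomial, hd] using h2

/-- Noncommutative binomial expansion in a scalar parameter. Only its linear coefficient is needed,
for polarization. -/
lemma exists_add_smul_pow {A : Type*} [Ring A] [Algebra ℂ A] (x y : A) (n : ℕ) :
    ∃ c : ℕ → A, c 0 = x ^ n ∧ c 1 = ∑ i ∈ Finset.range n, x ^ i * y * x ^ (n - 1 - i) ∧
      ∀ t : ℂ, (x + t • y) ^ n = ∑ d ∈ Finset.range (n + 1), t ^ d • c d := by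
  induction n with
  | zero => exact ⟨fun d => if d = 0 then 1 else 0, by simp, by simp, by simp⟩
  | succ n ih =>
    obtain ⟨c, h0, h1, hc⟩ := ih
    let c' : ℕ → A := fun d => if d ≤ n then c d else 0
    refine ⟨fun d => match d with
      | 0 => x * c' 0
      | d + 1 => x * c' (d + 1) + y * c' d, ?_, ?_, fun t => ?_⟩
    · simp [c', h0, pow_succ']
    · simp only [c', h0, zero_le, if_true]
      rw [Finset.sum_range_succ', pow_zero, one_mul, add_tsub_cancel_right, tsub_zero]
      congr 1
      rcases n with _ | n
      · simp
      · rw [if_pos (by omega), h1, Finset.mul_sum]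
        refine Finset.sum_congr rfl fun i hi => ?_
        rw [pow_succ', mul_assoc, mul_assoc, mul_assoc, show n + 1 - 1 - i = n + 1 - (i + 1) by omega]
    · have hc' : (x + t • y) ^ n = ∑ d ∈ Finset.range (n + 1), t ^ d • c' d := by
        rw [hc]
        refine Finset.sum_congr rfl fun d hd => ?_
        simp only [c']
        rw [if_pos (by simpa [Nat.lt_succ_iff] using hd)]
      have hlast : c' (n + 1) = 0 := by simp [c']
      rw [pow_succ', hc', Finset.sum_range_succ' _ (n + 1)]
      simp only [smul_add, Finset.sum_add_distrib]
      rw [add_mul, Finset.mul_sum, Finset.mul_sum, Finset.sum_range_succ' _ n,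
        Finset.sum_range_succ (fun d => t ^ (d + 1) • (x * c' (d + 1))), hlast]
      simp only [mul_zero, smul_zero, add_zero, pow_zero, one_smul, mul_smul_comm, smul_mul_assoc,
        smul_smul, pow_succ]
      abel

/-- The standard filtration of the enveloping algebra. -/
def ueaFilt (L : Type*) [LieRing L] [LieAlgebra ℂ L] :
    Submodule ℂ (UniversalEnvelopingAlgebra ℂ L) :=
  1 ⊔ LinearMap.range (ι ℂ : L →ₗ⁅ℂ⁆ UniversalEnvelopingAlgebra ℂ L).toLinearMap

lemma one_le_ueaFilt : 1 ≤ ueaFilt L := le_sup_left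

lemma ι_mem_ueaFilt (x : L) : ι ℂ x ∈ ueaFilt L := Submodule.mem_sup_right ⟨x, rfl⟩

lemma ueaFilt_pow_mono {m n : ℕ} (h : m ≤ n) : ueaFilt L ^ m ≤ ueaFilt L ^ n :=
  pow_le_pow_right' one_le_ueaFilt h

lemma exists_mem_ueaFilt_pow (u : UniversalEnvelopingAlgebra ℂ L) : ∃ n, u ∈ ueaFilt L ^ n := by
  let W : Submodule ℂ (UniversalEnvelopingAlgebra ℂ L) :=
    { carrier := {u | ∃ n, u ∈ ueaFilt L ^ n}
      add_mem' := fun ⟨n, hn⟩ ⟨m, hm⟩ => ⟨max n m, add_mem (ueaFilt_pow_mono (le_max_left _ _) hn)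
        (ueaFilt_pow_mono (le_max_right _ _) hm)⟩
      zero_mem' := ⟨0, zero_mem _⟩
      smul_mem' := fun c u ⟨n, hn⟩ => ⟨n, Submodule.smul_mem _ c hn⟩ }
  refine uea_mem_of_stable W ⟨0, ?_⟩ (fun x u ⟨n, hn⟩ => ⟨n + 1, ?_⟩) u
  · rw [pow_zero]; exact Submodule.one_le.1 le_rfl
  · rw [pow_succ']; exact Submodule.mul_mem_mul (ι_mem_ueaFilt x) hn

/-- Each transposition of `y` with a factor `x` replaces two factors by the single factor `⁅x, y⁆`,
so the degree drops by one from the expected `i + 1`. -/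
lemma pow_mul_sub_mem (x y : L) (i : ℕ) : ι ℂ x ^ i * ι ℂ y - ι ℂ y * ι ℂ x ^ i ∈ ueaFilt L ^ i := by
  induction i with
  | zero => simp
  | succ i ih =>
    have h1 : ι ℂ x * ι ℂ y = ι ℂ y * ι ℂ x + ι ℂ ⁅x, y⁆ := by
      rw [LieHom.map_lie, LieRing.of_associative_ring_bracket]; abel
    have h2 : ι ℂ x ^ (i + 1) * ι ℂ y - ι ℂ y * ι ℂ x ^ (i + 1) =
        ι ℂ x * (ι ℂ x ^ i * ι ℂ y - ι ℂ y * ι ℂ x ^ i) + ι ℂ ⁅x, y⁆ * ι ℂ x ^ i := by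
      rw [pow_succ', mul_assoc, mul_sub, ← mul_assoc (ι ℂ x) (ι ℂ y), h1]
      noncomm_ring
    rw [h2, pow_succ' (ueaFilt L)]
    exact add_mem (Submodule.mul_mem_mul (ι_mem_ueaFilt x) ih)
      (Submodule.mul_mem_mul (ι_mem_ueaFilt _) (Submodule.pow_mem_pow _ (ι_mem_ueaFilt x) i))

/-- The span of the powers of degree at most `n` of elements of the Lie algebra. -/
def powSpan (L : Type*) [LieRing L] [LieAlgebra ℂ L] (n : ℕ) :
    Submodule ℂ (UniversalEnvelopingAlgebra ℂ L) :=
  Submodule.span ℂ {u | ∃ m ≤ n, ∃ x : L, u = ι ℂ x ^ m}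

lemma powSpan_mono {m n : ℕ} (h : m ≤ n) : powSpan L m ≤ powSpan L n :=
  Submodule.span_mono fun _ ⟨i, hi, x, hx⟩ => ⟨i, hi.trans h, x, hx⟩

/-- The enveloping algebra is spanned by powers. -/
lemma ueaFilt_pow_le_powSpan (n : ℕ) : ueaFilt L ^ n ≤ powSpan L n := by
  induction n with
  | zero =>
    rw [pow_zero, Submodule.one_le]
    exact Submodule.subset_span ⟨0, le_rfl, 0, by simp⟩
  | succ n ih =>
    rw [pow_succ', ueaFilt, Submodule.sup_mul]
    refine sup_le ?_ (Submodule.mul_le.2 ?_)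
    · rw [one_mul]
      exact ih.trans (powSpan_mono (Nat.le_succ n))
    · rintro _ ⟨y, rfl⟩ u hu
      have hu' := ih hu
      clear hu
      change ι ℂ y * u ∈ _
      induction hu' using Submodule.span_induction with
      | zero => rw [mul_zero]; exact zero_mem _
      | add a b _ _ ha hb => rw [mul_add]; exact add_mem ha hb
      | smul c a _ ha => rw [mul_smul_comm]; exact Submodule.smul_mem _ c ha
      | mem a ha =>
        obtain ⟨m, hm, x, rfl⟩ := ha
        rcases hm.lt_or_eq with hm | rfl
        · refine powSpan_mono (Nat.le_succ n) (ih (ueaFilt_pow_mono (Nat.succ_le_of_lt hm) ?_))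
          rw [pow_succ']
          exact Submodule.mul_mem_mul (ι_mem_ueaFilt y) (Submodule.pow_mem_pow _ (ι_mem_ueaFilt x) m)
        -- Polarization: the coefficient of `t` in `(x + ty)^(m+1)` is a combination of powers, and
        -- it equals `(m+1) y x^m` up to terms of lower degree, which are in the span by induction.
        · obtain ⟨c, -, h1, hc⟩ := exists_add_smul_pow (ι ℂ x) (ι ℂ y) (m + 1)
          have hmem := coeff_mem_of_forall_eval_mem (powSpan L (m + 1)) (m + 1 + 1) c (fun t => by
            rw [← hc]
            exact Submodule.subset_span ⟨m + 1, le_rfl, x + t • y, by rw [map_add, map_smul]⟩)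
            1 (by omega)
          rw [h1] at hmem
          have hdiff : ∑ i ∈ Finset.range (m + 1), (ι ℂ x ^ i * ι ℂ y * ι ℂ x ^ (m + 1 - 1 - i) -
              ι ℂ y * ι ℂ x ^ m) ∈ powSpan L (m + 1) := by
            refine powSpan_mono (Nat.le_succ m) (ih (sum_mem fun i hi => ?_))
            have hi' : i ≤ m := by simpa [Nat.lt_succ_iff] using hi
            obtain ⟨j, rfl⟩ := Nat.exists_eq_add_of_le hi'
            rw [show i + j + 1 - 1 - i = j by omega, pow_add (ι ℂ x), ← mul_assoc, ← sub_mul, pow_add]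
            exact Submodule.mul_mem_mul (pow_mul_sub_mem x y i)
              (Submodule.pow_mem_pow _ (ι_mem_ueaFilt x) j)
          have := sub_mem hmem hdiff
          rw [← Finset.sum_sub_distrib] at this
          simp only [sub_sub_cancel, Finset.sum_const, Finset.card_range] at this
          rw [← Nat.cast_smul_eq_nsmul ℂ] at this
          exact (Submodule.smul_mem_iff _ (by exact_mod_cast Nat.succ_ne_zero m)).1 this

/-- The comultiplication of the enveloping algebra. -/
noncomputable def ueaComul (L : Type*) [LieRing L] [LieAlgebra ℂ L] : UniversalEnvelopingAlgebra ℂ L →ₐ[ℂ]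
    UniversalEnvelopingAlgebra ℂ L ⊗[ℂ] UniversalEnvelopingAlgebra ℂ L :=
  lift ℂ
    { toFun := fun x => ι ℂ x ⊗ₜ[ℂ] 1 + 1 ⊗ₜ[ℂ] ι ℂ x
      map_add' := fun x y => by rw [map_add, TensorProduct.add_tmul, TensorProduct.tmul_add]; abel
      map_smul' := fun c x => by
        rw [map_smul, RingHom.id_apply, smul_add, TensorProduct.smul_tmul', TensorProduct.tmul_smul]
      map_lie' := fun {x y} => by
        rw [LieHom.map_lie, LieRing.of_associative_ring_bracket, LieRing.of_associative_ring_bracket]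
        simp only [mul_add, add_mul, Algebra.TensorProduct.tmul_mul_tmul, one_mul, mul_one,
          TensorProduct.sub_tmul, TensorProduct.tmul_sub]
        abel }

lemma ueaComul_pow (x : L) (m : ℕ) : ueaComul L (ι ℂ x ^ m) =
    ∑ ij ∈ Finset.range (m + 1), (m.choose ij : ℂ) • ((ι ℂ x ^ ij) ⊗ₜ[ℂ] (ι ℂ x ^ (m - ij))) := by
  have hc : Commute (ι ℂ x ⊗ₜ[ℂ] (1 : UniversalEnvelopingAlgebra ℂ L))
      ((1 : UniversalEnvelopingAlgebra ℂ L) ⊗ₜ[ℂ] ι ℂ x) := by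
    simp [Commute, SemiconjBy, Algebra.TensorProduct.tmul_mul_tmul]
  rw [map_pow, ueaComul, lift_ι_apply]
  change (ι ℂ x ⊗ₜ[ℂ] 1 + 1 ⊗ₜ[ℂ] ι ℂ x) ^ m = _
  rw [hc.add_pow]
  refine Finset.sum_congr rfl fun j _ => ?_
  rw [Algebra.TensorProduct.tmul_pow, Algebra.TensorProduct.tmul_pow,
    Algebra.TensorProduct.tmul_mul_tmul, one_pow, one_pow, one_mul, mul_one, ← nsmul_eq_mul',
    Nat.cast_smul_eq_nsmul]

variable (lam : UniversalEnvelopingAlgebra ℂ L →ₗ[ℂ] L')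

/-- The convolution powers of a linear map from an enveloping algebra to a Lie algebra. -/
noncomputable def convPow : ℕ → UniversalEnvelopingAlgebra ℂ L →ₗ[ℂ] UniversalEnvelopingAlgebra ℂ L'
  | 0 => Algebra.linearMap ℂ _ ∘ₗ (lift ℂ (0 : L →ₗ⁅ℂ⁆ ℂ)).toLinearMap
  | n + 1 => LinearMap.mul' ℂ _ ∘ₗ
      TensorProduct.map (convPow n) 
      ((ι ℂ : L' →ₗ⁅ℂ⁆ UniversalEnvelopingAlgebra ℂ L').toLinearMap ∘ₗ lam) ∘ₗ
      (ueaComul L).toLinearMap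

variable {lam}

/-- The `n`-th convolution power splits `x^m` into `n` factors, each of which must have positive
degree since `lam 1 = 0`. For `m < n` this is impossible; for `m = n` each factor is a single `x`,
and there are `n!` ways to distribute them. -/
lemma convPow_pow (h1 : lam 1 = 0) {x : L} {y : L'} (hx : lam (ι ℂ x) = y) (n m : ℕ) (hm : m ≤ n) :
    convPow lam n (ι ℂ x ^ m) = if m = n then (n.factorial : ℂ) • ι ℂ y ^ n else 0 := by
  induction n generalizing m with
  | zero =>
    obtain rfl : m = 0 := by omega
    simp [convPow]
  | succ n ih =>
    have hstep : convPow lam (n + 1) (ι ℂ x ^ m) = ∑ j ∈ Finset.range (m + 1),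
        (m.choose j : ℂ) • (convPow lam n (ι ℂ x ^ j) * ι ℂ (lam (ι ℂ x ^ (m - j)))) := by
      rw [convPow, LinearMap.comp_apply, LinearMap.comp_apply, AlgHom.toLinearMap_apply, ueaComul_pow,
        map_sum, map_sum]
      refine Finset.sum_congr rfl fun j _ => ?_
      rw [map_smul, map_smul, TensorProduct.map_tmul, LinearMap.mul'_apply]
      rfl
    rw [hstep, Finset.sum_range_succ, Nat.sub_self, pow_zero, h1, map_zero, mul_zero, smul_zero,
      add_zero]
    split_ifs with hmn
    · subst hmn
      rw [Finset.sum_range_succ, Finset.sum_eq_zero, zero_add, ih n le_rfl, if_pos rfl,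
        Nat.add_sub_cancel_left, pow_one, hx, Nat.choose_succ_self_right, smul_mul_assoc, ← pow_succ,
        smul_smul, Nat.factorial_succ]
      · push_cast; rfl
      · intro j hj
        rw [Finset.mem_range] at hj
        rw [ih j hj.le, if_neg hj.ne, zero_mul, smul_zero]
    · refine Finset.sum_eq_zero fun j hj => ?_
      rw [Finset.mem_range] at hj
      rw [ih j (by omega), if_neg (by omega), zero_mul, smul_zero]

/-- The algebra map induced by a homomorphism of Lie algebras. -/
noncomputable def ueaMap (f : L' →ₗ⁅ℂ⁆ L) :
    UniversalEnvelopingAlgebra ℂ L' →ₐ[ℂ] UniversalEnvelopingAlgebra ℂ L :=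
  lift ℂ ((ι ℂ).comp f)

lemma ueaMap_ι (f : L' →ₗ⁅ℂ⁆ L) (x : L') : ueaMap f (ι ℂ x) = ι ℂ (f x) := by
  rw [ueaMap, lift_ι_apply]; rfl

/-- The convolution powers of `lam` recover the leading term of `u` from its image. So an element of
the kernel that is a combination of powers of degree at most `n + 1` is already one of degree at
most `n`; descending, it is a scalar, which the counit detects. -/
lemma ueaMap_injective_of_retraction (f : L' →ₗ⁅ℂ⁆ L) (h1 : lam 1 = 0)
    (hf : ∀ x, lam (ι ℂ (f x)) = x) : Function.Injective (ueaMap f) := by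
  rw [injective_iff_map_eq_zero]
  intro u hu
  obtain ⟨n, hn⟩ := exists_mem_ueaFilt_pow u
  replace hn := ueaFilt_pow_le_powSpan n hn
  have key (n m : ℕ) (hm : m ≤ n) (x : L') : convPow lam n (ueaMap f (ι ℂ x ^ m)) =
      if m = n then (n.factorial : ℂ) • ι ℂ x ^ n else 0 := by
    rw [map_pow, ueaMap_ι, convPow_pow h1 (hf x) n m hm]
  have h0 (n : ℕ) (v : UniversalEnvelopingAlgebra ℂ L') (hv : v ∈ powSpan L' n) :
      convPow lam (n + 1) (ueaMap f v) = 0 := by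
    induction hv using Submodule.span_induction with
    | zero => simp
    | add a b _ _ ha hb => rw [map_add, map_add, ha, hb, add_zero]
    | smul c a _ ha => rw [map_smul, map_smul, ha, smul_zero]
    | mem a ha =>
      obtain ⟨m, hm, x, rfl⟩ := ha
      rw [key _ _ (by omega), if_neg (by omega)]
  have hdec (n : ℕ) (v : UniversalEnvelopingAlgebra ℂ L') (hv : v ∈ powSpan L' (n + 1)) :
      v - (((n + 1).factorial : ℂ)⁻¹) • convPow lam (n + 1) (ueaMap f v) ∈ powSpan L' n := by
    induction hv using Submodule.span_induction with
    | zero => simp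
    | add a b _ _ ha hb =>
      rw [map_add, map_add, smul_add, add_sub_add_comm]; exact add_mem ha hb
    | smul c a _ ha =>
      rw [map_smul, map_smul, smul_comm, ← smul_sub]; exact Submodule.smul_mem _ c ha
    | mem a ha =>
      obtain ⟨m, hm, x, rfl⟩ := ha
      rw [key _ _ hm]
      split_ifs with hmn
      · subst hmn
        rw [smul_smul, inv_mul_cancel₀ (by exact_mod_cast Nat.factorial_ne_zero _), one_smul, sub_self]
        exact zero_mem _
      · rw [smul_zero, sub_zero]
        exact Submodule.subset_span ⟨m, by omega, x, rfl⟩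
  induction n with
  | zero =>
    have hle : powSpan L' 0 ≤ 1 := by
      refine Submodule.span_le.2 ?_
      rintro _ ⟨m, hm, x, rfl⟩
      obtain rfl : m = 0 := by omega
      rw [pow_zero]
      exact Submodule.one_le.1 le_rfl
    obtain ⟨c, rfl⟩ := Submodule.mem_one.1 (hle hn)
    have := congrArg (convPow lam 0) hu
    rw [AlgHom.commutes, convPow, LinearMap.comp_apply, AlgHom.toLinearMap_apply,
      AlgHom.commutes, map_zero] at this
    simpa using this
  | succ n ih =>
    have := hdec n u hn
    rw [hu, map_zero, smul_zero, sub_zero] at this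
    exact ih this

/-- A homomorphism of Lie algebras induces an injection of enveloping algebras if it is injective
after composition with a `1`-cocycle. -/
theorem ueaMap_injective (f : L' →ₗ⁅ℂ⁆ L) {A : Type*} [AddCommGroup A] [Module ℂ A]
    [LieRingModule L A] [LieModule ℂ L A] (δ : L →ₗ[ℂ] A)
    (hδ : ∀ x y, δ ⁅x, y⁆ = ⁅x, δ y⁆ - ⁅y, δ x⁆) (hf : Function.Injective fun x => δ (f x)) :
    Function.Injective (ueaMap f) := by
  -- The extension of the trivial module by `A` defined by the cocycle: `x · (a, r) = (x a + r δ x,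
  -- 0)`. Acting on `(0, 1)` extends `δ` to a linear map on the enveloping algebra that kills `1`,
  -- and a linear left inverse of `δ ∘ f` then supplies the retraction.
  let τ : L →ₗ⁅ℂ⁆ Module.End ℂ (A × ℂ) :=
    { toFun := fun x => LinearMap.inl ℂ A ℂ ∘ₗ
        ((LieModule.toEnd ℂ L A x).coprod (LinearMap.toSpanSingleton ℂ A (δ x)))
      map_add' := fun x y => by ext <;> simp
      map_smul' := fun c x => by ext <;> simp
      map_lie' := fun {x y} => by
        rw [LieRing.of_associative_ring_bracket]
        ext <;> simp [hδ] }
  let ev : UniversalEnvelopingAlgebra ℂ L →ₗ[ℂ] A :=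
    LinearMap.fst ℂ A ℂ ∘ₗ LinearMap.applyₗ ((0, 1) : A × ℂ) ∘ₗ (lift ℂ τ).toLinearMap
  have hev (x : L) : ev (ι ℂ x) = δ x := by
    simp only [ev, LinearMap.comp_apply, AlgHom.toLinearMap_apply, lift_ι_apply]
    simp [τ]
  obtain ⟨g, hg⟩ := LinearMap.exists_leftInverse_of_injective (δ ∘ₗ f.toLinearMap)
    (LinearMap.ker_eq_bot.2 hf)
  refine ueaMap_injective_of_retraction (lam := g ∘ₗ ev) f ?_ fun x => ?_
  · simp [ev]
  · rw [LinearMap.comp_apply, hev]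
    exact LinearMap.congr_fun hg x

end EnvelopingAlgebra
end Parafermion

/-! ### Induced modules realized on the enveloping algebra of a complementary subalgebra -/

namespace Parafermion
section InducedModule
attribute [local instance 100] LieRing.ofAssociativeRing
open UniversalEnvelopingAlgebra

variable {L : Type*} [LieRing L] [LieAlgebra ℂ L] (N : LieSubalgebra ℂ L)

/-- The module of linear maps from `L` to the enveloping algebra of a subalgebra. -/
noncomputable def homAction : N →ₗ⁅ℂ⁆ Module.End ℂ (L →ₗ[ℂ] UniversalEnvelopingAlgebra ℂ N) where
  toFun y :=
    { toFun φ := LinearMap.mulLeft ℂ (ι ℂ y) ∘ₗ φ - φ ∘ₗ LieModule.toEnd ℂ L L (y : L)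
      map_add' φ ψ := by ext z; simp [mul_add]; abel
      map_smul' c φ := by ext z; simp [smul_sub] }
  map_add' x y := by ext φ z; simp [add_mul]; abel
  map_smul' c x := by ext φ z; simp [smul_sub]
  map_lie' {x y} := by
    ext φ z
    rw [LieRing.of_associative_ring_bracket]
    simp [LieRing.of_associative_ring_bracket, mul_sub, sub_mul, mul_assoc]
    abel

/-- If `L` is the direct sum of a subalgebra `N` and a complementary subalgebra, then every
character of the complement makes the enveloping algebra of `N` into an `L`-module. -/
theorem exists_induced_action (pr : L →ₗ[ℂ] N) (χ : L →ₗ[ℂ] ℂ) (hpr : ∀ y : N, pr y = y)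
    (hχ : ∀ y : N, χ y = 0) (hpr' : ∀ z w, pr ⁅z - pr z, w - pr w⁆ = 0)
    (hχ' : ∀ z w, χ ⁅z - pr z, w - pr w⁆ = 0) :
    ∃ τ : L →ₗ⁅ℂ⁆ Module.End ℂ (UniversalEnvelopingAlgebra ℂ N),
      (∀ (y : N) u, τ y u = ι ℂ y * u) ∧
      ∀ z, τ z 1 = ι ℂ (pr z) + algebraMap ℂ _ (χ z) := by
  let φ₀ : L →ₗ[ℂ] UniversalEnvelopingAlgebra ℂ N :=
    (ι ℂ : N →ₗ⁅ℂ⁆ UniversalEnvelopingAlgebra ℂ N).toLinearMap ∘ₗ pr + Algebra.linearMap ℂ _ ∘ₗ χ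
  -- `act u z` is to be `z · u`. The desired rule `z · (y u) = y (z · u) - ⁅y, z⁆ · u` for `y ∈ N`
  -- says that `u ↦ act u` is linear over the enveloping algebra of `N` for `homAction`, so it is
  -- determined by `φ₀`, the prescribed action on `1`. Well-definedness is automatic, and the module
  -- axiom is checked by induction on `u`.
  let act : UniversalEnvelopingAlgebra ℂ N →ₗ[ℂ] L →ₗ[ℂ] UniversalEnvelopingAlgebra ℂ N :=
    LinearMap.applyₗ φ₀ ∘ₗ (lift ℂ (homAction N)).toLinearMap
  have act_one : act 1 = φ₀ := by simp [act]
  have act_mul (y : N) (u) (z : L) : act (ι ℂ y * u) z = ι ℂ y * act u z - act u ⁅(y : L), z⁆ := by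
    simp only [act, LinearMap.comp_apply, AlgHom.toLinearMap_apply, map_mul, lift_ι_apply]
    rfl
  have hφ (z : L) : φ₀ z = ι ℂ (pr z) + algebraMap ℂ _ (χ z) := rfl
  have hφN (y : N) : φ₀ y = ι ℂ y := by rw [hφ, hpr, hχ, map_zero, add_zero]
  have hN (y : N) (u) : act u (y : L) = ι ℂ y * u := by
    let W : Submodule ℂ (UniversalEnvelopingAlgebra ℂ N) :=
      { carrier := {u | ∀ y : N, act u (y : L) = ι ℂ y * u}
        add_mem' := fun ha hb y => by rw [map_add, LinearMap.add_apply, ha, hb, mul_add]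
        zero_mem' := fun y => by simp
        smul_mem' := fun c a ha y => by
          rw [map_smul, LinearMap.smul_apply, ha, mul_smul_comm] }
    refine uea_mem_of_stable W (fun y => by rw [act_one, hφN, mul_one]) (fun x u hu y => ?_) u y
    rw [act_mul, hu y, ← LieSubalgebra.coe_bracket, hu, LieHom.map_lie,
      LieRing.of_associative_ring_bracket, sub_mul, mul_assoc, mul_assoc]
    abel
  have hlie (u) (z w : L) : act (act u w) z - act (act u z) w = act u ⁅z, w⁆ := by
    let W : Submodule ℂ (UniversalEnvelopingAlgebra ℂ N) :=
      { carrier := {u | ∀ z w, act (act u w) z - act (act u z) w = act u ⁅z, w⁆}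
        add_mem' := fun {a b} ha hb z w => by
          simp only [map_add, LinearMap.add_apply, ← ha z w, ← hb z w]
          abel
        zero_mem' := fun z w => by simp
        smul_mem' := fun c a ha z w => by
          simp only [map_smul, LinearMap.smul_apply, ← ha z w, smul_sub] }
    refine uea_mem_of_stable W (fun z w => ?_) (fun y u hu z w => ?_) u z w
    · have h1 (z w : L) : act (φ₀ w) z =
          ι ℂ (pr w) * φ₀ z - φ₀ ⁅(pr w : L), z⁆ + χ w • φ₀ z := by
        have h := act_mul (pr w) 1 z
        rw [mul_one, act_one] at h
        rw [hφ w, map_add, LinearMap.add_apply, h, Algebra.algebraMap_eq_smul_one, map_smul, act_one]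
        rfl
      have h2 : φ₀ ⁅z, w⁆ = φ₀ ⁅(pr z : L), w⁆ - φ₀ ⁅(pr w : L), z⁆
          - ι ℂ ⁅pr z, pr w⁆ := by
        have h3 : φ₀ ⁅z - (pr z : L), w - (pr w : L)⁆ = 0 := by
          rw [hφ, hpr', hχ', map_zero, map_zero, add_zero]
        rw [← hφN, LieSubalgebra.coe_bracket, ← map_sub, ← map_sub, ← sub_eq_zero, ← map_sub, ← h3]
        congr 1
        rw [← lie_skew (pr w : L) z]
        simp only [sub_lie, lie_sub]
        abel
      rw [act_one, h1, h1, h2, hφ z, hφ w, LieHom.map_lie, LieRing.of_associative_ring_bracket,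
        Algebra.algebraMap_eq_smul_one, Algebra.algebraMap_eq_smul_one]
      simp only [mul_add, smul_add, mul_smul_comm, mul_one, smul_smul, mul_comm (χ w)]
      abel
    · have j : ⁅(y : L), ⁅z, w⁆⁆ = ⁅⁅(y : L), z⁆, w⁆ + ⁅z, ⁅(y : L), w⁆⁆ := leibniz_lie _ _ _
      rw [act_mul, act_mul, act_mul, map_sub, map_sub, LinearMap.sub_apply, LinearMap.sub_apply,
        act_mul, act_mul, ← hu z w, j, map_add, ← hu ⁅(y : L), z⁆ w, ← hu z ⁅(y : L), w⁆, mul_sub]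
      abel
  refine ⟨{ act.flip with map_lie' := fun {z w} => ?_ }, hN, fun z => ?_⟩
  · ext u
    rw [LieRing.of_associative_ring_bracket]
    exact (hlie u z w).symm
  · change act 1 z = _
    rw [act_one]
    rfl

end InducedModule

/-! ### The negative part of the affine Lie algebra and the realization of `V(k,0)` -/

section NegativePart
open UniversalEnvelopingAlgebra
variable {𝔤 : Type*} [LieRing 𝔤] [LieAlgebra ℂ 𝔤] (B : InvForm 𝔤)

lemma loopElt_lie_central (n : ℤ) (x : 𝔤) : ⁅central B, loopElt B n x⁆ = 0 := by
  rw [← lie_skew, lie_central, neg_zero]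

/-- The subalgebra `𝔤 ⊗ t⁻¹ ℂ[t⁻¹]` of the affine Lie algebra. -/
noncomputable def negPart : LieSubalgebra ℂ (Affine B) where
  __ := Submodule.span ℂ {z | ∃ (n : ℤ) (x : 𝔤), n < 0 ∧ z = loopElt B n x}
  lie_mem' {z w} hz hw := by
    change z ∈ Submodule.span ℂ _ at hz
    change w ∈ Submodule.span ℂ _ at hw
    change ⁅z, w⁆ ∈ Submodule.span ℂ _
    induction hz, hw using Submodule.span_induction₂ with
    | zero_left => rw [zero_lie]; exact zero_mem _
    | zero_right => rw [lie_zero]; exact zero_mem _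
    | add_left x y z _ _ _ h1 h2 => rw [add_lie]; exact add_mem h1 h2
    | add_right x y z _ _ _ h1 h2 => rw [lie_add]; exact add_mem h1 h2
    | smul_left r x y _ _ h => rw [smul_lie]; exact Submodule.smul_mem _ _ h
    | smul_right r x y _ _ h => rw [lie_smul]; exact Submodule.smul_mem _ _ h
    | mem_mem x y hx hy =>
      obtain ⟨m, x, hm, rfl⟩ := hx
      obtain ⟨n, y, hn, rfl⟩ := hy
      rw [lie_loopElt, if_neg (by omega), zero_smul, add_zero]
      exact Submodule.subset_span ⟨_, _, by omega, rfl⟩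

lemma loopElt_mem_negPart {n : ℤ} (hn : n < 0) (x : 𝔤) : loopElt B n x ∈ negPart B :=
  Submodule.subset_span ⟨n, x, hn, rfl⟩

/-- The element `x ⊗ t^n` of the negative part, for `n < 0`. -/
noncomputable def negElt (n : ℤ) (hn : n < 0) (x : 𝔤) : negPart B := ⟨loopElt B n x, loopElt_mem_negPart B hn x⟩

lemma negPart_ext {M : Type*} [AddCommGroup M] [Module ℂ M] {F G : negPart B →ₗ[ℂ] M}
    (h : ∀ n hn x, F (negElt B n hn x) = G (negElt B n hn x)) : F = G := by
  ext ⟨z, hz⟩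
  have : ∀ (z : Affine B) (hz : z ∈ Submodule.span ℂ {z | ∃ (n : ℤ) (x : 𝔤), n < 0 ∧ z = loopElt B n x}),
      F ⟨z, hz⟩ = G ⟨z, hz⟩ := by
    intro z hz
    induction hz using Submodule.span_induction with
    | zero => exact (map_zero F).trans (map_zero G).symm
    | add x y hx hy h1 h2 =>
      exact (map_add F ⟨x, hx⟩ ⟨y, hy⟩).trans ((congrArg₂ _ h1 h2).trans
        (map_add G ⟨x, hx⟩ ⟨y, hy⟩).symm)
    | smul c x hx h1 =>
      exact (map_smul F c ⟨x, hx⟩).trans ((congrArg _ h1).trans (map_smul G c ⟨x, hx⟩).symm)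
    | mem x hx =>
      obtain ⟨n, x, hn, rfl⟩ := hx
      exact h n hn x
  exact this z hz

/-- A linear map from the affine Lie algebra, from its values on loops and on `K`. -/
noncomputable def affineLift {M : Type*} [AddCommGroup M] [Module ℂ M] (F : ℤ → 𝔤 →ₗ[ℂ] M) (c : M) :
    Affine B →ₗ[ℂ] M :=
  LinearMap.coprod (Finsupp.lsum ℂ F) (LinearMap.toSpanSingleton ℂ M c) ∘ₗ (coords B).toLinearMap

variable {B} in
lemma affineLift_loopElt {M : Type*} [AddCommGroup M] [Module ℂ M] (F : ℤ → 𝔤 →ₗ[ℂ] M) (c : M)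
    (n : ℤ) (x : 𝔤) : affineLift B F c (loopElt B n x) = F n x := by
  simp [affineLift, coords_loopElt]

variable {B} in
lemma affineLift_central {M : Type*} [AddCommGroup M] [Module ℂ M] (F : ℤ → 𝔤 →ₗ[ℂ] M) (c : M) :
    affineLift B F c (central B) = c := by
  simp [affineLift, coords_central]

variable {B} in
lemma affine_ext {M : Type*} [AddCommGroup M] [Module ℂ M] {F G : Affine B →ₗ[ℂ] M}
    (h : ∀ n x, F (loopElt B n x) = G (loopElt B n x)) (hc : F (central B) = G (central B)) :
    F = G := by
  ext z
  rw [eq_sum_loopElt B z, map_add, map_add, map_smul, map_smul, hc, Finsupp.sum, map_sum, map_sum]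
  simp_rw [h]

/-- The projection of the affine Lie algebra onto its negative part. -/
noncomputable def negProj : Affine B →ₗ[ℂ] negPart B :=
  affineLift B (fun n => if hn : n < 0 then (loopElt B n).codRestrict (negPart B).toSubmodule
    (loopElt_mem_negPart B hn) else 0) 0

lemma negProj_loopElt_of_neg {n : ℤ} (hn : n < 0) (x : 𝔤) :
    negProj B (loopElt B n x) = negElt B n hn x := by
  rw [negProj, affineLift_loopElt, dif_pos hn]; rfl

lemma negProj_loopElt_of_nonneg {n : ℤ} (hn : 0 ≤ n) (x : 𝔤) :
    negProj B (loopElt B n x) = 0 := by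
  rw [negProj, affineLift_loopElt, dif_neg (by omega)]; rfl

lemma negProj_central : negProj B (central B) = 0 := affineLift_central _ _

lemma negProj_coe (y : negPart B) : negProj B y = y := by
  have : negProj B ∘ₗ (negPart B).toSubmodule.subtype = LinearMap.id :=
    negPart_ext B fun n hn x => negProj_loopElt_of_neg B hn x
  exact LinearMap.congr_fun this y

/-- The span of `𝔤 ⊗ ℂ[t]` and `K`. -/
noncomputable def nonnegPart : Submodule ℂ (Affine B) :=
  Submodule.span ℂ ({z | ∃ (n : ℤ) (x : 𝔤), 0 ≤ n ∧ z = loopElt B n x} ∪ {central B})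

lemma sub_negProj_mem (z : Affine B) : z - negProj B z ∈ nonnegPart B := by
  rw [eq_sum_loopElt B z, map_add, map_smul, negProj_central, smul_zero, add_zero, add_sub_right_comm]
  refine add_mem ?_ (Submodule.smul_mem _ _ (Submodule.subset_span (Or.inr rfl)))
  have h (s : Finset ℤ) (g : ℤ → negPart B) :
      ((∑ n ∈ s, g n : negPart B) : Affine B) = ∑ n ∈ s, (g n : Affine B) :=
    map_sum (negPart B).toSubmodule.subtype g s
  rw [Finsupp.sum, map_sum, h, ← Finset.sum_sub_distrib]
  refine sum_mem fun n _ => ?_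
  rcases lt_or_ge n 0 with hn | hn
  · rw [negProj_loopElt_of_neg B hn, negElt, sub_self]
    exact zero_mem _
  · rw [negProj_loopElt_of_nonneg B hn, ZeroMemClass.coe_zero, sub_zero]
    exact Submodule.subset_span (Or.inl ⟨n, _, hn, rfl⟩)

/-- No central term arises: for degrees `m, n ≥ 0` it would require `m = n = 0`, and its coefficient
is `m`. -/
lemma lie_nonnegPart {M : Type*} [AddCommGroup M] [Module ℂ M] (F : Affine B →ₗ[ℂ] M)
    (hF : ∀ n x, 0 ≤ n → F (loopElt B n x) = 0) {z w : Affine B} (hz : z ∈ nonnegPart B)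
    (hw : w ∈ nonnegPart B) : F ⁅z, w⁆ = 0 := by
  induction hz, hw using Submodule.span_induction₂ with
  | zero_left => rw [zero_lie, map_zero]
  | zero_right => rw [lie_zero, map_zero]
  | add_left x y z _ _ _ h1 h2 => rw [add_lie, map_add, h1, h2, add_zero]
  | add_right x y z _ _ _ h1 h2 => rw [lie_add, map_add, h1, h2, add_zero]
  | smul_left r x y _ _ h => rw [smul_lie, map_smul, h, smul_zero]
  | smul_right r x y _ _ h => rw [lie_smul, map_smul, h, smul_zero]
  | mem_mem x y hx hy =>
    rcases hy with ⟨n, y, hn, rfl⟩ | rfl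
    · rcases hx with ⟨m, x, hm, rfl⟩ | rfl
      · rw [lie_loopElt, map_add, hF _ _ (by omega), zero_add]
        split_ifs with h
        · rw [show m = 0 by omega]; simp
        · simp
      · rw [loopElt_lie_central, map_zero]
    · rw [lie_central, map_zero]

/-- The realization of `V(k,0)` on the enveloping algebra of the negative part. -/
theorem exists_realization (k : ℂ) :
    ∃ θ : VacuumModule B k →ₗ[ℂ] UniversalEnvelopingAlgebra ℂ (negPart B),
      θ (vacuum B k) = 1 ∧ ∀ (n : ℤ) (hn : n < 0) (x : 𝔤) (v : VacuumModule B k),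
        θ (modeEnd B k x n v) = ι ℂ (negElt B n hn x) * θ v := by
  let χ : Affine B →ₗ[ℂ] ℂ := affineLift B 0 k
  obtain ⟨τ, h1, h2⟩ := exists_induced_action (negPart B) (negProj B) χ (negProj_coe B)
    (fun y => by
      have : χ ∘ₗ (negPart B).toSubmodule.subtype = 0 :=
        negPart_ext B fun n hn x => affineLift_loopElt _ _ _ _
      exact LinearMap.congr_fun this y)
    (fun z w => lie_nonnegPart B (negProj B) (fun n x hn => negProj_loopElt_of_nonneg B hn x)
      (sub_negProj_mem B z) (sub_negProj_mem B w))
    (fun z w => lie_nonnegPart B χ (fun n x _ => affineLift_loopElt _ _ _ _)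
      (sub_negProj_mem B z) (sub_negProj_mem B w))
  let _ : LieRing (Module.End ℂ (UniversalEnvelopingAlgebra ℂ (negPart B))) := LieRing.ofAssociativeRing
  let T : UAff B →ₗ[ℂ] UniversalEnvelopingAlgebra ℂ (negPart B) :=
    LinearMap.applyₗ 1 ∘ₗ (lift ℂ τ).toLinearMap
  have hmul (u w : UAff B) : T (u * w) = lift ℂ τ u (T w) := by simp [T]
  have hT (u : UAff B) (hu : u ∈ vacuumIdeal B k) : T u = 0 := by
    induction hu using Submodule.span_induction with
    | zero => exact map_zero _
    | add x y _ _ hx hy => rw [map_add, hx, hy, add_zero]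
    | smul a x _ hx => rw [smul_eq_mul, hmul, hx, map_zero]
    | mem x hx =>
      rcases hx with ⟨y, n, hn, rfl⟩ | rfl
      · change lift ℂ τ (ι ℂ (loopElt B n y)) 1 = 0
        rw [lift_ι_apply, h2, negProj_loopElt_of_nonneg B hn, affineLift_loopElt]
        simp
      · change lift ℂ τ (ι ℂ (central B) - algebraMap ℂ _ k) 1 = 0
        rw [map_sub, lift_ι_apply, AlgHom.commutes, LinearMap.sub_apply, h2, negProj_central,
          affineLift_central, map_zero, zero_add, Algebra.algebraMap_eq_smul_one,
          Algebra.algebraMap_eq_smul_one]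
        exact sub_self _
  refine ⟨(((vacuumIdeal B k).restrictScalars ℂ).liftQ T hT) ∘ₗ
    (Submodule.Quotient.restrictScalarsEquiv ℂ (vacuumIdeal B k)).symm.toLinearMap, ?_,
    fun n hn x v => ?_⟩
  · change T 1 = 1
    simp [T]
  · obtain ⟨u, rfl⟩ := toVacuum_surjective B k v
    have h : modeEnd B k x n (toVacuum B k u) = toVacuum B k (ι ℂ (loopElt B n x) * u) :=
      (map_smul (toVacuum B k) _ u).symm
    rw [h]
    change T (ι ℂ (loopElt B n x) * u) = _ * T u
    rw [hmul, lift_ι_apply]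
    exact h1 (negElt B n hn x) _

end NegativePart
end Parafermion

/-! ### Embeddings of vacuum modules -/

namespace Parafermion
section Embedding
attribute [local instance 100] LieRing.ofAssociativeRing
open UniversalEnvelopingAlgebra

variable {𝔤 𝔤' : Type*} [LieRing 𝔤] [LieAlgebra ℂ 𝔤] [LieRing 𝔤'] [LieAlgebra ℂ 𝔤']
  {B : InvForm 𝔤} {B' : InvForm 𝔤'} {k k' : ℂ}

lemma affine_ext₂ {M : Type*} [AddCommGroup M] [Module ℂ M] {F G : Affine B →ₗ[ℂ] Affine B →ₗ[ℂ] M}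
    (h : ∀ m x n y, F (loopElt B m x) (loopElt B n y) = G (loopElt B m x) (loopElt B n y))
    (hl : ∀ z, F (central B) z = G (central B) z) (hr : ∀ z, F z (central B) = G z (central B)) :
    F = G :=
  affine_ext (fun m x => affine_ext (fun n y => h m x n y) (hr _)) (LinearMap.ext hl)

/-- The homomorphism of affine Lie algebras induced by a homomorphism that scales the form. -/
noncomputable def affineMap (i : 𝔤' →ₗ⁅ℂ⁆ 𝔤) (s : ℂ)
    (hi : ∀ x y, B.form (i x) (i y) = s * B'.form x y) : Affine B' →ₗ⁅ℂ⁆ Affine B :=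
  { affineLift B' (fun n => loopElt B n ∘ₗ i.toLinearMap) (s • central B) with
    map_lie' := fun {z w} => by
      let F := affineLift B' (fun n => loopElt B n ∘ₗ i.toLinearMap) (s • central B)
      have hF (n : ℤ) (x : 𝔤') : F (loopElt B' n x) = loopElt B n (i x) := affineLift_loopElt _ _ _ _
      have hFc : F (central B') = s • central B := affineLift_central _ _
      have h : (LieModule.toEnd ℂ (Affine B') (Affine B')).toLinearMap.compr₂ F =
          (LieModule.toEnd ℂ (Affine B) (Affine B)).toLinearMap.compl₁₂ F F := by
        refine affine_ext₂ (fun m x n y => ?_) (fun z => ?_) fun z => ?_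
        · change F ⁅loopElt B' m x, loopElt B' n y⁆ = ⁅F (loopElt B' m x), F (loopElt B' n y)⁆
          rw [lie_loopElt, map_add, map_smul, hF, hF, hF, hFc, lie_loopElt, LieHom.map_lie, hi,
            smul_smul]
          congr 2
          split_ifs <;> ring
        · change F ⁅central B', z⁆ = ⁅F (central B'), F z⁆
          rw [hFc, ← lie_skew, lie_central, smul_lie, ← lie_skew, lie_central]
          simp
        · change F ⁅z, central B'⁆ = ⁅F z, F (central B')⁆
          rw [hFc, lie_central, lie_smul, lie_central]
          simp
      exact LinearMap.congr_fun (LinearMap.congr_fun h z) w }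

section
variable (i : 𝔤' →ₗ⁅ℂ⁆ 𝔤) (s : ℂ) (hi : ∀ x y, B.form (i x) (i y) = s * B'.form x y)

lemma affineMap_loopElt (n : ℤ) (x : 𝔤') :
    affineMap i s hi (loopElt B' n x) = loopElt B n (i x) := affineLift_loopElt _ _ _ _

lemma affineMap_central : affineMap i s hi (central B') = s • central B := affineLift_central _ _

lemma affineMap_mem_negPart (z : Affine B') (hz : z ∈ negPart B') :
    affineMap i s hi z ∈ negPart B := by
  change z ∈ Submodule.span ℂ _ at hz
  induction hz using Submodule.span_induction with
  | zero => rw [map_zero]; exact zero_mem _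
  | add x y _ _ h1 h2 => rw [map_add]; exact add_mem h1 h2
  | smul c x _ h1 => rw [map_smul]; exact (negPart B).smul_mem c h1
  | mem x hx =>
    obtain ⟨n, x, hn, rfl⟩ := hx
    rw [affineMap_loopElt]
    exact loopElt_mem_negPart B hn _

/-- The restriction of `affineMap` to the negative parts. -/
noncomputable def negMap : negPart B' →ₗ⁅ℂ⁆ negPart B where
  toFun z := ⟨affineMap i s hi z, affineMap_mem_negPart i s hi z z.2⟩
  map_add' x y := Subtype.ext (map_add (affineMap i s hi) x.1 y.1)
  map_smul' c x := Subtype.ext (map_smul (affineMap i s hi) c x.1)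
  map_lie' {x y} := Subtype.ext (LieHom.map_lie (affineMap i s hi) x.1 y.1)

lemma negMap_negElt (n : ℤ) (hn : n < 0) (x : 𝔤') :
    negMap i s hi (negElt B' n hn x) = negElt B n hn (i x) :=
  Subtype.ext (affineMap_loopElt i s hi n x)

end

variable (B) in
/-- The derivation `t d/dt` of the affine Lie algebra. -/
noncomputable def degreeDer : Affine B →ₗ[ℂ] Affine B :=
  affineLift B (fun n => (n : ℂ) • loopElt B n) 0

lemma degreeDer_loopElt (n : ℤ) (x : 𝔤) :
    degreeDer B (loopElt B n x) = (n : ℂ) • loopElt B n x := affineLift_loopElt _ _ _ _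

lemma degreeDer_central : degreeDer B (central B) = 0 := affineLift_central _ _

/-- The derivation property, written as the `1`-cocycle condition with adjoint coefficients that
`ueaMap_injective` expects. The central term has degree zero and does not contribute. -/
lemma degreeDer_lie (z w : Affine B) :
    degreeDer B ⁅z, w⁆ = ⁅z, degreeDer B w⁆ - ⁅w, degreeDer B z⁆ := by
  have h : (LieModule.toEnd ℂ (Affine B) (Affine B)).toLinearMap.compr₂ (degreeDer B) =
      (LieModule.toEnd ℂ (Affine B) (Affine B)).toLinearMap.compl₁₂ LinearMap.id (degreeDer B) -
      ((LieModule.toEnd ℂ (Affine B) (Affine B)).toLinearMap.compl₁₂ LinearMap.id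
        (degreeDer B)).flip := by
    refine affine_ext₂ (fun m x n y => ?_) (fun z => ?_) fun z => ?_
    · change degreeDer B ⁅loopElt B m x, loopElt B n y⁆ =
        ⁅loopElt B m x, degreeDer B (loopElt B n y)⁆ - ⁅loopElt B n y, degreeDer B (loopElt B m x)⁆
      rw [degreeDer_loopElt, degreeDer_loopElt, lie_smul, lie_smul, ← lie_skew (loopElt B n y),
        smul_neg, sub_neg_eq_add, ← add_smul, lie_loopElt, map_add, map_smul, degreeDer_central,
        degreeDer_loopElt, smul_zero, add_zero]
      split_ifs with h
      · have h' : (n : ℂ) + m = 0 := by rw [add_comm]; exact_mod_cast h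
        rw [h', zero_smul, h, Int.cast_zero, zero_smul]
      · rw [zero_smul, add_zero, Int.cast_add, add_comm (n : ℂ)]
    · change degreeDer B ⁅central B, z⁆ = ⁅central B, degreeDer B z⁆ - ⁅z, degreeDer B (central B)⁆
      rw [degreeDer_central, lie_zero, ← lie_skew, lie_central, ← lie_skew, lie_central]
      simp
    · change degreeDer B ⁅z, central B⁆ = ⁅z, degreeDer B (central B)⁆ - ⁅central B, degreeDer B z⁆
      rw [degreeDer_central, lie_zero, lie_central, ← lie_skew, lie_central]
      simp
  exact LinearMap.congr_fun (LinearMap.congr_fun h z) w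

/-- The cocycle is `t d/dt`. It multiplies `x ⊗ t^n` by `n`, so it is injective on the negative
part, where `n ≠ 0`. -/
lemma ueaMap_negMap_injective (i : 𝔤' →ₗ⁅ℂ⁆ 𝔤) (s : ℂ)
    (hi : ∀ x y, B.form (i x) (i y) = s * B'.form x y) (hinj : Function.Injective i) :
    Function.Injective (ueaMap (negMap i s hi)) := by
  refine ueaMap_injective (negMap i s hi) (A := Affine B) (degreeDer B ∘ₗ (negPart B).toSubmodule.subtype)
    (fun x y => degreeDer_lie (x : Affine B) y) ?_
  obtain ⟨g, hg⟩ := LinearMap.exists_leftInverse_of_injective i.toLinearMap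
    (LinearMap.ker_eq_bot.2 hinj)
  let G : Affine B →ₗ[ℂ] Affine B' :=
    affineLift B (fun n => (n : ℂ)⁻¹ • (loopElt B' n ∘ₗ g)) 0
  have h : G ∘ₗ (degreeDer B ∘ₗ (negPart B).toSubmodule.subtype) ∘ₗ (negMap i s hi).toLinearMap =
      (negPart B').toSubmodule.subtype := by
    refine negPart_ext B' fun n hn x => ?_
    change G (degreeDer B (negMap i s hi (negElt B' n hn x))) = loopElt B' n x
    rw [negMap_negElt]
    change G (degreeDer B (loopElt B n (i x))) = loopElt B' n x
    rw [degreeDer_loopElt, map_smul, affineLift_loopElt]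
    have hn' : (n : ℂ) ≠ 0 := by exact_mod_cast hn.ne
    have hx : g (i x) = x := LinearMap.congr_fun hg x
    rw [LinearMap.smul_apply, smul_smul, mul_inv_cancel₀ hn', one_smul, LinearMap.comp_apply, hx]
  intro x y hxy
  have h2 (z) : G (degreeDer B (negMap i s hi z)) = (z : Affine B') := LinearMap.congr_fun h z
  refine Subtype.ext ?_
  rw [← h2 x, ← h2 y]
  exact congrArg G hxy

/-- The spanning half of PBW for the vacuum module. In the smallest subspace stable under negative
modes, an arbitrary mode moves to the right past a negative one at the cost of a single mode and a
scalar; hence the auxiliary `U` controls all modes of a vector simultaneously. -/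
lemma mem_of_negative_modes_stable (W : Submodule ℂ (VacuumModule B k)) (h1 : vacuum B k ∈ W)
    (hW : ∀ x (n : ℤ), n < 0 → ∀ v ∈ W, modeEnd B k x n v ∈ W) (v : VacuumModule B k) : v ∈ W := by
  let W₀ : Submodule ℂ (VacuumModule B k) :=
    sInf {U | vacuum B k ∈ U ∧ ∀ x (n : ℤ), n < 0 → ∀ v ∈ U, modeEnd B k x n v ∈ U}
  have hle (U : Submodule ℂ (VacuumModule B k)) (h1 : vacuum B k ∈ U)
      (h2 : ∀ x (n : ℤ), n < 0 → ∀ v ∈ U, modeEnd B k x n v ∈ U) : W₀ ≤ U := sInf_le ⟨h1, h2⟩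
  have hvac : vacuum B k ∈ W₀ := (Submodule.mem_sInf).2 fun U hU => hU.1
  have hneg (x) (n : ℤ) (hn : n < 0) (v) (hv : v ∈ W₀) : modeEnd B k x n v ∈ W₀ :=
    (Submodule.mem_sInf).2 fun U hU => hU.2 x n hn v (hle U hU.1 hU.2 hv)
  let U : Submodule ℂ (VacuumModule B k) :=
    { carrier := {v | v ∈ W₀ ∧ ∀ x n, modeEnd B k x n v ∈ W₀}
      add_mem' := fun ha hb => ⟨add_mem ha.1 hb.1, fun x n => by
        rw [map_add]; exact add_mem (ha.2 x n) (hb.2 x n)⟩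
      zero_mem' := ⟨zero_mem _, fun x n => by rw [map_zero]; exact zero_mem _⟩
      smul_mem' := fun c a ha => ⟨W₀.smul_mem c ha.1, fun x n => by
        rw [map_smul]; exact W₀.smul_mem c (ha.2 x n)⟩ }
  have hU : W₀ ≤ U := by
    refine hle U ⟨hvac, fun x n => ?_⟩ fun y m hm v hv => ⟨hneg y m hm v hv.1, fun x n => ?_⟩
    · rcases lt_or_ge n 0 with hn | hn
      · exact hneg x n hn _ hvac
      · rw [modeEnd_vacuum B k x n hn]; exact zero_mem _
    · rw [modeEnd_swap]
      exact add_mem (add_mem (hneg y m hm _ (hv.2 x n)) (hv.2 _ _)) (W₀.smul_mem _ hv.1)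
  exact hle W h1 hW (mem_of_modeEnd_stable B k W₀ hvac (fun x n v hv => (hU hv).2 x n) v)

/-- The realization on the enveloping algebra of the negative part is faithful. -/
lemma realization_injective (θ : VacuumModule B k →ₗ[ℂ] UniversalEnvelopingAlgebra ℂ (negPart B))
    (h1 : θ (vacuum B k) = 1) (h2 : ∀ (n : ℤ) (hn : n < 0) (x : 𝔤) (v : VacuumModule B k),
      θ (modeEnd B k x n v) = ι ℂ (negElt B n hn x) * θ v) : Function.Injective θ := by
  -- Acting on the vacuum is a left inverse of `θ`; negative modes suffice for the check.
  let σ : UniversalEnvelopingAlgebra ℂ (negPart B) →ₗ[ℂ] VacuumModule B k :=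
    ((toVacuum B k).restrictScalars ℂ) ∘ₗ (ueaMap (negPart B).incl).toLinearMap
  have hσ (v) : σ (θ v) = v := by
    refine mem_of_negative_modes_stable (LinearMap.eqLocus (σ ∘ₗ θ) LinearMap.id) ?_
      (fun x n hn v hv => ?_) v
    · change σ (θ (vacuum B k)) = vacuum B k
      rw [h1]
      change toVacuum B k (ueaMap _ 1) = toVacuum B k 1
      rw [map_one]
    · change σ (θ (modeEnd B k x n v)) = modeEnd B k x n v
      have hv' : σ (θ v) = v := hv
      rw [h2 n hn]
      change toVacuum B k (ueaMap _ (ι ℂ _ * θ v)) = _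
      rw [map_mul, ueaMap_ι, ← smul_eq_mul, map_smul]
      nth_rw 2 [← hv']
      rfl
  exact Function.LeftInverse.injective hσ

/-- An injective homomorphism of Lie algebras that multiplies the form by `s` induces an embedding
of the vacuum module of level `s * k` into the one of level `k`. -/
theorem exists_vacuum_embedding (i : 𝔤' →ₗ⁅ℂ⁆ 𝔤) (s : ℂ)
    (hi : ∀ x y, B.form (i x) (i y) = s * B'.form x y) (hinj : Function.Injective i)
    (hk : k' = s * k) :
    ∃ ψ : VacuumModule B' k' →ₗ[ℂ] VacuumModule B k, Function.Injective ψ ∧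
      ψ (vacuum B' k') = vacuum B k ∧
      ∀ x n v, ψ (modeEnd B' k' x n v) = modeEnd B k (i x) n (ψ v) := by
  let T : UAff B' →ₗ[ℂ] VacuumModule B k :=
    ((toVacuum B k).restrictScalars ℂ) ∘ₗ (ueaMap (affineMap i s hi)).toLinearMap
  have hmul (u w : UAff B') : T (u * w) = ueaMap (affineMap i s hi) u • T w := by
    change toVacuum B k (ueaMap _ (u * w)) = _ • toVacuum B k _
    rw [map_mul, ← smul_eq_mul, map_smul]
    rfl
  have hT (u : UAff B') (hu : u ∈ vacuumIdeal B' k') : T u = 0 := by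
    induction hu using Submodule.span_induction with
    | zero => exact map_zero _
    | add x y _ _ hx hy => rw [map_add, hx, hy, add_zero]
    | smul a x _ hx => rw [smul_eq_mul, hmul, hx, smul_zero]
    | mem x hx =>
      refine (toVacuum_eq_zero B k _).2 ?_
      change ueaMap _ x ∈ _
      rcases hx with ⟨y, n, hn, rfl⟩ | rfl
      · rw [ueaMap_ι, affineMap_loopElt]
        exact Ideal.subset_span (Or.inl ⟨_, n, hn, rfl⟩)
      · rw [map_sub, ueaMap_ι, affineMap_central, AlgHom.commutes, hk, map_smul, map_mul,
          ← Algebra.smul_def, ← smul_sub, Algebra.smul_def]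
        exact Ideal.mul_mem_left _ _ (Ideal.subset_span (Or.inr rfl))
  let ψ : VacuumModule B' k' →ₗ[ℂ] VacuumModule B k :=
    (((vacuumIdeal B' k').restrictScalars ℂ).liftQ T hT) ∘ₗ
      (Submodule.Quotient.restrictScalarsEquiv ℂ (vacuumIdeal B' k')).symm.toLinearMap
  have hψ1 : ψ (vacuum B' k') = vacuum B k := by
    change toVacuum B k (ueaMap _ 1) = toVacuum B k 1
    rw [map_one]
  have hψ (x n v) : ψ (modeEnd B' k' x n v) = modeEnd B k (i x) n (ψ v) := by
    obtain ⟨u, rfl⟩ := toVacuum_surjective B' k' v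
    have h : modeEnd B' k' x n (toVacuum B' k' u) = toVacuum B' k' (ι ℂ (loopElt B' n x) * u) :=
      (map_smul (toVacuum B' k') _ u).symm
    rw [h]
    change T (ι ℂ (loopElt B' n x) * u) = _
    rw [hmul, ueaMap_ι, affineMap_loopElt]
    rfl
  refine ⟨ψ, ?_, hψ1, hψ⟩
  obtain ⟨θ, hθ1, hθ⟩ := exists_realization B k
  obtain ⟨θ', hθ1', hθ'⟩ := exists_realization B' k'
  -- In the realizations `ψ` becomes the map of enveloping algebras of the negative parts, which is
  -- injective.
  have key (v) : θ (ψ v) = ueaMap (negMap i s hi) (θ' v) := by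
    refine mem_of_negative_modes_stable
      (LinearMap.eqLocus (θ ∘ₗ ψ) ((ueaMap (negMap i s hi)).toLinearMap ∘ₗ θ')) ?_
      (fun x n hn v hv => ?_) v
    · change θ (ψ (vacuum B' k')) = ueaMap _ (θ' _)
      rw [hψ1, hθ1, hθ1', map_one]
    · change θ (ψ (modeEnd B' k' x n v)) = ueaMap _ (θ' _)
      have hv' : θ (ψ v) = ueaMap (negMap i s hi) (θ' v) := hv
      rw [hψ, hθ n hn, hθ' n hn, hv', map_mul, ueaMap_ι, negMap_negElt]
  have hinj' : Function.Injective (θ ∘ ψ) := by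
    have : θ ∘ ψ = ueaMap (negMap i s hi) ∘ θ' := funext key
    rw [this]
    exact (ueaMap_negMap_injective i s hi hinj).comp (realization_injective θ' hθ1' hθ')
  exact hinj'.of_comp

variable {ψ : VacuumModule B' k' →ₗ[ℂ] VacuumModule B k} {i : 𝔤' → 𝔤}

lemma map_nProd_of_embedding (hψ : Function.Injective ψ) (h1 : ψ (vacuum B' k') = vacuum B k)
    (h2 : ∀ x n v, ψ (modeEnd B' k' x n v) = modeEnd B k (i x) n (ψ v))
    (u : VacuumModule B' k') (n : ℤ) (v : VacuumModule B' k') :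
    ψ (nProd B' k' u n v) = nProd B k (ψ u) n (ψ v) := by
  let W : Submodule ℂ (VacuumModule B' k') :=
    { carrier := {u | ∀ n v, ψ (nProd B' k' u n v) = nProd B k (ψ u) n (ψ v)}
      add_mem' := fun ha hb n v => by
        rw [nProd_add_left, map_add, map_add, ha, hb, nProd_add_left]
      zero_mem' := fun n v => by rw [nProd_zero_left, map_zero, nProd_zero_left]
      smul_mem' := fun c a ha n v => by
        rw [nProd_smul_left, map_smul, map_smul, ha, nProd_smul_left] }
  refine mem_of_modeEnd_stable B' k' W (fun n v => ?_) (fun x m u hu n v => ?_) u n v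
  · rw [h1, nProd_vacuum, nProd_vacuum]
    split_ifs <;> simp
  -- Injectivity of `ψ` preserves supports, so it commutes with `finsum` without a finiteness check.
  · have hfs (f : ℕ → VacuumModule B' k') : ψ (∑ᶠ j, f j) = ∑ᶠ j, ψ (f j) :=
      AddMonoidHom.map_finsum_of_injective ψ.toAddMonoidHom hψ f
    have hu' : ∀ n v, ψ (nProd B' k' u n v) = nProd B k (ψ u) n (ψ v) := hu
    rw [nProd_modeEnd, h2, nProd_modeEnd, map_sub, map_zsmul, hfs, hfs]
    simp_rw [map_zsmul, h2, hu', h2]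

lemma map_vertexClosure_of_embedding (hψ : Function.Injective ψ) (h1 : ψ (vacuum B' k') = vacuum B k)
    (h2 : ∀ x n v, ψ (modeEnd B' k' x n v) = modeEnd B k (i x) n (ψ v))
    (S : Set (VacuumModule B' k')) :
    (vertexClosure B' k' S).map ψ = vertexClosure B k (ψ '' S) := by
  have h3 := map_nProd_of_embedding hψ h1 h2
  refine le_antisymm ?_ (vertexClosure_le ⟨?_, ?_⟩ ?_)
  · rw [Submodule.map_le_iff_le_comap]
    have h := isVertexSubalgebra_vertexClosure (B := B) (k := k) (ψ '' S)
    refine vertexClosure_le ⟨?_, fun u hu v hv n => ?_⟩ fun s hs =>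
      subset_vertexClosure _ (Set.mem_image_of_mem ψ hs)
    · rw [Submodule.mem_comap, h1]
      exact h.vacuum_mem
    · rw [Submodule.mem_comap, h3]
      exact h.nProd_mem _ hu _ hv n
  · exact ⟨_, (isVertexSubalgebra_vertexClosure S).vacuum_mem, h1⟩
  · rintro _ ⟨u, hu, rfl⟩ _ ⟨v, hv, rfl⟩ n
    exact ⟨_, (isVertexSubalgebra_vertexClosure S).nProd_mem u hu v hv n, h3 u n v⟩
  · rintro _ ⟨s, hs, rfl⟩
    exact ⟨s, subset_vertexClosure S hs, rfl⟩

lemma map_omegaVec_of_embedding (h1 : ψ (vacuum B' k') = vacuum B k)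
    (h2 : ∀ x n v, ψ (modeEnd B' k' x n v) = modeEnd B k (i x) n (ψ v)) (κ : ℂ) (h e f : 𝔤') :
    ψ (omegaVec B' k' κ h e f) = omegaVec B k κ (i h) (i e) (i f) := by
  simp only [omegaVec, map_smul, map_add, map_sub, map_neg, h2, h1]

lemma map_wVec_of_embedding (h1 : ψ (vacuum B' k') = vacuum B k)
    (h2 : ∀ x n v, ψ (modeEnd B' k' x n v) = modeEnd B k (i x) n (ψ v)) (κ : ℂ) (h e f : 𝔤') :
    ψ (wVec B' k' κ h e f) = wVec B k κ (i h) (i e) (i f) := by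
  simp only [wVec, map_smul, map_add, map_sub, h2, h1]

end Embedding
end Parafermion

/-! ### The case of `sl₂` -/

namespace Parafermion
section SpecialLinear

lemma sl2_lie_h_e : ⁅sl2H, sl2E⁆ = (2 : ℂ) • sl2E := by
  refine Subtype.ext ?_
  rw [LieAlgebra.SpecialLinear.sl_bracket]
  ext a b
  fin_cases a <;> fin_cases b <;> norm_num [sl2H, sl2E, Matrix.mul_apply, Fin.sum_univ_two]

lemma sl2_lie_h_f : ⁅sl2H, sl2F⁆ = (-2 : ℂ) • sl2F := by
  refine Subtype.ext ?_
  rw [LieAlgebra.SpecialLinear.sl_bracket]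
  ext a b
  fin_cases a <;> fin_cases b <;> norm_num [sl2H, sl2F, Matrix.mul_apply, Fin.sum_univ_two]

lemma sl2_lie_e_f : ⁅sl2E, sl2F⁆ = sl2H := by
  refine Subtype.ext ?_
  rw [LieAlgebra.SpecialLinear.sl_bracket]
  ext a b
  fin_cases a <;> fin_cases b <;> norm_num [sl2H, sl2E, sl2F, Matrix.mul_apply, Fin.sum_univ_two]

lemma sl2Form_apply (x y : sl2) : sl2Form.form x y = (x.1 * y.1).trace := rfl

lemma isLevelTriple_sl2 (κ : ℂ) : IsLevelTriple sl2Form κ κ sl2H sl2E sl2F where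
  lie_h_e := sl2_lie_h_e
  lie_h_f := sl2_lie_h_f
  lie_e_f := sl2_lie_e_f
  form_h_h := by
    norm_num [sl2Form_apply, sl2H, Matrix.trace_fin_two]
  form_e_f := by norm_num [sl2Form_apply, sl2E, sl2F, Matrix.trace_fin_two]
  form_e_e := by norm_num [sl2Form_apply, sl2E, Matrix.trace_fin_two]
  form_f_f := by norm_num [sl2Form_apply, sl2F, Matrix.trace_fin_two]
  form_h_e := by norm_num [sl2Form_apply, sl2H, sl2E, Matrix.trace_fin_two]
  form_h_f := by norm_num [sl2Form_apply, sl2H, sl2F, Matrix.trace_fin_two]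

lemma sl2_eq (x : sl2) : x = x.1 0 0 • sl2H + x.1 0 1 • sl2E + x.1 1 0 • sl2F := by
  have hx : x.1 0 0 + x.1 1 1 = 0 := by
    have h : Matrix.trace x.1 = 0 := x.2
    rwa [Matrix.trace_fin_two] at h
  refine Subtype.ext ?_
  ext a b
  fin_cases a <;> fin_cases b <;>
    simp [sl2H, sl2E, sl2F]
  linear_combination hx

/-- The weight of `sl2E` on the Cartan subalgebra spanned by `sl2H`. -/
noncomputable def sl2Weight : Module.Dual ℂ (ℂ ∙ sl2H) where
  toFun h := 2 * (h : sl2).1 0 0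
  map_add' x y := by simp [mul_add]
  map_smul' c x := by simp; ring

lemma sl2_eq_of_mem {h : sl2} (hh : h ∈ ℂ ∙ sl2H) : h = h.1 0 0 • sl2H := by
  obtain ⟨c, rfl⟩ := Submodule.mem_span_singleton.1 hh
  congr 1
  simp [sl2H]

/-- The root vectors of `sl₂`. -/
noncomputable def sl2RootVectorSystem : RootVectorSystem sl2Form (ℂ ∙ sl2H) Bool where
  x i := if i then sl2E else sl2F
  neg i := !i
  wt i := if i then sl2Weight else -sl2Weight
  neg_neg i := by simp
  wt_neg i := by cases i <;> simp
  lie_toral x hx y hy := by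
    rw [sl2_eq_of_mem hx, sl2_eq_of_mem hy, lie_smul, smul_lie, lie_self, smul_zero, smul_zero]
  lie_x h i := by
    cases i
    · have e : ⁅(h : sl2), sl2F⁆ = (-sl2Weight) h • sl2F := by
        have h1 : sl2Weight h = 2 * (h : sl2).1 0 0 := rfl
        rw [sl2_eq_of_mem h.2, smul_lie, sl2_lie_h_f, smul_smul, LinearMap.neg_apply, h1]
        congr 1; ring
      exact e
    · have e : ⁅(h : sl2), sl2E⁆ = sl2Weight h • sl2E := by
        have h1 : sl2Weight h = 2 * (h : sl2).1 0 0 := rfl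
        rw [sl2_eq_of_mem h.2, smul_lie, sl2_lie_h_e, smul_smul, h1]
        congr 1; ring
      exact e
  span_eq_top := by
    refine eq_top_iff.2 fun x _ => ?_
    rw [sl2_eq x, add_assoc]
    refine Submodule.add_mem_sup (Submodule.smul_mem _ _ (Submodule.mem_span_singleton_self _))
      (add_mem (Submodule.smul_mem _ _ (Submodule.subset_span ⟨true, rfl⟩))
        (Submodule.smul_mem _ _ (Submodule.subset_span ⟨false, rfl⟩)))
  lie_x_x i j := by
    cases i <;> cases j
    · exact Or.inl (lie_self _)
    · refine Or.inr (Or.inl ⟨neg_add_cancel sl2Weight, ?_⟩)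
      change ⁅sl2F, sl2E⁆ ∈ _
      rw [← lie_skew, sl2_lie_e_f]
      exact neg_mem (Submodule.mem_span_singleton_self _)
    · refine Or.inr (Or.inl ⟨add_neg_cancel sl2Weight, ?_⟩)
      change ⁅sl2E, sl2F⁆ ∈ _
      rw [sl2_lie_e_f]
      exact Submodule.mem_span_singleton_self _
    · exact Or.inl (lie_self _)
  exists_pair i l hl := by
    by_cases h : (!i) ∈ l
    · exact ⟨_, h, Or.inl rfl⟩
    exfalso
    -- Without an opposite letter all letters equal `i`, and the total weight is a positive multiple
    -- of a nonzero one.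
    have hrep : l = List.replicate l.length i := List.eq_replicate_of_mem fun j hj => by
      by_contra hne
      exact h (by rwa [show (!i) = j by cases i <;> cases j <;> simp_all])
    rw [hrep, List.map_replicate, List.sum_replicate, ← succ_nsmul'] at hl
    have h0 : (if i then sl2Weight else -sl2Weight) = 0 :=
      (smul_eq_zero.1 hl).resolve_left (by omega)
    have h1 : sl2Weight = 0 := by cases i <;> simpa using h0
    have h2 := LinearMap.congr_fun h1 ⟨sl2H, Submodule.mem_span_singleton_self _⟩
    have h3 : (2 : ℂ) * sl2H.1 0 0 = 0 := h2
    simp [sl2H] at h3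

theorem vertexClosure_eq_parafermionSl2 (κ : ℂ) (hκ0 : κ ≠ 0) (hκ2 : κ + 2 ≠ 0)
    (hκ : ∀ m : ℕ, (κ + 1) * (m + 1) + 1 ≠ 0) :
    vertexClosure sl2Form κ {omegaVec sl2Form κ κ sl2H sl2E sl2F, wVec sl2Form κ κ sl2H sl2E sl2F} =
      parafermionSl2 κ := by
  rw [parafermionSl2, ← sl2RootVectorSystem.vertexClosure_eq_parafermion {true}
    (fun i => by cases i <;> simp [sl2RootVectorSystem]) (fun _ => sl2H) (fun _ => κ)
    (fun _ _ => Submodule.mem_span_singleton_self _)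
    (fun i hi => by
      obtain rfl : i = true := hi
      exact isLevelTriple_sl2 κ) (fun _ _ => hκ0) (fun _ _ => hκ2) (fun _ _ => hκ) hκ0
    -- Dual bases of the Cartan subalgebra, since `⟨h, h⟩ = 2`.
    (fun _ : Unit => sl2H) (fun _ => (1 / 2 : ℂ) • sl2H)
    (fun _ => Submodule.mem_span_singleton_self _)
    (fun _ => Submodule.smul_mem _ _ (Submodule.mem_span_singleton_self _)) ?_]
  · congr 1
    ext v
    constructor
    · exact fun h => ⟨true, rfl, h⟩
    · rintro ⟨i, hi, h⟩
      obtain rfl : i = true := hi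
      exact h
  · intro h hh
    obtain ⟨c, rfl⟩ := Submodule.mem_span_singleton.1 hh
    have h1 : sl2Form.form sl2H sl2H = 2 := by
      norm_num [sl2Form_apply, sl2H, Matrix.trace_fin_two]
    simp [h1]

/-- The term with `h(-2)` comes from reordering `f(-1)e(-1)𝟙`. -/
lemma conformalSl2_eq (κ : ℂ) (hκ0 : κ ≠ 0) (hκ2 : κ + 2 ≠ 0) :
    conformalSl2 κ = omegaVec sl2Form κ κ sl2H sl2E sl2F := by
  have h : modeEnd sl2Form κ sl2F (-1) (modeEnd sl2Form κ sl2E (-1) (vacuum sl2Form κ)) =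
      modeEnd sl2Form κ sl2E (-1) (modeEnd sl2Form κ sl2F (-1) (vacuum sl2Form κ)) -
        modeEnd sl2Form κ sl2H (-2) (vacuum sl2Form κ) := by
    rw [modeEnd_swap, ← lie_skew, sl2_lie_e_f, modeEnd_neg]
    norm_num
    abel
  rw [conformalSl2, omegaVec, h]
  match_scalars <;> field_simp <;> ring

end SpecialLinear
end Parafermion

/-! ### From a triple of level `κ` to the isomorphism with `N(sl₂, κ)` -/

namespace Parafermion
section LevelTriple

variable {𝔤 : Type*} [LieRing 𝔤] [LieAlgebra ℂ 𝔤] {B : InvForm 𝔤} {k κ : ℂ} {h e f : 𝔤}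

/-- The linear map from `sl₂` with prescribed values on the standard basis. -/
noncomputable def sl2Lift (h e f : 𝔤) : sl2 →ₗ[ℂ] 𝔤 where
  toFun x := x.1 0 0 • h + x.1 0 1 • e + x.1 1 0 • f
  map_add' x y := by
    change (x.1 0 0 + y.1 0 0) • h + (x.1 0 1 + y.1 0 1) • e + (x.1 1 0 + y.1 1 0) • f = _
    module
  map_smul' c x := by
    change (c * x.1 0 0) • h + (c * x.1 0 1) • e + (c * x.1 1 0) • f = c • _
    module

lemma sl2Lift_apply (h e f : 𝔤) (x : sl2) :
    sl2Lift h e f x = x.1 0 0 • h + x.1 0 1 • e + x.1 1 0 • f := rfl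

lemma sl2Lift_h (h e f : 𝔤) : sl2Lift h e f sl2H = h := by simp [sl2Lift_apply, sl2H]
lemma sl2Lift_e (h e f : 𝔤) : sl2Lift h e f sl2E = e := by simp [sl2Lift_apply, sl2E]
lemma sl2Lift_f (h e f : 𝔤) : sl2Lift h e f sl2F = f := by simp [sl2Lift_apply, sl2F]

namespace IsLevelTriple

/-- The homomorphism from `sl₂` given by a triple. -/
noncomputable def sl2Hom (T : IsLevelTriple B k κ h e f) : sl2 →ₗ⁅ℂ⁆ 𝔤 :=
  { sl2Lift h e f with
    map_lie' := fun {x y} => by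
      change sl2Lift h e f ⁅x, y⁆ = ⁅sl2Lift h e f x, sl2Lift h e f y⁆
      have h1 : ⁅e, h⁆ = (-2 : ℂ) • e := by rw [← lie_skew, T.lie_h_e, neg_smul]
      have h2 : ⁅f, h⁆ = (2 : ℂ) • f := by rw [← lie_skew, T.lie_h_f, neg_smul, neg_neg]
      have h3 : ⁅f, e⁆ = -h := by rw [← lie_skew, T.lie_e_f]
      have hx : x.1 0 0 + x.1 1 1 = 0 := by
        have h : Matrix.trace x.1 = 0 := x.2
        rwa [Matrix.trace_fin_two] at h
      have hy : y.1 0 0 + y.1 1 1 = 0 := by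
        have h : Matrix.trace y.1 = 0 := y.2
        rwa [Matrix.trace_fin_two] at h
      rw [sl2Lift_apply, LieAlgebra.SpecialLinear.sl_bracket, sl2Lift_apply, sl2Lift_apply]
      simp only [lie_add, add_lie, smul_lie, lie_smul, lie_self, T.lie_h_e, T.lie_h_f, T.lie_e_f,
        h1, h2, h3, Matrix.sub_apply, Matrix.mul_apply, Fin.sum_univ_two,
        eq_neg_of_add_eq_zero_right hx, eq_neg_of_add_eq_zero_right hy]
      module }

variable (T : IsLevelTriple B k κ h e f)
include T

lemma form_sl2Hom (hk : k ≠ 0) (x y : sl2) :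
    B.form (T.sl2Hom x) (T.sl2Hom y) = κ / k * sl2Form.form x y := by
  change B.form (sl2Lift h e f x) (sl2Lift h e f y) = _
  have h1 : B.form e h = 0 := by rw [← B.symm.eq, T.form_h_e]
  have h2 : B.form f h = 0 := by rw [← B.symm.eq, T.form_h_f]
  have h3 : B.form f e = κ / k := by
    rw [← B.symm.eq, eq_div_iff hk, T.form_e_f]
  have h4 : B.form e f = κ / k := by rw [eq_div_iff hk, T.form_e_f]
  have h5 : B.form h h = κ / k * 2 := by
    have := T.form_h_h
    field_simp
    linear_combination this
  have hx : x.1 0 0 + x.1 1 1 = 0 := by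
    have h : Matrix.trace x.1 = 0 := x.2
    rwa [Matrix.trace_fin_two] at h
  have hy : y.1 0 0 + y.1 1 1 = 0 := by
    have h : Matrix.trace y.1 = 0 := y.2
    rwa [Matrix.trace_fin_two] at h
  rw [sl2Lift_apply, sl2Lift_apply, sl2Form_apply, Matrix.trace_fin_two, Matrix.mul_apply,
    Matrix.mul_apply, Fin.sum_univ_two, Fin.sum_univ_two, eq_neg_of_add_eq_zero_right hx,
    eq_neg_of_add_eq_zero_right hy]
  simp only [map_add, map_smul, LinearMap.add_apply, LinearMap.smul_apply, smul_eq_mul, h1, h2, h3,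
    h4, h5, T.form_e_e, T.form_f_f, T.form_h_e, T.form_h_f]
  ring

/-- The form pulls back to a nonzero multiple of the trace form, which is nondegenerate. -/
lemma sl2Hom_injective (hk : k ≠ 0) (hκ : κ ≠ 0) : Function.Injective T.sl2Hom := by
  rw [injective_iff_map_eq_zero]
  intro x hx
  have hκk : κ / k ≠ 0 := div_ne_zero hκ hk
  have key (y : sl2) : sl2Form.form x y = 0 := by
    have := T.form_sl2Hom hk x y
    rw [hx, map_zero, LinearMap.zero_apply] at this
    exact (mul_eq_zero.1 this.symm).resolve_left hκk
  have h1 := key sl2H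
  have h2 := key sl2E
  have h3 := key sl2F
  have hx : x.1 0 0 + x.1 1 1 = 0 := by
    have h : Matrix.trace x.1 = 0 := x.2
    rwa [Matrix.trace_fin_two] at h
  simp [sl2Form_apply, Matrix.trace_fin_two, Matrix.mul_apply, Fin.sum_univ_two, sl2H, sl2E,
    sl2F] at h1 h2 h3
  rw [sl2_eq x, h2, h3, show x.1 0 0 = 0 by linear_combination (h1 + hx) / 2]
  simp

/-- The vertex subalgebra generated by `ω` and `W³` of a triple of level `κ` is isomorphic to
`N(sl₂, κ)`. -/
theorem exists_isVOAIso (hk : k ≠ 0) (hκ0 : κ ≠ 0) (hκ2 : κ + 2 ≠ 0)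
    (hκ : ∀ m : ℕ, (κ + 1) * (m + 1) + 1 ≠ 0) :
    ∃ φ : vertexClosure B k {omegaVec B k κ h e f, wVec B k κ h e f} ≃ₗ[ℂ] parafermionSl2 κ,
      IsVOAIso φ (omegaVec B k κ h e f) (conformalSl2 κ) := by
  obtain ⟨ψ, hψ, h1, h2⟩ := exists_vacuum_embedding (k := k) (k' := κ) T.sl2Hom (κ / k)
    (T.form_sl2Hom hk) (T.sl2Hom_injective hk hκ0) (div_mul_cancel₀ κ hk).symm
  have eh : T.sl2Hom sl2H = h := sl2Lift_h h e f
  have ee : T.sl2Hom sl2E = e := sl2Lift_e h e f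
  have ef : T.sl2Hom sl2F = f := sl2Lift_f h e f
  have hω : ψ (omegaVec sl2Form κ κ sl2H sl2E sl2F) = omegaVec B k κ h e f := by
    rw [map_omegaVec_of_embedding h1 h2, eh, ee, ef]
  have hw : ψ (wVec sl2Form κ κ sl2H sl2E sl2F) = wVec B k κ h e f := by
    rw [map_wVec_of_embedding h1 h2, eh, ee, ef]
  -- Here the generation theorem for `sl₂` enters; without it the image of `N(sl₂, κ)` could be
  -- larger than the subalgebra generated by `ω` and `W³`.
  have hmap : (parafermionSl2 κ).map ψ =
      vertexClosure B k {omegaVec B k κ h e f, wVec B k κ h e f} := by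
    rw [← vertexClosure_eq_parafermionSl2 κ hκ0 hκ2 hκ, map_vertexClosure_of_embedding hψ h1 h2,
      Set.image_pair, hω, hw]
  let Φ : parafermionSl2 κ ≃ₗ[ℂ] vertexClosure B k {omegaVec B k κ h e f, wVec B k κ h e f} :=
    (Submodule.equivMapOfInjective ψ hψ _).trans (LinearEquiv.ofEq _ _ hmap)
  have hΦ (v : parafermionSl2 κ) : (Φ v : VacuumModule B k) = ψ v := rfl
  have hsymm (u : VacuumModule B k) (hu) (v : VacuumModule sl2Form κ) (huv : ψ v = u) :
      (Φ.symm ⟨u, hu⟩ : VacuumModule sl2Form κ) = v := by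
    refine hψ ?_
    rw [← hΦ, LinearEquiv.apply_symm_apply, huv]
  have hV := isVertexSubalgebra_vertexClosure (B := B) (k := k)
    {omegaVec B k κ h e f, wVec B k κ h e f}
  refine ⟨Φ.symm, ⟨hV.vacuum_mem, hsymm _ _ _ h1⟩, fun u v n => ⟨hV.nProd_mem u u.2 v v.2 n,
    hsymm _ _ _ ?_⟩, ⟨subset_vertexClosure _ (Or.inl rfl), hsymm _ _ _ ?_⟩⟩
  · rw [map_nProd_of_embedding hψ h1 h2, ← hΦ, ← hΦ, LinearEquiv.apply_symm_apply,
      LinearEquiv.apply_symm_apply]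
  · rw [conformalSl2_eq κ hκ0 hκ2, hω]

end IsLevelTriple
end LevelTriple
end Parafermion

/-! ### Invariant forms on a simple Lie algebra and root lengths -/

namespace Parafermion
section SimpleForm
open LieAlgebra LieAlgebra.IsKilling LieModule

variable {𝔤 : Type*} [LieRing 𝔤] [LieAlgebra ℂ 𝔤] [FiniteDimensional ℂ 𝔤] [IsSimple ℂ 𝔤]
  {B : InvForm 𝔤} {H : LieSubalgebra ℂ 𝔤} [H.IsCartanSubalgebra]

/-- Invariant forms on a simple Lie algebra are multiples of the Killing form. -/
lemma exists_eq_smul_killingForm (B : InvForm 𝔤) :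
    ∃ c : ℂ, ∀ x y, B.form x y = c * killingForm ℂ 𝔤 x y := by
  have : Nontrivial 𝔤 := IsSimple.nontrivial ℂ 𝔤
  have hK := killingForm_nondegenerate ℂ 𝔤
  -- Schur's lemma: `T` compares the two forms and commutes with the adjoint action, so one of its
  -- eigenspaces is a nonzero ideal, hence everything.
  let T : 𝔤 →ₗ[ℂ] 𝔤 := ((killingForm ℂ 𝔤).toDual hK).symm.toLinearMap ∘ₗ B.form
  have hT (x y : 𝔤) : killingForm ℂ 𝔤 (T x) y = B.form x y := by
    rw [← LinearMap.BilinForm.toDual_def hK]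
    exact LinearMap.congr_fun (((killingForm ℂ 𝔤).toDual hK).apply_symm_apply (B.form x)) y
  have hlie (z x : 𝔤) : T ⁅z, x⁆ = ⁅z, T x⁆ := by
    refine ((killingForm ℂ 𝔤).toDual hK).injective (LinearMap.ext fun y => ?_)
    rw [LinearMap.BilinForm.toDual_def, LinearMap.BilinForm.toDual_def, hT,
      traceForm_lieInvariant ℂ 𝔤 𝔤 z, hT]
    exact B.invariant z x y
  obtain ⟨c, hc⟩ := Module.End.exists_eigenvalue T
  let I : LieIdeal ℂ 𝔤 :=
    { Module.End.eigenspace T c with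
      lie_mem := fun {z x} hx => by
        have hx' : T x = c • x := Module.End.mem_eigenspace_iff.1 hx
        exact Module.End.mem_eigenspace_iff.2 (by rw [hlie, hx', lie_smul]) }
  have hI : I ≠ ⊥ := fun h => hc ((LieSubmodule.toSubmodule_eq_bot I).2 h)
  have htop := (IsSimple.eq_bot_or_eq_top I).resolve_left hI
  refine ⟨c, fun x y => ?_⟩
  have hx : x ∈ I := htop ▸ LieSubmodule.mem_top x
  have hx' : T x = c • x := Module.End.mem_eigenspace_iff.1 hx
  rw [← hT, hx', map_smul, LinearMap.smul_apply, smul_eq_mul]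

variable {c : ℂ}

lemma killingForm_cartanEquivDual_symm (φ : Module.Dual ℂ H) (h : H) :
    killingForm ℂ 𝔤 ((cartanEquivDual H).symm φ) h = φ h :=
  LinearMap.congr_fun ((cartanEquivDual H).apply_symm_apply φ) h

lemma rootVec_eq (hc0 : c ≠ 0) (hc : ∀ x y, B.form x y = c * killingForm ℂ 𝔤 x y) (α : H.root) :
    rootVec B H α = c⁻¹ • (cartanEquivDual H).symm α.1.toLinear := by
  -- Injectivity ensures that `Function.invFun` in `rootVec` returns the intended preimage.
  have hinj : Function.Injective (fun t h : H => B.form t h) := fun s t hst => by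
    refine (cartanEquivDual H).injective (LinearMap.ext fun h => mul_left_cancel₀ hc0 ?_)
    have := congrFun hst h
    simp only [hc] at this
    exact this
  have h : (α.1 : H → ℂ) = (fun t h : H => B.form t h) (c⁻¹ • (cartanEquivDual H).symm α.1.toLinear) := by
    funext h
    change α.1 h = B.form ((c⁻¹ • (cartanEquivDual H).symm α.1.toLinear : H) : 𝔤) h
    rw [hc]
    change _ = c * killingForm ℂ 𝔤 (c⁻¹ • ((cartanEquivDual H).symm α.1.toLinear : 𝔤)) h
    rw [map_smul, LinearMap.smul_apply, killingForm_cartanEquivDual_symm, smul_eq_mul,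
      mul_inv_cancel_left₀ hc0]
    rfl
  rw [rootVec, h]
  exact Function.leftInverse_invFun hinj _

lemma rootNormSq_eq (hc0 : c ≠ 0) (hc : ∀ x y, B.form x y = c * killingForm ℂ 𝔤 x y) (α : H.root) :
    rootNormSq B H α = c⁻¹ * α.1 ((cartanEquivDual H).symm α.1.toLinear) := by
  rw [rootNormSq, rootVec_eq hc0 hc, hc]
  change c * killingForm ℂ 𝔤 (c⁻¹ • ((cartanEquivDual H).symm α.1.toLinear : 𝔤))
    (c⁻¹ • ((cartanEquivDual H).symm α.1.toLinear : 𝔤)) = _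
  rw [map_smul, map_smul, LinearMap.smul_apply, killingForm_cartanEquivDual_symm, smul_eq_mul,
    smul_eq_mul, mul_inv_cancel_left₀ hc0]
  rfl

/-- The square length of a root for the Killing form is `4 / N` for some positive integer `N`. -/
lemma exists_root_apply_mul_eq_four (α : H.root) :
    ∃ N : ℕ, 0 < N ∧ α.1 ((cartanEquivDual H).symm α.1.toLinear) * N = 4 := by
  set t := (cartanEquivDual H).symm α.1.toLinear with ht
  have hn : α.1 t ≠ 0 := root_apply_cartanEquivDual_symm_ne_zero (H.isNonZero_coe_root α)
  have hcor (β : H.root) : ∃ n : ℤ, 2 * β.1 t = α.1 t * n := by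
    refine ⟨chainBotCoeff α.1 β.1 - chainTopCoeff α.1 β.1, ?_⟩
    have h1 := apply_coroot_eq_cast α.1 β.1
    rw [coroot, ← ht, ← Weight.toLinear_apply, map_nsmul, map_smul, Weight.toLinear_apply] at h1
    push_cast at h1
    push_cast
    rw [← h1]
    simp only [smul_eq_mul, nsmul_eq_mul]
    field_simp
    push_cast; ring
  choose n hn' using hcor
  -- On `H` the Killing form is the sum of the squares of the roots. Substituting `2 β(t) = α(t)
  -- n_β` gives `4 α(t) = α(t)² ∑ n_β²`, so `N` is the sum of the squares of the integers `n_β`.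
  have hsum : α.1 t = ∑ β : H.root, β.1 t * β.1 t := by
    have h := LinearMap.congr_fun (LinearMap.congr_fun (restrict_killingForm_eq_sum (H := H)) t) t
    rw [LinearMap.BilinForm.restrict_apply] at h
    have h' := killingForm_cartanEquivDual_symm α.1.toLinear t
    rw [← ht] at h'
    rw [LinearMap.domRestrict_apply] at h
    simp only [LinearMap.sum_apply, LinearMap.smulRight_apply] at h
    rw [← Finset.sum_coe_sort] at h
    exact h'.symm.trans h
  have h4 : α.1 t * ((∑ β, (n β) ^ 2 : ℤ) : ℂ) = 4 := by
    have h5 : 4 * α.1 t = α.1 t * (α.1 t * ((∑ β, (n β) ^ 2 : ℤ) : ℂ)) := by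
      nth_rw 1 [hsum]
      push_cast
      rw [Finset.mul_sum, Finset.mul_sum, Finset.mul_sum]
      refine Finset.sum_congr rfl fun β _ => ?_
      linear_combination (2 * β.1 t + α.1 t * n β) * hn' β
    exact mul_left_cancel₀ hn (by rw [← h5, mul_comm])
  have hnn : 0 ≤ ∑ β, (n β) ^ 2 := Finset.sum_nonneg fun β _ => sq_nonneg _
  obtain ⟨N, hN⟩ := Int.eq_ofNat_of_zero_le hnn
  rw [hN] at h4
  refine ⟨N, Nat.pos_of_ne_zero fun h0 => ?_, by exact_mod_cast h4⟩
  rw [h0] at h4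
  norm_num at h4

section Normalized
variable (hB : IsNormalized B H)
include hB

lemma IsNormalized.exists_eq_smul_killingForm :
    ∃ c : ℂ, c ≠ 0 ∧ ∀ x y, B.form x y = c * killingForm ℂ 𝔤 x y := by
  obtain ⟨c, hc⟩ := Parafermion.exists_eq_smul_killingForm B
  refine ⟨c, fun h0 => ?_, hc⟩
  have : Nontrivial 𝔤 := IsSimple.nontrivial ℂ 𝔤
  obtain ⟨x, hx⟩ := exists_ne (0 : 𝔤)
  exact hx (hB.nondegenerate.1 x fun y => by rw [hc, h0, zero_mul])

/-- For `B` equal to `c` times the Killing form, all square lengths are `c⁻¹ * 4 / N`. A root `β` of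
maximal length exists and has square length `2`, which fixes `c⁻¹ = N_β / 2`. The resulting
positivity of every `k_α` supplies all nonvanishing conditions of the generation theorem. -/
lemma IsNormalized.rootNormSq_pos (α : H.root) : ∃ r : ℝ, 0 < r ∧ rootNormSq B H α = r := by
  obtain ⟨c, hc0, hc⟩ := hB.exists_eq_smul_killingForm
  choose N hN hN4 using exists_root_apply_mul_eq_four (H := H)
  have : Nonempty H.root := ⟨α⟩
  obtain ⟨β, hβ⟩ := Finite.exists_max fun β : H.root => ‖rootNormSq B H β‖
  have h2 := hB.long_root β hβ
  have hq (γ : H.root) : rootNormSq B H γ = c⁻¹ * (4 / N γ) := by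
    have : (N γ : ℂ) ≠ 0 := by exact_mod_cast (hN γ).ne'
    rw [rootNormSq_eq hc0 hc, ← hN4 γ]
    field_simp
  rw [hq] at h2
  have hβ0 : (N β : ℂ) ≠ 0 := by exact_mod_cast (hN β).ne'
  have hα0 : (N α : ℂ) ≠ 0 := by exact_mod_cast (hN α).ne'
  have hα1 : (0 : ℝ) < N α := by exact_mod_cast hN α
  have hβ1 : (0 : ℝ) < N β := by exact_mod_cast hN β
  refine ⟨2 * N β / N α, by positivity, ?_⟩
  have hc' : c⁻¹ = N β / 2 := by
    field_simp at h2 ⊢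
    linear_combination (1 / 2) * h2
  rw [hq, hc']
  push_cast
  field_simp
  ring

lemma IsNormalized.rootLevel_pos (α : H.root) {k : ℕ} (hk : 1 ≤ k) :
    ∃ r : ℝ, 0 < r ∧ rootLevel B H k α = r := by
  obtain ⟨r, hr, h⟩ := hB.rootNormSq_pos α
  have hk' : (0 : ℝ) < k := by exact_mod_cast hk
  refine ⟨2 / r * k, by positivity, ?_⟩
  rw [rootLevel, h]
  push_cast
  rfl

lemma IsNormalized.form_coroot (α : H.root) (h : H) :
    B.form (coroot α.1) h = 2 / rootNormSq B H α * α.1 h := by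
  obtain ⟨c, hc0, hc⟩ := hB.exists_eq_smul_killingForm
  have h1 : killingForm ℂ 𝔤 (coroot α.1) h =
      2 * (α.1 ((cartanEquivDual H).symm α.1.toLinear))⁻¹ * α.1 h := by
    have h2 : killingForm ℂ 𝔤 (coroot α.1) h = _ := traceForm_coroot α.1 h
    rw [h2, nsmul_eq_mul, smul_eq_mul, Nat.cast_ofNat, mul_assoc]
  rw [hc, h1, rootNormSq_eq hc0 hc]
  field_simp

lemma IsNormalized.form_root_vectors (α : H.root) {e f : 𝔤} (he : e ∈ rootSpace H α.1)
    (hf : f ∈ rootSpace H (-α.1)) (hef : ⁅e, f⁆ = (coroot α.1 : 𝔤)) :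
    B.form e f = 2 / rootNormSq B H α := by
  obtain ⟨c, hc0, hc⟩ := hB.exists_eq_smul_killingForm
  have h1 := lie_eq_killingForm_smul_of_mem_rootSpace_of_mem_rootSpace_neg he hf
  have hn := root_apply_cartanEquivDual_symm_ne_zero (H.isNonZero_coe_root α)
  have h2 : coroot α.1 = killingForm ℂ 𝔤 e f • (cartanEquivDual H).symm α.1.toLinear :=
    Subtype.ext (hef.symm.trans h1)
  have h3 := congrArg α.1.toLinear h2
  rw [map_smul, Weight.toLinear_apply, Weight.toLinear_apply,
    root_apply_coroot (H.isNonZero_coe_root α), smul_eq_mul] at h3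
  rw [rootNormSq_eq hc0 hc, hc, h3]
  field_simp

end Normalized
end SimpleForm
end Parafermion

/-! ### Root vectors of a simple Lie algebra form a root vector system -/

namespace Parafermion
section RootVectors
open LieAlgebra LieAlgebra.IsKilling LieModule

variable {𝔤 : Type*} [LieRing 𝔤] [LieAlgebra ℂ 𝔤] [FiniteDimensional ℂ 𝔤] [IsSimple ℂ 𝔤]
  {B : InvForm 𝔤} {H : LieSubalgebra ℂ 𝔤} [H.IsCartanSubalgebra]

lemma exists_eq_smul_of_mem_rootSpace {α : Weight ℂ H 𝔤} (hα : α.IsNonZero) {x y : 𝔤}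
    (hx : x ∈ rootSpace H α) (hx0 : x ≠ 0) (hy : y ∈ rootSpace H α) : ∃ c : ℂ, y = c • x := by
  have h0 : (⟨x, hx⟩ : rootSpace H α) ≠ 0 := fun h => hx0 (congrArg Subtype.val h)
  obtain ⟨c, hc⟩ := (finrank_eq_one_iff_of_nonzero' _ h0).1 (finrank_rootSpace_eq_one α hα) ⟨y, hy⟩
  exact ⟨c, (congrArg Subtype.val hc).symm⟩

/-- If the bracket vanished, `y` would be a primitive vector for the `sl₂`-triple of `α`, and the
weight of such a vector in a finite-dimensional module is a natural number. -/
lemma lie_ne_zero_of_apply_coroot_neg {α : Weight ℂ H 𝔤} (hα : α.IsNonZero) {χ : H → ℂ} {x y : 𝔤}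
    (hx : x ∈ rootSpace H α) (hx0 : x ≠ 0) (hy : y ∈ rootSpace H χ) (hy0 : y ≠ 0)
    (hχ : ∀ n : ℕ, χ (coroot α) ≠ n) : ⁅x, y⁆ ≠ 0 := by
  intro h0
  obtain ⟨h, e, f, t, he, hf⟩ := exists_isSl2Triple_of_weight_isNonZero hα
  obtain ⟨c, rfl⟩ := exists_eq_smul_of_mem_rootSpace hα hx hx0 he
  have hh := t.h_eq_coroot hα he hf
  have P : t.HasPrimitiveVectorWith y (χ (coroot α)) :=
    ⟨hy0, by rw [hh]; exact lie_eq_smul_of_mem_rootSpace hy (coroot α), by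
      rw [smul_lie, h0, smul_zero]⟩
  obtain ⟨n, hn⟩ := P.exists_nat
  exact hχ n hn

/-- As the root spaces are lines, a vanishing pairing would put `x` into the radical of the Killing
form. -/
lemma killingForm_root_ne_zero {α : Weight ℂ H 𝔤} (hα : α.IsNonZero) {x y : 𝔤}
    (hx : x ∈ rootSpace H α) (hx0 : x ≠ 0) (hy : y ∈ rootSpace H (-α : Weight ℂ H 𝔤)) (hy0 : y ≠ 0) :
    killingForm ℂ 𝔤 x y ≠ 0 := by
  intro h0
  have h := mem_ker_killingForm_of_mem_rootSpace_of_forall_rootSpace_neg ℂ 𝔤 H hx fun z hz => by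
    obtain ⟨c, rfl⟩ := exists_eq_smul_of_mem_rootSpace hα.neg hy hy0
      (by rw [Weight.coe_neg]; exact hz)
    rw [map_smul, h0, smul_zero]
  rw [IsKilling.ker_killingForm_eq_bot] at h
  exact hx0 h

variable (H) in
/-- The negative of a root. -/
noncomputable def negRoot (α : H.root) : H.root :=
  ⟨-α.1, by simpa using H.isNonZero_coe_root α⟩

lemma negRoot_negRoot (α : H.root) : negRoot H (negRoot H α) = α :=
  Subtype.ext (neg_neg α.1)

lemma negRoot_eq (α : H.root) : negRoot H α = (rootSystem H).reflectionPerm α α := by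
  refine (rootSystem H).root.injective ?_
  rw [RootPairing.root_reflectionPerm, RootPairing.reflection_apply_self]
  rfl

lemma isPos_or_negRoot (b : (rootSystem H).Base) (α : H.root) :
    b.IsPos α ∨ b.IsPos (negRoot H α) := by
  rw [negRoot_eq]
  exact RootPairing.Base.IsPos.or_neg b α

lemma isPos_negRoot_iff (b : (rootSystem H).Base) (α : H.root) :
    b.IsPos (negRoot H α) ↔ ¬ b.IsPos α := by
  rw [negRoot_eq]
  exact RootPairing.Base.IsPos.neg_iff_not b α

omit [IsSimple ℂ 𝔤] in
lemma iSup_rootSpace_eq_top : (⨆ α : Weight ℂ H 𝔤, (rootSpace H α).toSubmodule) = ⊤ := by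
  rw [← LieSubmodule.iSup_toSubmodule, iSup_genWeightSpace_eq_top' ℂ H 𝔤]
  rfl

omit [IsSimple ℂ 𝔤] in
lemma mem_of_mem_rootSpace_zero {x : 𝔤} (hx : x ∈ rootSpace H (0 : H → ℂ)) : x ∈ H := by
  rwa [rootSpace_zero_eq ℂ 𝔤 H] at hx

section System
variable (x : H.root → 𝔤) (hx : ∀ α, x α ∈ rootSpace H α.1) (hx0 : ∀ α, x α ≠ 0)
include hx hx0

lemma sup_span_rootVectors_eq_top : H.toSubmodule ⊔ Submodule.span ℂ (Set.range x) = ⊤ := by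
  rw [eq_top_iff, ← iSup_rootSpace_eq_top (H := H)]
  refine iSup_le fun α y hy => ?_
  by_cases hα : α.IsZero
  · refine Submodule.mem_sup_left (mem_of_mem_rootSpace_zero ?_)
    have h : (α : H → ℂ) = 0 := hα
    rwa [h] at hy
  · have hα' : α ∈ H.root := by simpa using hα
    obtain ⟨c, rfl⟩ := exists_eq_smul_of_mem_rootSpace hα (hx ⟨α, hα'⟩) (hx0 _) hy
    exact Submodule.mem_sup_right (Submodule.smul_mem _ _ (Submodule.subset_span ⟨_, rfl⟩))

lemma exists_root_eq_of_mem_rootSpace {χ : H → ℂ} (hχ : χ ≠ 0) {y : 𝔤} (hy : y ∈ rootSpace H χ)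
    (hy0 : y ≠ 0) : ∃ (γ : H.root) (c : ℂ), (γ.1 : H → ℂ) = χ ∧ y = c • x γ := by
  have hne : rootSpace H χ ≠ ⊥ := fun h => hy0 (by rwa [h, LieSubmodule.mem_bot] at hy)
  let γ : Weight ℂ H 𝔤 := ⟨χ, hne⟩
  have hγ : γ.IsNonZero := hχ
  have hγ' : γ ∈ H.root := by simpa using hγ
  obtain ⟨c, hc⟩ := exists_eq_smul_of_mem_rootSpace hγ (hx ⟨γ, hγ'⟩) (hx0 _) hy
  exact ⟨⟨γ, hγ'⟩, c, rfl, hc⟩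

/-- The hypothesis on the coroot makes `⁅x_{-α}, x_{-β}⁆` nonzero, so `-(α+β)` is a root and `γ = α
+ β`. The form vanishes on `x_{-α}`, `x_γ` because their weights add up to `β ≠ 0`. -/
lemma exists_add_root {α β : H.root} (hne : β ≠ negRoot H α)
    (hαβ : ∀ n : ℕ, β.1 (coroot α.1) ≠ n) :
    ∃ (γ : H.root) (c : ℂ), c ≠ 0 ∧ γ.1.toLinear = α.1.toLinear + β.1.toLinear ∧
      ⁅x (negRoot H α), x γ⁆ = c • x β ∧ killingForm ℂ 𝔤 (x (negRoot H α)) (x γ) = 0 := by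
  have hα := H.isNonZero_coe_root α
  have hβ := H.isNonZero_coe_root β
  have hsum : (-(α.1 : H → ℂ) + -(β.1 : H → ℂ)) ≠ 0 := fun h0 => hne (Subtype.ext (by
    refine Weight.ext fun z => ?_
    have := congrFun h0 z
    change β.1 z = -α.1 z
    simp only [Pi.add_apply, Pi.neg_apply, Pi.zero_apply] at this
    linear_combination -this))
  have h1 : ⁅x (negRoot H α), x (negRoot H β)⁆ ≠ 0 := by
    refine lie_ne_zero_of_apply_coroot_neg (α := -α.1) hα.neg (hx (negRoot H α)) (hx0 _)
      (hx (negRoot H β)) (hx0 _) fun n hn => hαβ n ?_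
    rw [coroot_neg] at hn
    rw [← hn]
    change _ = -β.1 (-coroot α.1)
    rw [← Weight.toLinear_apply, ← Weight.toLinear_apply, map_neg, neg_neg]
  have h2 : ⁅x (negRoot H α), x (negRoot H β)⁆ ∈ rootSpace H (-(α.1 : H → ℂ) + -(β.1 : H → ℂ)) :=
    lie_mem_genWeightSpace_of_mem_genWeightSpace (hx (negRoot H α)) (hx (negRoot H β))
  obtain ⟨δ, a, hδ, ha⟩ := exists_root_eq_of_mem_rootSpace x hx hx0 hsum h2 h1
  have hγ : ((negRoot H δ).1 : H → ℂ) = α.1 + β.1 := by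
    change -(δ.1 : H → ℂ) = _
    rw [hδ]
    abel
  -- By invariance, its pairing with `x_{-β}` is up to sign the pairing of `x_γ` with `⁅x_{-α},
  -- x_{-β}⁆`, both nonzero vectors in opposite root spaces.
  have h3 : ⁅x (negRoot H α), x (negRoot H δ)⁆ ≠ 0 := fun h0 => by
    have h4 : killingForm ℂ 𝔤 (x (negRoot H δ)) ⁅x (negRoot H α), x (negRoot H β)⁆ ≠ 0 :=
      killingForm_root_ne_zero (α := -δ.1) (H.isNonZero_coe_root δ).neg (hx (negRoot H δ)) (hx0 _)
        (by rw [neg_neg, hδ]; exact h2) h1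
    have h5 := traceForm_lieInvariant ℂ 𝔤 𝔤 (x (negRoot H α)) (x (negRoot H δ)) (x (negRoot H β))
    rw [h0, map_zero, LinearMap.zero_apply, eq_comm, neg_eq_zero] at h5
    exact h4 h5
  have h6 : ⁅x (negRoot H α), x (negRoot H δ)⁆ ∈ rootSpace H β.1 := by
    have := lie_mem_genWeightSpace_of_mem_genWeightSpace (hx (negRoot H α)) (hx (negRoot H δ))
    rw [hγ] at this
    have e : ((negRoot H α).1 : H → ℂ) + (α.1 + β.1) = β.1 := by
      change -(α.1 : H → ℂ) + _ = _
      abel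
    rwa [e] at this
  obtain ⟨c, hc⟩ := exists_eq_smul_of_mem_rootSpace hβ (hx β) (hx0 β) h6
  refine ⟨negRoot H δ, c, fun h0 => h3 (by rw [hc, h0, zero_smul]), ?_, hc, ?_⟩
  · ext z
    exact congrFun hγ z
  · refine killingForm_apply_eq_zero_of_mem_rootSpace_of_add_ne_zero ℂ 𝔤 H (hx (negRoot H α))
      (hx (negRoot H δ)) ?_
    rw [hγ]
    change -(α.1 : H → ℂ) + _ ≠ 0
    rw [neg_add_cancel_left]
    exact hβ

/-- A choice of root vectors of a simple Lie algebra. -/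
noncomputable def rootVectorSystem {c : ℂ} (hc : ∀ x y, B.form x y = c * killingForm ℂ 𝔤 x y) :
    RootVectorSystem B H.toSubmodule H.root where
  x := x
  neg := negRoot H
  wt α := α.1.toLinear
  neg_neg := negRoot_negRoot
  wt_neg _ := rfl
  lie_toral y hy z hz := congrArg Subtype.val (trivial_lie_zero H H ⟨y, hy⟩ ⟨z, hz⟩)
  lie_x h α := lie_eq_smul_of_mem_rootSpace (hx α) h
  span_eq_top := sup_span_rootVectors_eq_top x hx hx0
  lie_x_x α β := by
    by_cases h0 : ⁅x α, x β⁆ = 0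
    · exact Or.inl h0
    have hmem : ⁅x α, x β⁆ ∈ rootSpace H ((α.1 : H → ℂ) + β.1) :=
      lie_mem_genWeightSpace_of_mem_genWeightSpace (hx α) (hx β)
    by_cases hs : (α.1 : H → ℂ) + β.1 = 0
    · refine Or.inr (Or.inl ⟨LinearMap.ext fun z => congrFun hs z, ?_⟩)
      rw [hs] at hmem
      exact mem_of_mem_rootSpace_zero hmem
    · obtain ⟨γ, a, hγ, ha⟩ := exists_root_eq_of_mem_rootSpace x hx hx0 hs hmem h0
      exact Or.inr (Or.inr ⟨γ, a, LinearMap.ext fun z => congrFun hγ z, ha⟩)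
  exists_pair α l hl := by
    -- Evaluate the vanishing total weight at the coroot of `α`: as `α` contributes `2`, the other
    -- letters cannot all contribute natural numbers.
    have hex : ∃ β ∈ l, ∀ n : ℕ, β.1 (coroot α.1) ≠ n := by
      by_contra! hcon
      have h1 : ∀ l' : List H.root, (∀ β ∈ l', ∃ n : ℕ, β.1 (coroot α.1) = n) →
          ∃ n : ℕ, (l'.map fun β => β.1.toLinear).sum (coroot α.1) = n := by
        intro l' hl'
        induction l' with
        | nil => exact ⟨0, by simp⟩
        | cons β l' ih =>
          obtain ⟨n, hn⟩ := ih fun γ hγ => hl' γ (List.mem_cons_of_mem _ hγ)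
          obtain ⟨m, hm⟩ := hl' β List.mem_cons_self
          refine ⟨m + n, ?_⟩
          rw [List.map_cons, List.sum_cons, LinearMap.add_apply, hn, Weight.toLinear_apply, hm]
          push_cast; rfl
      obtain ⟨n, hn⟩ := h1 l hcon
      have h2 : (Weight.toLinear ℂ H 𝔤 α.1) (coroot α.1) + (l.map fun β => β.1.toLinear).sum (coroot α.1) = 0 :=
        LinearMap.congr_fun hl (coroot α.1)
      rw [hn, Weight.toLinear_apply, root_apply_coroot (H.isNonZero_coe_root α)] at h2
      have : 2 + n = 0 := by exact_mod_cast h2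
      omega
    obtain ⟨β, hβ, hn⟩ := hex
    refine ⟨β, hβ, ?_⟩
    by_cases hne : β = negRoot H α
    · exact Or.inl hne
    · obtain ⟨γ, a, ha, h1, h2, h3⟩ := exists_add_root x hx hx0 hne hn
      exact Or.inr ⟨γ, a, ha, h1, h2, by rw [hc, h3, mul_zero]⟩

end System
end RootVectors
end Parafermion

/-! ### The generation theorem for a simple Lie algebra -/

namespace Parafermion
section Generation
open LieAlgebra LieAlgebra.IsKilling LieModule

variable {𝔤 : Type*} [LieRing 𝔤] [LieAlgebra ℂ 𝔤] [FiniteDimensional ℂ 𝔤] [IsSimple ℂ 𝔤]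
  {B : InvForm 𝔤} {H : LieSubalgebra ℂ 𝔤} [H.IsCartanSubalgebra]
  {b : (rootSystem H).Base} {e f : H.root → 𝔤} {k : ℕ}

lemma coroot_ne_zero (α : H.root) : (coroot α.1 : 𝔤) ≠ 0 := fun h =>
  H.isNonZero_coe_root α (coroot_eq_zero_iff.1 (Subtype.ext h))

lemma IsRootVectors.ne_zero (hef : IsRootVectors H b e f) {α : H.root} (hα : b.IsPos α) :
    e α ≠ 0 ∧ f α ≠ 0 := by
  have h := (hef α hα).2.2
  exact ⟨fun h0 => coroot_ne_zero α (by rw [← h, h0, zero_lie]),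
    fun h0 => coroot_ne_zero α (by rw [← h, h0, lie_zero])⟩

lemma IsNormalized.isLevelTriple (hB : IsNormalized B H) (hef : IsRootVectors H b e f) {α : H.root}
    (hα : b.IsPos α) : IsLevelTriple B k (rootLevel B H k α) (coroot α.1 : 𝔤) (e α) (f α) := by
  obtain ⟨he, hf, h⟩ := hef α hα
  obtain ⟨c, hc0, hc⟩ := hB.exists_eq_smul_killingForm
  have h2 := root_apply_coroot (H.isNonZero_coe_root α)
  have hα0 : (α.1 : H → ℂ) ≠ 0 := H.isNonZero_coe_root α
  have hH (z : H) : (z : 𝔤) ∈ rootSpace H (0 : H → ℂ) := by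
    rw [rootSpace_zero_eq ℂ 𝔤 H]
    exact z.2
  have hαα : (α.1 : H → ℂ) + α.1 ≠ 0 := fun h0 => hα0 (by
    funext z
    have := congrFun h0 z
    simp only [Pi.add_apply, Pi.zero_apply] at this ⊢
    linear_combination this / 2)
  refine ⟨?_, ?_, h, ?_, ?_, ?_, ?_, ?_, ?_⟩
  · rw [← h2]
    exact lie_eq_smul_of_mem_rootSpace he (coroot α.1)
  · rw [← h2]
    exact lie_eq_smul_of_mem_rootSpace hf (coroot α.1)
  · rw [hB.form_coroot, h2, rootLevel]
    ring
  · rw [hB.form_root_vectors α he hf h, rootLevel]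
  · rw [hc, killingForm_apply_eq_zero_of_mem_rootSpace_of_add_ne_zero ℂ 𝔤 H he he hαα, mul_zero]
  · rw [hc, killingForm_apply_eq_zero_of_mem_rootSpace_of_add_ne_zero ℂ 𝔤 H hf hf, mul_zero]
    rw [← neg_add]
    exact neg_ne_zero.2 hαα
  · rw [hc, killingForm_apply_eq_zero_of_mem_rootSpace_of_add_ne_zero ℂ 𝔤 H (hH _) he, mul_zero]
    rwa [zero_add]
  · rw [hc, killingForm_apply_eq_zero_of_mem_rootSpace_of_add_ne_zero ℂ 𝔤 H (hH _) hf, mul_zero]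
    rw [zero_add]
    exact neg_ne_zero.2 hα0

section Level
variable (hB : IsNormalized B H) (hk : 1 ≤ k) (α : H.root)
include hB hk

lemma IsNormalized.rootLevel_ne_zero : rootLevel B H k α ≠ 0 := by
  obtain ⟨r, hr, h⟩ := hB.rootLevel_pos α hk
  rw [h]
  exact_mod_cast hr.ne'

lemma IsNormalized.rootLevel_add_two_ne_zero : rootLevel B H k α + 2 ≠ 0 := by
  obtain ⟨r, hr, h⟩ := hB.rootLevel_pos α hk
  rw [h]
  exact_mod_cast (by positivity : r + 2 ≠ 0)

lemma IsNormalized.rootLevel_add_one_mul_ne_zero (m : ℕ) :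
    (rootLevel B H k α + 1) * (m + 1) + 1 ≠ 0 := by
  obtain ⟨r, hr, h⟩ := hB.rootLevel_pos α hk
  rw [h]
  exact_mod_cast (by positivity : (r + 1) * (m + 1) + 1 ≠ 0)

end Level

open scoped Classical in
theorem IsNormalized.vertexClosure_parafermionGenerators (hB : IsNormalized B H)
    (hef : IsRootVectors H b e f) (hk : 1 ≤ k) :
    vertexClosure B k (parafermionGenerators B H e f k b) = parafermion B k H.toSubmodule := by
  obtain ⟨c, hc0, hc⟩ := hB.exists_eq_smul_killingForm
  let x (α : H.root) : 𝔤 := if b.IsPos α then e α else f (negRoot H α)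
  have hx1 {α : H.root} (hα : b.IsPos α) : x α = e α := if_pos hα
  have hx2 {α : H.root} (hα : b.IsPos α) : x (negRoot H α) = f α := by
    have h : ¬ b.IsPos (negRoot H α) := fun h => (isPos_negRoot_iff b α).1 h hα
    change ite _ _ _ = _
    rw [if_neg h, negRoot_negRoot]
  have hx (α : H.root) : x α ∈ rootSpace H α.1 := by
    rcases isPos_or_negRoot b α with hα | hα
    · rw [hx1 hα]
      exact (hef α hα).1
    · rw [← negRoot_negRoot α, hx2 hα]
      exact (hef _ hα).2.1
  have hx0 (α : H.root) : x α ≠ 0 := by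
    rcases isPos_or_negRoot b α with hα | hα
    · rw [hx1 hα]
      exact (hef.ne_zero hα).1
    · rw [← negRoot_negRoot α, hx2 hα]
      exact (hef.ne_zero hα).2
  have hk0 : (k : ℂ) ≠ 0 := by exact_mod_cast (by omega : k ≠ 0)
  -- Any basis of `H`. Its dual basis for `B` is the dual for the Killing form divided by `c`.
  let β := Module.finBasis ℂ H
  have hT (α : H.root) (hα : b.IsPos α) :
      IsLevelTriple B k (rootLevel B H k α) (coroot α.1 : 𝔤) (x α) (x (negRoot H α)) := by
    rw [hx1 hα, hx2 hα]
    exact hB.isLevelTriple hef hα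
  rw [← (rootVectorSystem x hx hx0 hc).vertexClosure_eq_parafermion {α | b.IsPos α}
    (isPos_or_negRoot b) (fun α => (coroot α.1 : 𝔤)) (rootLevel B H k)
    (fun α _ => (coroot α.1).2) hT (fun α _ => hB.rootLevel_ne_zero hk α)
    (fun α _ => hB.rootLevel_add_two_ne_zero hk α)
    (fun α _ => hB.rootLevel_add_one_mul_ne_zero hk α) hk0
    (fun i => (β i : 𝔤)) (fun i => c⁻¹ • ((cartanEquivDual H).symm (β.coord i) : 𝔤))
    (fun i => (β i).2) (fun i => H.toSubmodule.smul_mem _ (Subtype.prop _)) ?_]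
  · congr 1
    ext v
    constructor
    · rintro ⟨α, hα, h⟩
      refine ⟨α, hα, ?_⟩
      change v = omegaVec B k _ _ (x α) (x (negRoot H α)) ∨ v = wVec B k _ _ (x α) (x (negRoot H α))
      rw [hx1 hα, hx2 hα]
      exact h
    · rintro ⟨α, hα, h⟩
      refine ⟨α, hα, ?_⟩
      change v = omegaVec B k _ _ (x α) (x (negRoot H α)) ∨
        v = wVec B k _ _ (x α) (x (negRoot H α)) at h
      rw [hx1 hα, hx2 hα] at h
      exact h
  · intro h hh
    have h1 (i) : B.form (c⁻¹ • ((cartanEquivDual H).symm (β.coord i) : 𝔤)) h = β.repr ⟨h, hh⟩ i := by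
      rw [hc, map_smul, LinearMap.smul_apply, smul_eq_mul, mul_inv_cancel_left₀ hc0]
      exact killingForm_cartanEquivDual_symm (β.coord i) ⟨h, hh⟩
    simp_rw [h1]
    have h2 := congrArg Subtype.val (β.sum_repr ⟨h, hh⟩)
    have h3 := map_sum H.toSubmodule.subtype (fun i => β.repr ⟨h, hh⟩ i • β i) Finset.univ
    exact h3.symm.trans h2

end Generation
end Parafermion

/-! ### Counting the roots -/

namespace Parafermion
section Dimension
open LieAlgebra LieAlgebra.IsKilling LieModule

variable {𝔤 : Type*} [LieRing 𝔤] [LieAlgebra ℂ 𝔤] [FiniteDimensional ℂ 𝔤] [IsSimple ℂ 𝔤]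
  {H : LieSubalgebra ℂ 𝔤} [H.IsCartanSubalgebra]

-- Take dimensions in the root space decomposition: each root space is a line, and the zero weight
-- space is `H`.
open scoped Classical in
variable (H) in
lemma card_root_add_finrank : H.root.card + Module.finrank ℂ H = Module.finrank ℂ 𝔤 := by
  have : Nontrivial 𝔤 := IsSimple.nontrivial ℂ 𝔤
  have hint : DirectSum.IsInternal fun α : Weight ℂ H 𝔤 => (rootSpace H α).toSubmodule :=
    DirectSum.isInternal_submodule_of_iSupIndep_of_iSup_eq_top
      (LieSubmodule.iSupIndep_toSubmodule.2 (iSupIndep_genWeightSpace' ℂ H 𝔤)) iSup_rootSpace_eq_top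
  rw [← (LinearEquiv.ofBijective (DirectSum.coeLinearMap
      fun α : Weight ℂ H 𝔤 => (rootSpace H α).toSubmodule) hint).finrank_eq, Module.finrank_directSum,
    ← Finset.sum_filter_add_sum_filter_not Finset.univ fun α : Weight ℂ H 𝔤 => α.IsNonZero]
  congr 1
  · have h1 (α : Weight ℂ H 𝔤) (hα : α ∈ Finset.univ.filter fun α : Weight ℂ H 𝔤 => α.IsNonZero) :
        Module.finrank ℂ (rootSpace H α).toSubmodule = 1 :=
      finrank_rootSpace_eq_one α (Finset.mem_filter.1 hα).2
    rw [Finset.sum_congr rfl h1, Finset.sum_const, smul_eq_mul, mul_one]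
  · have h0 : (Finset.univ.filter fun α : Weight ℂ H 𝔤 => ¬ α.IsNonZero) = {0} := by
      ext α
      simp only [Finset.mem_filter, Finset.mem_univ, true_and, not_not, Finset.mem_singleton]
      exact ⟨fun h => Weight.ext fun z => congrFun h z, fun h => h ▸ Weight.isZero_zero⟩
    rw [h0, Finset.sum_singleton]
    have h1 : (rootSpace H (0 : Weight ℂ H 𝔤)).toSubmodule = H.toSubmodule := by
      rw [FunLike.coe_zero, rootSpace_zero_eq ℂ 𝔤 H]
      rfl
    rw [h1]
    rfl

lemma card_root (b : (rootSystem H).Base) : H.root.card = 2 * Nat.card {α : H.root // b.IsPos α} := by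
  classical
  have e : {α : H.root // b.IsPos α} ≃ {α : H.root // ¬ b.IsPos α} :=
    { toFun := fun α => ⟨negRoot H α, fun h => (isPos_negRoot_iff b α.1).1 h α.2⟩
      invFun := fun α => ⟨negRoot H α, (isPos_negRoot_iff b α.1).2 α.2⟩
      left_inv := fun α => Subtype.ext (negRoot_negRoot _)
      right_inv := fun α => Subtype.ext (negRoot_negRoot _) }
  rw [← Nat.card_eq_finsetCard, Nat.card_congr (Equiv.sumCompl fun α : H.root => b.IsPos α).symm,
    Nat.card_sum, ← Nat.card_congr e, two_mul]

end Dimension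

/-! ### Evaluation of vectors of `V(k,0)` at characters of the negative part -/

section Evaluation
open UniversalEnvelopingAlgebra

variable {𝔤 : Type*} [LieRing 𝔤] [LieAlgebra ℂ 𝔤] (B : InvForm 𝔤) (k : ℂ)

attribute [local instance 100] LieRing.ofAssociativeRing in
/-- Every linear form on `𝔤` gives a multiplicative evaluation of the products of the operators
`x(-1)` applied to the vacuum, which vanishes on the images of all `x(n)` with `n ≤ -2`. -/
lemma exists_evaluation (η : 𝔤 →ₗ[ℂ] ℂ) :
    ∃ Φ : VacuumModule B k →ₗ[ℂ] ℂ, Φ (vacuum B k) = 1 ∧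
      (∀ x v, Φ (modeEnd B k x (-1) v) = η x * Φ v) ∧
      ∀ x (n : ℤ), n < -1 → ∀ v, Φ (modeEnd B k x n v) = 0 := by
  let F : Affine B →ₗ[ℂ] ℂ := affineLift B (fun n => if n = -1 then η else 0) 0
  -- Brackets in the negative part have degree at most `-2`, while `F` sees only degree `-1`. So `F`
  -- restricts to a character of the negative part and extends multiplicatively to its enveloping
  -- algebra.
  have hF (z w : Affine B) (hz : z ∈ negPart B) (hw : w ∈ negPart B) : F ⁅z, w⁆ = 0 := by
    change z ∈ Submodule.span ℂ _ at hz
    change w ∈ Submodule.span ℂ _ at hw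
    induction hz, hw using Submodule.span_induction₂ with
    | zero_left => rw [zero_lie, map_zero]
    | zero_right => rw [lie_zero, map_zero]
    | add_left x y z _ _ _ h1 h2 => rw [add_lie, map_add, h1, h2, add_zero]
    | add_right x y z _ _ _ h1 h2 => rw [lie_add, map_add, h1, h2, add_zero]
    | smul_left r x y _ _ h => rw [smul_lie, map_smul, h, smul_zero]
    | smul_right r x y _ _ h => rw [lie_smul, map_smul, h, smul_zero]
    | mem_mem x y hx hy =>
      obtain ⟨m, x, hm, rfl⟩ := hx
      obtain ⟨n, y, hn, rfl⟩ := hy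
      rw [lie_loopElt, if_neg (by omega), zero_smul, add_zero, affineLift_loopElt,
        if_neg (by omega), LinearMap.zero_apply]
  let G : negPart B →ₗ⁅ℂ⁆ ℂ :=
    { F ∘ₗ (negPart B).toSubmodule.subtype with
      map_lie' := fun {z w} => by
        rw [LieRing.of_associative_ring_bracket, mul_comm, sub_self]
        exact hF z w z.2 w.2 }
  have hG (n : ℤ) (hn : n < 0) (x : 𝔤) : G (negElt B n hn x) = if n = -1 then η x else 0 := by
    change F (loopElt B n x) = _
    rw [affineLift_loopElt]
    split_ifs <;> rfl
  obtain ⟨θ, h1, h2⟩ := exists_realization B k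
  refine ⟨(lift ℂ G).toLinearMap ∘ₗ θ, ?_, fun x v => ?_, fun x n hn v => ?_⟩
  · change lift ℂ G (θ _) = 1
    rw [h1, map_one]
  · change lift ℂ G (θ _) = η x * lift ℂ G (θ v)
    rw [h2 (-1) (by norm_num), map_mul, lift_ι_apply, hG, if_pos rfl]
  · change lift ℂ G (θ _) = 0
    rw [h2 n (by omega), map_mul, lift_ι_apply, hG, if_neg (by omega), zero_mul]

variable {B k} {η : 𝔤 →ₗ[ℂ] ℂ} {Φ : VacuumModule B k →ₗ[ℂ] ℂ} (h1 : Φ (vacuum B k) = 1)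
  (h2 : ∀ x v, Φ (modeEnd B k x (-1) v) = η x * Φ v)
  (h3 : ∀ x (n : ℤ), n < -1 → ∀ v, Φ (modeEnd B k x n v) = 0)
include h1 h2 h3

lemma evaluation_omegaVec (κ : ℂ) (h e f : 𝔤) : Φ (omegaVec B k κ h e f) =
    1 / (2 * κ * (κ + 2)) * (2 * κ * (η e * η f) - η h ^ 2) := by
  simp only [omegaVec, map_smul, map_add, map_sub, map_neg, h2, h3 _ (-2) (by norm_num), h1,
    smul_eq_mul]
  ring

lemma evaluation_wVec (κ : ℂ) (h e f : 𝔤) : Φ (wVec B k κ h e f) =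
    2 * η h ^ 3 - 6 * κ * (η h * (η e * η f)) := by
  simp only [wVec, map_smul, map_add, map_sub, h2, h3 _ (-2) (by norm_num),
    h3 _ (-3) (by norm_num), h1, smul_eq_mul]
  ring

end Evaluation
end Parafermion

/-! ### The generators are pairwise distinct -/

namespace Parafermion
section Distinct
open LieAlgebra LieAlgebra.IsKilling LieModule

variable {𝔤 : Type*} [LieRing 𝔤] [LieAlgebra ℂ 𝔤] [FiniteDimensional ℂ 𝔤] [IsSimple ℂ 𝔤]
  {B : InvForm 𝔤} {H : LieSubalgebra ℂ 𝔤} [H.IsCartanSubalgebra]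
  {b : (rootSystem H).Base} {e f : H.root → 𝔤} {k : ℕ}

variable (hB : IsNormalized B H)
include hB

lemma IsNormalized.form_eq_zero {χ ψ : H → ℂ} (h : χ + ψ ≠ 0) {x y : 𝔤} (hx : x ∈ rootSpace H χ)
    (hy : y ∈ rootSpace H ψ) : B.form x y = 0 := by
  obtain ⟨c, -, hc⟩ := hB.exists_eq_smul_killingForm
  rw [hc, killingForm_apply_eq_zero_of_mem_rootSpace_of_add_ne_zero ℂ 𝔤 H hx hy h, mul_zero]

/-- Linear forms that separate the root vectors of one positive root from all others. -/
lemma IsNormalized.exists_separating_form (hef : IsRootVectors H b e f) {α : H.root}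
    (hα : b.IsPos α) (hk : 1 ≤ k) :
    ∃ s r : ℂ, s ≠ 0 ∧ r ≠ 0 ∧ ∀ a t : ℂ, ∃ η : 𝔤 →ₗ[ℂ] ℂ, η (e α) = a * s ∧ η (f α) = a * s ∧
      η (coroot α.1 : 𝔤) = t * r ∧ (∀ h : H, η h = t * B.form (coroot α.1) h) ∧
      ∀ β : H.root, b.IsPos β → α ≠ β → η (e β) = 0 ∧ η (f β) = 0 := by
  have T := hB.isLevelTriple (k := k) hef hα
  have hκ := hB.rootLevel_ne_zero hk α
  obtain ⟨he, hf, -⟩ := hef α hα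
  have hH (z : H) : (z : 𝔤) ∈ rootSpace H (0 : H → ℂ) := by
    rw [rootSpace_zero_eq ℂ 𝔤 H]
    exact z.2
  have h0 (β : H.root) : (β.1 : H → ℂ) ≠ 0 := H.isNonZero_coe_root β
  have hez (z : H) : B.form (e α) z = 0 :=
    hB.form_eq_zero (by rw [add_zero]; exact h0 α) he (hH z)
  have hfz (z : H) : B.form (f α) z = 0 :=
    hB.form_eq_zero (by rw [add_zero]; exact neg_ne_zero.2 (h0 α)) hf (hH z)
  -- The form `η` is the pairing with `a (e_α + f_α) + t h_α`. It kills the root vectors of every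
  -- other positive root because root spaces that are not opposite are orthogonal.
  refine ⟨B.form (e α) (f α), B.form (coroot α.1) (coroot α.1), fun h => hκ ?_, fun h => hκ ?_,
    fun a t => ⟨B.form (a • (e α + f α) + t • (coroot α.1 : 𝔤)), ?_, ?_, ?_, fun z => ?_,
      fun β hβ hne => ?_⟩⟩
  · rw [← T.form_e_f, h, zero_mul]
  · have := T.form_h_h
    rw [h, zero_mul] at this
    linear_combination -this / 2
  · have h1 : B.form (f α) (e α) = B.form (e α) (f α) := B.symm.eq _ _
    simp only [map_add, map_smul, LinearMap.add_apply, LinearMap.smul_apply, smul_eq_mul, h1,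
      T.form_e_e, T.form_h_e]
    ring
  · simp only [map_add, map_smul, LinearMap.add_apply, LinearMap.smul_apply, smul_eq_mul,
      T.form_f_f, T.form_h_f]
    ring
  · simp only [map_add, map_smul, LinearMap.add_apply, LinearMap.smul_apply, smul_eq_mul, hez, hfz]
    ring
  · simp only [map_add, map_smul, LinearMap.add_apply, LinearMap.smul_apply, smul_eq_mul, hez, hfz]
    ring
  · obtain ⟨he', hf', -⟩ := hef β hβ
    have hadd : (α.1 : H → ℂ) + β.1 ≠ 0 := fun h => by
      have : β = negRoot H α := Subtype.ext (Weight.ext fun z => by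
        have := congrFun h z
        change β.1 z = -α.1 z
        simp only [Pi.add_apply, Pi.zero_apply] at this
        linear_combination this)
      rw [this] at hβ
      exact (isPos_negRoot_iff b α).1 hβ hα
    have hsub : (α.1 : H → ℂ) + -β.1 ≠ 0 := fun h => hne (Subtype.ext (Weight.ext fun z => by
      have := congrFun h z
      simp only [Pi.add_apply, Pi.neg_apply, Pi.zero_apply] at this
      linear_combination this))
    have h1 : B.form (e α) (e β) = 0 := hB.form_eq_zero hadd he he'
    have h2 : B.form (e α) (f β) = 0 := hB.form_eq_zero hsub he hf'
    have h3 : B.form (f α) (e β) = 0 :=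
      hB.form_eq_zero (fun h => hsub (by rw [← neg_eq_zero, ← h]; abel)) hf he'
    have h4 : B.form (f α) (f β) = 0 :=
      hB.form_eq_zero (fun h => hadd (by rw [← neg_eq_zero, ← h]; abel)) hf hf'
    have h5 : B.form (coroot α.1) (e β) = 0 :=
      hB.form_eq_zero (by rw [zero_add]; exact h0 β) (hH _) he'
    have h6 : B.form (coroot α.1) (f β) = 0 :=
      hB.form_eq_zero (by rw [zero_add]; exact neg_ne_zero.2 (h0 β)) (hH _) hf'
    simp only [map_add, map_smul, LinearMap.add_apply, LinearMap.smul_apply, smul_eq_mul, h1, h2,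
      h3, h4, h5, h6, add_zero, mul_zero, and_self]

/-- With `a = 1`, `t = 0` the evaluation of `ω_β` is zero, whereas that of `ω_α` is a nonzero
multiple of `s²`. -/
lemma IsNormalized.omegaRoot_injOn (hef : IsRootVectors H b e f) (hk : 1 ≤ k) {α β : H.root}
    (hα : b.IsPos α) (hβ : b.IsPos β)
    (h : omegaRoot B H e f k α = omegaRoot B H e f k β) : α = β := by
  by_contra hne
  obtain ⟨s, r, hs, hr, hη⟩ := hB.exists_separating_form hef hα hk
  obtain ⟨η, he, hf, -, hz, hβ'⟩ := hη 1 0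
  obtain ⟨Φ, h1, h2, h3⟩ := exists_evaluation B k η
  have hκ := hB.rootLevel_ne_zero hk α
  have hκ2 := hB.rootLevel_add_two_ne_zero hk α
  have := congrArg Φ h
  rw [omegaRoot, omegaRoot, evaluation_omegaVec h1 h2 h3, evaluation_omegaVec h1 h2 h3, he, hf,
    hz, hz, (hβ' β hβ hne).1, (hβ' β hβ hne).2] at this
  field_simp at this
  simp [hs, hκ] at this

/-- With `t = 0` the form `η` vanishes on `H`. Every surviving term of `W³` contains a factor from
`H`, but the term `e(-1)f(-1)𝟙` of `ω_α` does not. -/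
lemma IsNormalized.omegaRoot_ne_wRoot (hef : IsRootVectors H b e f) (hk : 1 ≤ k) {α : H.root}
    (hα : b.IsPos α) (β : H.root) : omegaRoot B H e f k α ≠ wRoot B H e f k β := by
  intro h
  obtain ⟨s, r, hs, hr, hη⟩ := hB.exists_separating_form hef hα hk
  obtain ⟨η, he, hf, -, hz, -⟩ := hη 1 0
  obtain ⟨Φ, h1, h2, h3⟩ := exists_evaluation B k η
  have hκ := hB.rootLevel_ne_zero hk α
  have hκ2 := hB.rootLevel_add_two_ne_zero hk α
  have := congrArg Φ h
  rw [omegaRoot, wRoot, evaluation_omegaVec h1 h2 h3, evaluation_wVec h1 h2 h3, he, hf,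
    hz, hz] at this
  field_simp at this
  simp [hs, hκ] at this

/-- Here `t = 1` is needed to see the mixed term. The evaluation of `W³_α` then varies with `a`,
that of `W³_β` does not, and comparing `a = 0` with `a = 1` gives the contradiction. -/
lemma IsNormalized.wRoot_injOn (hef : IsRootVectors H b e f) (hk : 1 ≤ k) {α β : H.root}
    (hα : b.IsPos α) (hβ : b.IsPos β)
    (h : wRoot B H e f k α = wRoot B H e f k β) : α = β := by
  by_contra hne
  obtain ⟨s, r, hs, hr, hη⟩ := hB.exists_separating_form hef hα hk
  have hκ := hB.rootLevel_ne_zero hk α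
  have key (a : ℂ) : 2 * r ^ 3 - 6 * rootLevel B H k α * (r * (a * s * (a * s))) =
      2 * (B.form (coroot α.1) (coroot β.1)) ^ 3 := by
    obtain ⟨η, he, hf, hc, hz, hβ'⟩ := hη a 1
    obtain ⟨Φ, h1, h2, h3⟩ := exists_evaluation B k η
    have := congrArg Φ h
    rw [wRoot, wRoot, evaluation_wVec h1 h2 h3, evaluation_wVec h1 h2 h3, he, hf, hc, hz,
      (hβ' β hβ hne).1, (hβ' β hβ hne).2] at this
    linear_combination this
  have h0 : rootLevel B H k α * r * s ^ 2 = 0 := by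
    linear_combination (key 0 - key 1) / 6
  simp [hκ, hr, hs] at h0

theorem IsNormalized.ncard_parafermionGenerators (hef : IsRootVectors H b e f) (hk : 1 ≤ k) :
    (parafermionGenerators B H e f k b).ncard + Module.finrank ℂ H = Module.finrank ℂ 𝔤 := by
  let g : {α : H.root // b.IsPos α} × Bool → VacuumModule B k := fun p =>
    if p.2 then omegaRoot B H e f k p.1 else wRoot B H e f k p.1
  have hg : Function.Injective g := by
    rintro ⟨⟨α, hα⟩, i⟩ ⟨⟨β, hβ⟩, j⟩ h
    cases i <;> cases j
    · obtain rfl := hB.wRoot_injOn hef hk hα hβ h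
      rfl
    · exact absurd h.symm (hB.omegaRoot_ne_wRoot hef hk hβ α)
    · exact absurd h (hB.omegaRoot_ne_wRoot hef hk hα β)
    · obtain rfl := hB.omegaRoot_injOn hef hk hα hβ h
      rfl
  have hrange : parafermionGenerators B H e f k b = Set.range g := by
    ext v
    constructor
    · rintro ⟨α, hα, rfl | rfl⟩
      · exact ⟨(⟨α, hα⟩, true), rfl⟩
      · exact ⟨(⟨α, hα⟩, false), rfl⟩
    · rintro ⟨⟨⟨α, hα⟩, i⟩, rfl⟩
      cases i
      · exact ⟨α, hα, Or.inr rfl⟩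
      · exact ⟨α, hα, Or.inl rfl⟩
  rw [hrange, Set.ncard_range_of_injective hg, Nat.card_prod, Nat.card_eq_fintype_card (α := Bool),
    Fintype.card_bool, mul_comm, ← card_root b, card_root_add_finrank]

end Distinct
end Parafermion

theorem theorem3p1 {𝔤 : Type*} [LieRing 𝔤] [LieAlgebra ℂ 𝔤] [FiniteDimensional ℂ 𝔤]
    [LieAlgebra.IsSimple ℂ 𝔤] (H : LieSubalgebra ℂ 𝔤) [H.IsCartanSubalgebra]
    (B : Parafermion.InvForm 𝔤) (hB : Parafermion.IsNormalized B H)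
    (b : (LieAlgebra.IsKilling.rootSystem H).Base)
    (e f : H.root → 𝔤) (hef : Parafermion.IsRootVectors H b e f) (k : ℕ) (hk : 1 ≤ k) :
    -- the vectors `ω_α` and `W³_α`, which are `dim 𝔤 - l` in number, generate `N(𝔤, k)`
    ((Parafermion.parafermionGenerators B H e f k b).ncard + Module.finrank ℂ H =
        Module.finrank ℂ 𝔤 ∧
      Parafermion.vertexClosure B k (Parafermion.parafermionGenerators B H e f k b) =
        Parafermion.parafermion B k H.toSubmodule) ∧
    -- the subalgebras `P̂_α` generate `N(𝔤, k)`
    Parafermion.vertexClosure B k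
        {v | ∃ α : H.root, b.IsPos α ∧ v ∈ Parafermion.rootSubalgebra B H e f k α} =
      Parafermion.parafermion B k H.toSubmodule ∧
    -- each `P̂_α`, with conformal vector `ω_α`, is isomorphic to `N(sl₂, k_α)`
    ∀ α : H.root, b.IsPos α →
      ∃ φ : Parafermion.rootSubalgebra B H e f k α ≃ₗ[ℂ]
          Parafermion.parafermionSl2 (Parafermion.rootLevel B H k α),
        Parafermion.IsVOAIso φ (Parafermion.omegaRoot B H e f k α)
          (Parafermion.conformalSl2 (Parafermion.rootLevel B H k α)) := by
  have hk0 : (k : ℂ) ≠ 0 := by exact_mod_cast (by omega : k ≠ 0)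
  have hgen := hB.vertexClosure_parafermionGenerators hef hk
  refine ⟨⟨hB.ncard_parafermionGenerators hef hk, hgen⟩, ?_, fun α hα =>
    (hB.isLevelTriple hef hα).exists_isVOAIso hk0 (hB.rootLevel_ne_zero hk α)
      (hB.rootLevel_add_two_ne_zero hk α) (hB.rootLevel_add_one_mul_ne_zero hk α)⟩
  rw [← hgen]
  refine le_antisymm (Parafermion.vertexClosure_le
    (Parafermion.isVertexSubalgebra_vertexClosure _) ?_) (Parafermion.vertexClosure_le
    (Parafermion.isVertexSubalgebra_vertexClosure _) ?_)
  · rintro v ⟨α, hα, hv⟩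
    refine Parafermion.vertexClosure_le (Parafermion.isVertexSubalgebra_vertexClosure _) ?_ hv
    exact fun u hu => Parafermion.subset_vertexClosure _ ⟨α, hα, hu⟩
  · rintro v ⟨α, hα, hv⟩
    exact Parafermion.subset_vertexClosure _ ⟨α, hα, Parafermion.subset_vertexClosure _ hv⟩
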